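/- Let $(\mathscr C,0)\subset(\mathbb C^n,0)$ be a germ of generically reduced complex analytic curve (a germ of analytic space of dimension one, with ideal $I\subset\mathcal O_n=\mathbb C\{x_1,\dots,x_n\}$, having a representative that is reduced at every point other than $0$). Let $(\mathscr C^1,0),\dots,(\mathscr C^r,0)$ be its branches (the irreducible germs defined by the distinct minimal primes of $I$) and suppose $r\ge 2$. Let $C_5(\mathscr C,0)\subset\mathbb C^n$ be the set of limits of $\lambda_k(x_k-y_k)$ with $\lambda_k\in\mathbb C$ and $x_k,y_k$ points of a representative of $\mathscr C$ tending to $0$. Let $\pi:\mathbb C^n\to\mathbb C^2$ be any surjective linear map which is $C_5$-generic for $\mathscr C$, that is, $\ker\pi\cap C_5(\mathscr C,0)=\{0\}$, and let $\tilde{\mathscr C}^i=\pi(\mathscr C^i)$ be the image of $\mathscr C^i$ with its reduced structure. The $s$-invariant of $\mathscr C$ is $$s(\mathscr C,0)=\sum_{1\le i<j\le r} i(\tilde{\mathscr C}^i,\tilde{\mathscr C}^j,0),$$ where $i(\tilde{\mathscr C}^i,\tilde{\mathscr C}^j,0)=\dim_{\mathbb C}\mathcal O_2/(f_i,f_j)$,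 with $(f_i)$ the ideal of $\tilde{\mathscr C}^i$, is the intersection multiplicity of plane curves. Let $m(\mathscr C^i,0)$ be the Hilbert–Samuel multiplicity of the maximal ideal of the local ring of $\mathscr C^i$ at $0$. Then $s(\mathscr C,0)$ is finite for every such $\pi$, and: (a) $\displaystyle s(\mathscr C,0)\ \ge\ \sum_{1\le i<j\le r} m(\mathscr C^i,0)\,m(\mathscr C^j,0)$; (b) equality holds in (a) if and only if, for all $i\ne j$, the branches $\mathscr C^i$ and $\mathscr C^j$ have no common tangent line at $0$ (a tangent line of a germ being a line through $0$ contained in its tangent cone, the set of limits of $\lambda_k x_k$ with $\lambda_k\in\mathbb C$ and $x_k\to0$ points of a representative of the germ). -/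

import Mathlib

open Filter Topology
open scoped ENNReal

namespace CurveGerm

/-! ### Germs of holomorphic functions -/

/-- The germs at `a` of functions that are holomorphic near `a`, as a subring of all germs. -/
def holGermSubring {n : ℕ} (a : Fin n → ℂ) : Subring (Germ (𝓝 a) ℂ) where
  carrier := {u | ∃ f : (Fin n → ℂ) → ℂ, AnalyticAt ℂ f a ∧ u = (f : Germ (𝓝 a) ℂ)}
  mul_mem' := by
    rintro _ _ ⟨f, hf, rfl⟩ ⟨g, hg, rfl⟩
    exact ⟨f * g, hf.mul hg, rfl⟩
  one_mem' := ⟨fun _ => 1, analyticAt_const, rfl⟩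
  add_mem' := by
    rintro _ _ ⟨f, hf, rfl⟩ ⟨g, hg, rfl⟩
    exact ⟨f + g, hf.add hg, rfl⟩
  zero_mem' := ⟨fun _ => 0, analyticAt_const, rfl⟩
  neg_mem' := by
    rintro _ ⟨f, hf, rfl⟩
    exact ⟨-f, hf.neg, rfl⟩

/-- The local ring of germs of holomorphic functions on `(ℂⁿ, a)`. -/
abbrev HolGerm {n : ℕ} (a : Fin n → ℂ) : Type := holGermSubring a

/-- The ring `𝒪ₙ = ℂ{x₁, …, xₙ}` of germs of holomorphic functions on `(ℂⁿ, 0)`. -/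
abbrev O (n : ℕ) : Type := HolGerm (0 : Fin n → ℂ)

/-- The constant germs. -/
noncomputable def constHom {n : ℕ} (a : Fin n → ℂ) : ℂ →+* HolGerm a where
  toFun c := ⟨((fun _ => c : (Fin n → ℂ) → ℂ) : Germ (𝓝 a) ℂ), fun _ => c, analyticAt_const, rfl⟩
  map_one' := rfl
  map_mul' _ _ := rfl
  map_zero' := rfl
  map_add' _ _ := rfl

noncomputable instance {n : ℕ} (a : Fin n → ℂ) : Algebra ℂ (HolGerm a) := (constHom a).toAlgebra

/-- The maximal ideal of `𝒪ₙ`: the germs that vanish at the origin. -/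
noncomputable def maxIdeal (n : ℕ) : Ideal (O n) :=
  RingHom.ker ((Germ.valueRingHom (x := (0 : Fin n → ℂ)) (E := ℂ)).comp
    (holGermSubring (0 : Fin n → ℂ)).subtype)

/-- The homomorphism `π^* : 𝒪ₘ → 𝒪ₙ`, `f ↦ f ∘ π`, for a linear map `π : ℂⁿ → ℂᵐ`. -/
noncomputable def pullback {n m : ℕ} (π : (Fin n → ℂ) →L[ℂ] (Fin m → ℂ)) : O m →+* O n where
  toFun u := ⟨(u : Germ (𝓝 (0 : Fin m → ℂ)) ℂ).compTendsto π
      (by simpa using π.continuous.tendsto 0), by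
    obtain ⟨_, f, hf, rfl⟩ := u
    have h : AnalyticAt ℂ f (π 0) := by simpa using hf
    exact ⟨f ∘ π, h.comp (π.analyticAt 0), rfl⟩⟩
  map_one' := rfl
  map_mul' := by
    rintro ⟨_, f, hf, rfl⟩ ⟨_, g, hg, rfl⟩
    rfl
  map_zero' := rfl
  map_add' := by
    rintro ⟨_, f, hf, rfl⟩ ⟨_, g, hg, rfl⟩
    rfl

/-! ### Germs of analytic spaces and of curves

A germ of analytic space `(X, 0) ⊆ (ℂⁿ, 0)` is given by its ideal `I ⊆ 𝒪ₙ`; its local ring is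
`𝒪ₙ / I`. -/

/-- The ideal generated by the germs at `a` of a family of functions. -/
noncomputable def idealAt {n k : ℕ} (f : Fin k → (Fin n → ℂ) → ℂ) (a : Fin n → ℂ) : Ideal (HolGerm a) :=
  Ideal.span {u | ∃ i, (u : Germ (𝓝 a) ℂ) = (f i : Germ (𝓝 a) ℂ)}

/-- `f₁, …, fₖ` are holomorphic on the open neighbourhood `U` of `0` and their germs at `0`
generate `I`, so that they define a representative in `U` of the germ with ideal `I`. -/
structure IsModel {n k : ℕ} (I : Ideal (O n)) (U : Set (Fin n → ℂ))
    (f : Fin k → (Fin n → ℂ) → ℂ) : Prop where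
  isOpen : IsOpen U
  zero_mem : (0 : Fin n → ℂ) ∈ U
  analytic : ∀ i, AnalyticOnNhd ℂ (f i) U
  span_eq : idealAt f 0 = I

/-- `W` is (the underlying set of) a representative of the germ with ideal `I`. -/
def IsRepresentative {n : ℕ} (I : Ideal (O n)) (W : Set (Fin n → ℂ)) : Prop :=
  ∃ (k : ℕ) (U : Set (Fin n → ℂ)) (f : Fin k → (Fin n → ℂ) → ℂ),
    IsModel I U f ∧ W = {x ∈ U | ∀ i, f i x = 0}

/-- `I` is the ideal of a germ of generically reduced curve: the germ has dimension one and has a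
representative which is reduced at each of its points other than the origin. -/
def IsGenericallyReducedCurve {n : ℕ} (I : Ideal (O n)) : Prop :=
  ringKrullDim (O n ⧸ I) = 1 ∧
    ∃ (k : ℕ) (U : Set (Fin n → ℂ)) (f : Fin k → (Fin n → ℂ) → ℂ),
      IsModel I U f ∧ ∀ a ∈ U, a ≠ 0 → (idealAt f a).IsRadical

/-! ### Tangents, the cone `C₅` and generic projections -/

/-- The tangent cone at `0` of the germ with ideal `I`, as a set: the limits of `λₖ xₖ` with
`xₖ → 0` in a representative and `λₖ ∈ ℂ`. -/
def tangentCone {n : ℕ} (I : Ideal (O n)) : Set (Fin n → ℂ) :=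
  {v | ∃ W, IsRepresentative I W ∧ ∃ (x : ℕ → Fin n → ℂ) (c : ℕ → ℂ),
    (∀ k, x k ∈ W) ∧ Tendsto x atTop (𝓝 0) ∧ Tendsto (fun k => c k • x k) atTop (𝓝 v)}

/-- The line `L` through the origin is a tangent line of the germ with ideal `I`. -/
def IsTangentLine {n : ℕ} (I : Ideal (O n)) (L : Submodule ℂ (Fin n → ℂ)) : Prop :=
  Module.finrank ℂ L = 1 ∧ (L : Set (Fin n → ℂ)) ⊆ tangentCone I

/-- The cone `C₅` of the germ with ideal `I`: the limits of `λₖ (xₖ - yₖ)` with `xₖ → 0`, `yₖ → 0`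
in a representative and `λₖ ∈ ℂ`. -/
def coneC5 {n : ℕ} (I : Ideal (O n)) : Set (Fin n → ℂ) :=
  {v | ∃ W, IsRepresentative I W ∧ ∃ (x y : ℕ → Fin n → ℂ) (c : ℕ → ℂ),
    (∀ k, x k ∈ W) ∧ (∀ k, y k ∈ W) ∧ Tendsto x atTop (𝓝 0) ∧ Tendsto y atTop (𝓝 0) ∧
      Tendsto (fun k => c k • (x k - y k)) atTop (𝓝 v)}

/-- The linear projection `π : ℂⁿ → ℂ²` is `C₅`-generic for the germ with ideal `I`. -/
def IsC5Generic {n : ℕ} (I : Ideal (O n)) (π : (Fin n → ℂ) →L[ℂ] (Fin 2 → ℂ)) : Prop :=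
  Function.Surjective π ∧ {v | π v = 0} ∩ coneC5 I = {0}

/-- The ideal of the image, with reduced structure when `P` is prime, of the germ with ideal `P`
under the linear map `π : ℂⁿ → ℂ²`. -/
noncomputable def imageIdeal {n : ℕ} (π : (Fin n → ℂ) →L[ℂ] (Fin 2 → ℂ)) (P : Ideal (O n)) :
    Ideal (O 2) :=
  P.comap (pullback π)

/-! ### Multiplicities -/

/-- The dimension of a complex vector space, in `ℕ ∪ {∞}`. -/
noncomputable def dimC (V : Type) [AddCommGroup V] [Module ℂ V] : ℕ∞ :=
  Cardinal.toENat (Module.rank ℂ V)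

/-- The Hilbert–Samuel multiplicity `lim d! · dim (R / 𝔪ᵏ) / kᵈ` of the maximal ideal `𝔪` of a
`d`-dimensional local `ℂ`-algebra `R` with residue field `ℂ`. -/
noncomputable def hilbertSamuelMultiplicity (R : Type) [CommRing R] [Algebra ℂ R] (𝔪 : Ideal R)
    (d : ℕ) : ℝ≥0∞ :=
  limsup (fun k : ℕ => (d.factorial : ℝ≥0∞) * (dimC (R ⧸ 𝔪 ^ k) : ℝ≥0∞) / (k : ℝ≥0∞) ^ d) atTop

/-- The multiplicity at `0` of the germ of curve with ideal `P`. -/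
noncomputable def multiplicity {n : ℕ} (P : Ideal (O n)) : ℝ≥0∞ :=
  hilbertSamuelMultiplicity (O n ⧸ P) ((maxIdeal n).map (Ideal.Quotient.mk P)) 1

/-- The intersection multiplicity at `0` of two germs of plane curves with ideals `J = (f)` and
`J' = (g)`, that is, `dim 𝒪₂ / (f, g)`. -/
noncomputable def intersectionMultiplicity (J J' : Ideal (O 2)) : ℕ∞ :=
  dimC (O 2 ⧸ (J ⊔ J'))

/-- The `s`-invariant of a germ of curve with branches `P₁, …, Pᵣ`, computed with the projection
`π`. -/
noncomputable def sInvariant {n r : ℕ} (P : Fin r → Ideal (O n))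
    (π : (Fin n → ℂ) →L[ℂ] (Fin 2 → ℂ)) : ℕ∞ :=
  ∑ p : Fin r × Fin r with p.1 < p.2,
    intersectionMultiplicity (imageIdeal π (P p.1)) (imageIdeal π (P p.2))

end CurveGerm

namespace CurveGerm

section

/-! ### Germs of holomorphic functions of one variable -/

/-! Both statements reduce to a computation for one pair of branches `P`, `Q`, followed by summation
over pairs.

A minimal prime of a one-dimensional germ is a prime of coheight one. Newton-Puiseux gives it an
injective parametrization `φ(t) = tᵐ v(t)` with `v(0) ≠ 0`, whose restriction map `O n → ℂ{t}` has
kernel `P` (`O.IsCurvePrime.exists_isParam`). The tangent cone is the line `ℂ v(0)`.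

Genericity of `π` acts in three ways. By compactness of unit secants, `π` is injective on a small
representative (`exists_injOn_of_isRepresentative`). Tangent vectors lie in `C₅`, so `π v(0) ≠ 0`.
Differences of tangent vectors of two branches lie in `C₅` as well, so distinct ones have distinct
images. After a shear of the plane and a change of parameter the two images become `(tᵐ, tᵐ c(t))`
and `(tᵐ', tᵐ' c'(t))`, and injectivity makes these parametrizations primitive.

Let `f` be the product of `y - xc` over the rotations of `t` by `m`-th roots of unity. It generates
the ideal of the first image (`IsPlaneBranch.exists_ker_eq`), and the intersection number `d` is the
order of `f` along the second image. After `t ↦ tᵐ` this order becomes `m d = m · m m' + ord ∏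
(c'(tᵐ) - c(ζᵏ tᵐ'))`. Every factor takes the value `c'(0) - c(0)` at `0`, so `d ≥ m m'`, with
equality exactly when `c(0) ≠ c'(0)`, that is, when the tangents differ
(`IsPlaneBranch.intersectionMultiplicity_eq`).

The image of `O 2`, hence that of `O n`, has finite codimension in `ℂ{t}`. Comparing lengths there
shows that the multiplicity of the branch is `m` (`IsTangentParam.multiplicity_eq`).

The analytic tools are division with remainder, obtained from a contraction on `ℓ¹`, and Hensel's
lemma, obtained from the inverse function theorem. -/

/-- The germs at `0` of functions of one complex variable that are holomorphic near `0`. -/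
def lineGermSubring : Subring (Germ (𝓝 (0 : ℂ)) ℂ) where
  carrier := {u | ∃ f : ℂ → ℂ, AnalyticAt ℂ f 0 ∧ u = (f : Germ (𝓝 (0 : ℂ)) ℂ)}
  mul_mem' := by
    rintro _ _ ⟨f, hf, rfl⟩ ⟨g, hg, rfl⟩
    exact ⟨f * g, hf.mul hg, rfl⟩
  one_mem' := ⟨fun _ => 1, analyticAt_const, rfl⟩
  add_mem' := by
    rintro _ _ ⟨f, hf, rfl⟩ ⟨g, hg, rfl⟩
    exact ⟨f + g, hf.add hg, rfl⟩
  zero_mem' := ⟨fun _ => 0, analyticAt_const, rfl⟩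
  neg_mem' := by
    rintro _ ⟨f, hf, rfl⟩
    exact ⟨-f, hf.neg, rfl⟩

/-- The ring `ℂ{t}` of germs of holomorphic functions of one variable. -/
abbrev A : Type := lineGermSubring

/-- The constant germs. -/
noncomputable def lineConstHom : ℂ →+* A where
  toFun c := ⟨((fun _ => c : ℂ → ℂ) : Germ (𝓝 (0 : ℂ)) ℂ), fun _ => c, analyticAt_const, rfl⟩
  map_one' := rfl
  map_mul' _ _ := rfl
  map_zero' := rfl
  map_add' _ _ := rfl

noncomputable instance : Algebra ℂ A := lineConstHom.toAlgebra

namespace A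

/-- The germ of a function that is analytic at `0`. -/
noncomputable def mk (f : ℂ → ℂ) (hf : AnalyticAt ℂ f 0) : A := ⟨(f : Germ (𝓝 (0 : ℂ)) ℂ), f, hf, rfl⟩

theorem exists_mk (a : A) : ∃ (f : ℂ → ℂ) (hf : AnalyticAt ℂ f 0), a = mk f hf := by
  obtain ⟨_, f, hf, rfl⟩ := a
  exact ⟨f, hf, rfl⟩

theorem mk_eq_mk {f g : ℂ → ℂ} {hf : AnalyticAt ℂ f 0} {hg : AnalyticAt ℂ g 0} :
    mk f hf = mk g hg ↔ f =ᶠ[𝓝 0] g := by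
  exact Subtype.ext_iff.trans Germ.coe_eq

theorem mk_mul {f g : ℂ → ℂ} {hf : AnalyticAt ℂ f 0} {hg : AnalyticAt ℂ g 0} :
    mk f hf * mk g hg = mk (fun t => f t * g t) (hf.mul hg) := rfl

theorem mk_add {f g : ℂ → ℂ} {hf : AnalyticAt ℂ f 0} {hg : AnalyticAt ℂ g 0} :
    mk f hf + mk g hg = mk (fun t => f t + g t) (hf.add hg) := rfl

theorem mk_pow {f : ℂ → ℂ} {hf : AnalyticAt ℂ f 0} (n : ℕ) :
    mk f hf ^ n = mk (fun t => f t ^ n) (hf.pow n) := rfl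

theorem one_eq : (1 : A) = mk (fun _ => 1) analyticAt_const := rfl

/-- The coordinate. -/
noncomputable def X : A := mk (fun t => t) analyticAt_id

theorem mk_eq_zero {f : ℂ → ℂ} {hf : AnalyticAt ℂ f 0} : mk f hf = 0 ↔ ∀ᶠ t in 𝓝 0, f t = 0 :=
  mk_eq_mk (hg := analyticAt_const)

/-- The value at the origin. -/
noncomputable def ev : A →ₐ[ℂ] ℂ where
  __ := (Germ.valueRingHom (x := (0 : ℂ)) (E := ℂ)).comp lineGermSubring.subtype
  commutes' _ := rfl

@[simp] theorem ev_mk {f : ℂ → ℂ} {hf : AnalyticAt ℂ f 0} : ev (mk f hf) = f 0 := rfl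

theorem isUnit_iff {a : A} : IsUnit a ↔ ev a ≠ 0 := by
  constructor
  · intro h
    exact (h.map ev).ne_zero
  · obtain ⟨f, hf, rfl⟩ := exists_mk a
    intro h
    rw [ev_mk] at h
    refine IsUnit.of_mul_eq_one (mk (fun t => (f t)⁻¹) (hf.inv h)) ?_
    rw [mk_mul, one_eq, mk_eq_mk]
    filter_upwards [hf.continuousAt.eventually_ne h] with t ht
    exact mul_inv_cancel₀ ht

/-- Factorization by order of vanishing; the algebra of `ℂ{t}` below and its colengths are read off
from it. -/
theorem exists_eq_X_pow_mul {a : A} (ha : a ≠ 0) : ∃ (k : ℕ) (u : A), ev u ≠ 0 ∧ a = X ^ k * u := by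
  obtain ⟨f, hf, rfl⟩ := exists_mk a
  have h : analyticOrderAt f 0 ≠ ⊤ := by
    rw [Ne, analyticOrderAt_eq_top, ← mk_eq_zero (hf := hf)]
    exact ha
  obtain ⟨g, hg, hg0, hfg⟩ := hf.analyticOrderAt_ne_top.mp h
  refine ⟨analyticOrderNatAt f 0, mk g hg, hg0, ?_⟩
  rw [X, mk_pow, mk_mul, mk_eq_mk]
  filter_upwards [hfg] with t ht
  simpa using ht

theorem X_dvd_iff {a : A} : X ∣ a ↔ ev a = 0 := by
  constructor
  · rintro ⟨b, rfl⟩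
    rw [map_mul]
    simp [X]
  · intro h
    by_cases ha : a = 0
    · simp [ha]
    obtain ⟨k, u, hu, rfl⟩ := exists_eq_X_pow_mul ha
    have hk : k ≠ 0 := by
      rintro rfl
      simp at h
      exact hu h
    exact (dvd_pow_self X hk).mul_right u

theorem X_ne_zero : X ≠ 0 := by
  intro h
  rw [X, mk_eq_zero] at h
  have h' : ∀ᶠ t in 𝓝[≠] (0 : ℂ), t = 0 := h.filter_mono nhdsWithin_le_nhds
  obtain ⟨t, h1, h2⟩ := (h'.and eventually_mem_nhdsWithin).exists
  exact h2 h1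

theorem isUnit_of_ev_ne_zero {u : A} (h : ev u ≠ 0) : IsUnit u := isUnit_iff.2 h

instance : Nontrivial A := ⟨⟨X, 0, X_ne_zero⟩⟩

theorem X_pow_ne_zero (k : ℕ) : X ^ k ≠ 0 := by
  rw [X, mk_pow, Ne, mk_eq_zero]
  intro h
  have h' : ∀ᶠ t in 𝓝[≠] (0 : ℂ), t ^ k = 0 := h.filter_mono nhdsWithin_le_nhds
  obtain ⟨t, h1, h2⟩ := (h'.and eventually_mem_nhdsWithin).exists
  exact pow_ne_zero k h2 h1

instance : NoZeroDivisors A where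
  eq_zero_or_eq_zero_of_mul_eq_zero := by
    intro a b h
    by_contra! hab
    obtain ⟨k, u, hu, rfl⟩ := exists_eq_X_pow_mul hab.1
    obtain ⟨l, v, hv, rfl⟩ := exists_eq_X_pow_mul hab.2
    have h1 : X ^ (k + l) * (u * v) = 0 := by rw [← h]; ring
    rw [((isUnit_of_ev_ne_zero hu).mul (isUnit_of_ev_ne_zero hv)).mul_left_eq_zero] at h1
    exact X_pow_ne_zero _ h1

instance : IsDomain A := NoZeroDivisors.to_isDomain A

theorem irreducible_X : Irreducible X := by
  refine ⟨fun h => ?_, fun {a b} hab => ?_⟩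
  · have := isUnit_iff.1 h
    simp [X] at this
  · by_contra! h
    rw [isUnit_iff, isUnit_iff, not_not, not_not, ← X_dvd_iff, ← X_dvd_iff] at h
    obtain ⟨⟨c, rfl⟩, ⟨d, rfl⟩⟩ := h
    have h1 : X * (1 - X * (c * d)) = 0 := by
      rw [mul_sub, sub_eq_zero, mul_one]
      nth_rewrite 1 [hab]
      ring
    rcases mul_eq_zero.1 h1 with h1 | h1
    · exact X_ne_zero h1
    · have := congrArg ev h1
      rw [map_sub, map_mul] at this
      simp [X] at this

/-- Later uses are that `ℂ{t}` is Noetherian and integrally closed and that `X` is prime. -/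
instance : IsDiscreteValuationRing A :=
  IsDiscreteValuationRing.ofHasUnitMulPowIrreducibleFactorization
    ⟨X, irreducible_X, fun {a} ha => by
      obtain ⟨k, u, hu, rfl⟩ := exists_eq_X_pow_mul ha
      exact ⟨k, associated_mul_unit_right _ _ (isUnit_of_ev_ne_zero hu)⟩⟩

/-- Substitution of a germ that vanishes at the origin. -/
noncomputable def subst (τ : ℂ → ℂ) (hτ : AnalyticAt ℂ τ 0) (h0 : τ 0 = 0) : A →ₐ[ℂ] A where
  toFun u := ⟨(u : Germ (𝓝 (0 : ℂ)) ℂ).compTendsto τ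
      (by simpa [h0] using hτ.continuousAt.tendsto), by
    obtain ⟨_, f, hf, rfl⟩ := u
    have h : AnalyticAt ℂ f (τ 0) := by simpa [h0] using hf
    exact ⟨f ∘ τ, h.comp hτ, rfl⟩⟩
  map_one' := rfl
  map_mul' := by
    rintro ⟨_, f, hf, rfl⟩ ⟨_, g, hg, rfl⟩
    rfl
  map_zero' := rfl
  map_add' := by
    rintro ⟨_, f, hf, rfl⟩ ⟨_, g, hg, rfl⟩
    rfl
  commutes' _ := rfl

theorem comp_analyticAt {E : Type*} [NormedAddCommGroup E] [NormedSpace ℂ E] {f : ℂ → ℂ}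
    {τ : E → ℂ} {z : E} (hf : AnalyticAt ℂ f 0) (hτ : AnalyticAt ℂ τ z) (h0 : τ z = 0) :
    AnalyticAt ℂ (fun t => f (τ t)) z := by
  rw [← h0] at hf
  exact hf.comp hτ

theorem subst_mk {τ : ℂ → ℂ} {hτ : AnalyticAt ℂ τ 0} {h0 : τ 0 = 0} {f : ℂ → ℂ}
    {hf : AnalyticAt ℂ f 0} :
    subst τ hτ h0 (mk f hf) = mk (fun t => f (τ t)) (comp_analyticAt hf hτ h0) := rfl

end A

/-! ### Germs in several variables -/

namespace O

variable {n m : ℕ}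

/-- The germ of a function that is analytic at `0`. -/
noncomputable def mk (f : (Fin n → ℂ) → ℂ) (hf : AnalyticAt ℂ f 0) : O n :=
  ⟨(f : Germ (𝓝 (0 : Fin n → ℂ)) ℂ), f, hf, rfl⟩

theorem exists_mk (a : O n) : ∃ (f : (Fin n → ℂ) → ℂ) (hf : AnalyticAt ℂ f 0), a = mk f hf := by
  obtain ⟨_, f, hf, rfl⟩ := a
  exact ⟨f, hf, rfl⟩

theorem mk_eq_mk {f g : (Fin n → ℂ) → ℂ} {hf : AnalyticAt ℂ f 0} {hg : AnalyticAt ℂ g 0} :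
    mk f hf = mk g hg ↔ f =ᶠ[𝓝 0] g := by
  exact Subtype.ext_iff.trans Germ.coe_eq

theorem mk_mul {f g : (Fin n → ℂ) → ℂ} {hf : AnalyticAt ℂ f 0} {hg : AnalyticAt ℂ g 0} :
    mk f hf * mk g hg = mk (fun t => f t * g t) (hf.mul hg) := rfl

theorem mk_add {f g : (Fin n → ℂ) → ℂ} {hf : AnalyticAt ℂ f 0} {hg : AnalyticAt ℂ g 0} :
    mk f hf + mk g hg = mk (fun t => f t + g t) (hf.add hg) := rfl

theorem mk_sub {f g : (Fin n → ℂ) → ℂ} {hf : AnalyticAt ℂ f 0} {hg : AnalyticAt ℂ g 0} :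
    mk f hf - mk g hg = mk (fun x => f x - g x) (hf.sub hg) := rfl

theorem mk_pow {f : (Fin n → ℂ) → ℂ} {hf : AnalyticAt ℂ f 0} (k : ℕ) :
    mk f hf ^ k = mk (fun t => f t ^ k) (hf.pow k) := rfl

theorem algebraMap_eq (c : ℂ) : algebraMap ℂ (O n) c = mk (fun _ => c) analyticAt_const := rfl

theorem one_eq : (1 : O n) = mk (fun _ => 1) analyticAt_const := rfl

theorem mk_eq_zero {f : (Fin n → ℂ) → ℂ} {hf : AnalyticAt ℂ f 0} :
    mk f hf = 0 ↔ ∀ᶠ t in 𝓝 0, f t = 0 :=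
  mk_eq_mk (hg := analyticAt_const)

/-- The value at the origin. -/
noncomputable def ev : O n →ₐ[ℂ] ℂ where
  __ := (Germ.valueRingHom (x := (0 : Fin n → ℂ)) (E := ℂ)).comp
    (holGermSubring (0 : Fin n → ℂ)).subtype
  commutes' _ := rfl

@[simp] theorem ev_mk {f : (Fin n → ℂ) → ℂ} {hf : AnalyticAt ℂ f 0} : ev (mk f hf) = f 0 := rfl

theorem mem_maxIdeal {a : O n} : a ∈ maxIdeal n ↔ ev a = 0 := Iff.rfl

theorem isUnit_iff {a : O n} : IsUnit a ↔ ev a ≠ 0 := by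
  constructor
  · intro h
    exact (h.map ev).ne_zero
  · obtain ⟨f, hf, rfl⟩ := exists_mk a
    intro h
    rw [ev_mk] at h
    refine IsUnit.of_mul_eq_one (mk (fun t => (f t)⁻¹) (hf.inv h)) ?_
    rw [mk_mul, one_eq, mk_eq_mk]
    filter_upwards [hf.continuousAt.eventually_ne h] with t ht
    exact mul_inv_cancel₀ ht

/-- A linear form, as a germ. -/
noncomputable def lin (l : (Fin n → ℂ) →L[ℂ] ℂ) : O n := mk l (l.analyticAt 0)

/-- A coordinate function, as a germ. -/
noncomputable def coord (i : Fin n) : O n := lin (ContinuousLinearMap.proj i)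

/-- A germ in one variable composed with a linear form. -/
noncomputable def ofLine (l : (Fin n → ℂ) →L[ℂ] ℂ) : A →ₐ[ℂ] O n where
  toFun u := ⟨(u : Germ (𝓝 (0 : ℂ)) ℂ).compTendsto l
      (by simpa using l.continuous.tendsto 0), by
    obtain ⟨_, f, hf, rfl⟩ := u
    exact ⟨fun x => f (l x), A.comp_analyticAt hf (l.analyticAt 0) (map_zero l), rfl⟩⟩
  map_one' := rfl
  map_mul' := by
    rintro ⟨_, f, hf, rfl⟩ ⟨_, g, hg, rfl⟩
    rfl
  map_zero' := rfl
  map_add' := by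
    rintro ⟨_, f, hf, rfl⟩ ⟨_, g, hg, rfl⟩
    rfl
  commutes' _ := rfl

theorem ofLine_mk {l : (Fin n → ℂ) →L[ℂ] ℂ} {f : ℂ → ℂ} {hf : AnalyticAt ℂ f 0} :
    ofLine l (A.mk f hf) =
      mk (fun x => f (l x)) (A.comp_analyticAt hf (l.analyticAt 0) (map_zero l)) := rfl

theorem comp_analyticAt {f : (Fin n → ℂ) → ℂ} {φ : ℂ → Fin n → ℂ} (hf : AnalyticAt ℂ f 0)
    (hφ : AnalyticAt ℂ φ 0) (h0 : φ 0 = 0) : AnalyticAt ℂ (fun t => f (φ t)) 0 := by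
  rw [← h0] at hf
  exact hf.comp hφ

/-- The restriction of germs to a parametrized curve. -/
noncomputable def along (φ : ℂ → Fin n → ℂ) (hφ : AnalyticAt ℂ φ 0) (h0 : φ 0 = 0) :
    O n →ₐ[ℂ] A where
  toFun u := ⟨(u : Germ (𝓝 (0 : Fin n → ℂ)) ℂ).compTendsto φ
      (by simpa [h0] using hφ.continuousAt.tendsto), by
    obtain ⟨_, f, hf, rfl⟩ := u
    exact ⟨fun x => f (φ x), comp_analyticAt hf hφ h0, rfl⟩⟩
  map_one' := rfl
  map_mul' := by
    rintro ⟨_, f, hf, rfl⟩ ⟨_, g, hg, rfl⟩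
    rfl
  map_zero' := rfl
  map_add' := by
    rintro ⟨_, f, hf, rfl⟩ ⟨_, g, hg, rfl⟩
    rfl
  commutes' _ := rfl

theorem along_mk {φ : ℂ → Fin n → ℂ} {hφ : AnalyticAt ℂ φ 0} {h0 : φ 0 = 0}
    {f : (Fin n → ℂ) → ℂ} {hf : AnalyticAt ℂ f 0} :
    along φ hφ h0 (mk f hf) = A.mk (fun t => f (φ t)) (comp_analyticAt hf hφ h0) := rfl

theorem pullback_mk {π : (Fin n → ℂ) →L[ℂ] (Fin m → ℂ)} {f : (Fin m → ℂ) → ℂ}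
    {hf : AnalyticAt ℂ f 0} : pullback π (mk f hf) = mk (fun x => f (π x))
      (AnalyticAt.comp (by simpa using hf) (π.analyticAt 0)) := rfl

instance : Nontrivial (O n) := (ev (n := n)).toRingHom.domain_nontrivial

instance : IsLocalRing (O n) := IsLocalRing.of_nonunits_add fun {a b} ha hb => by
  simp only [mem_nonunits_iff, isUnit_iff, not_not, map_add] at *
  rw [ha, hb, add_zero]

theorem maximalIdeal_eq : IsLocalRing.maximalIdeal (O n) = maxIdeal n := by
  ext a
  rw [IsLocalRing.mem_maximalIdeal, mem_nonunits_iff, isUnit_iff, not_not, mem_maxIdeal]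

end O

end

section

/-! ### Absolutely convergent series of monomials -/

section lift

variable {ι E : Type*} [NormedAddCommGroup E] [NormedSpace ℂ E]

theorem summable_norm_lp_one (b : lp (fun _ : ι => ℂ) 1) : Summable fun i => ‖b i‖ := by
  simpa using (lp.memℓp b).summable (by simp)

theorem norm_lp_one_eq_tsum (b : lp (fun _ : ι => ℂ) 1) : ‖b‖ = ∑' i, ‖b i‖ := by
  simpa using lp.norm_eq_tsum_rpow (p := 1) (by simp) b

/-- The element of `ℓ¹` given by an absolutely summable family. -/
def lpOneMk (a : ι → ℂ) (ha : Summable fun i => ‖a i‖) : lp (fun _ : ι => ℂ) 1 :=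
  ⟨a, memℓp_gen (by simpa using ha)⟩

theorem summable_norm_lift {c : ι → E} {C : ℝ} (hc : ∀ i, ‖c i‖ ≤ C)
    (b : lp (fun _ : ι => ℂ) 1) : Summable fun i => ‖b i • c i‖ :=
  .of_nonneg_of_le (fun _ => norm_nonneg _)
    (fun i => by rw [norm_smul]; exact mul_le_mul_of_nonneg_left (hc i) (norm_nonneg _))
    ((summable_norm_lp_one b).mul_right C)

variable [CompleteSpace E]

/-- The continuous linear map on `ℓ¹` with prescribed bounded values on the standard basis. -/
noncomputable def lpOneLift (c : ι → E) (C : ℝ) (hc : ∀ i, ‖c i‖ ≤ C) :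
    lp (fun _ : ι => ℂ) 1 →L[ℂ] E :=
  LinearMap.mkContinuous
    { toFun b := ∑' i, b i • c i
      map_add' a b := by
        rw [← (summable_norm_lift hc a).of_norm.tsum_add (summable_norm_lift hc b).of_norm]
        simp [add_smul]
      map_smul' z b := by
        rw [RingHom.id_apply, ← (summable_norm_lift hc b).of_norm.tsum_const_smul]
        simp [mul_smul] } C fun b => by
    refine (norm_tsum_le_tsum_norm (summable_norm_lift hc b)).trans ?_
    rw [norm_lp_one_eq_tsum, mul_comm, ← tsum_mul_right]
    refine (summable_norm_lift hc b).tsum_le_tsum (fun i => ?_)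
      ((summable_norm_lp_one b).mul_right C)
    rw [norm_smul]
    exact mul_le_mul_of_nonneg_left (hc i) (norm_nonneg _)

theorem hasSum_lpOneLift (c : ι → E) (C : ℝ) (hc : ∀ i, ‖c i‖ ≤ C) (b : lp (fun _ : ι => ℂ) 1) :
    HasSum (fun i => b i • c i) (lpOneLift c C hc b) :=
  (summable_norm_lift hc b).of_norm.hasSum

theorem norm_lpOneLift_le (c : ι → E) (C : ℝ) (hC : 0 ≤ C) (hc : ∀ i, ‖c i‖ ≤ C) :
    ‖lpOneLift c C hc‖ ≤ C :=
  LinearMap.mkContinuous_norm_le _ hC _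

theorem lpOneLift_single [DecidableEq ι] (c : ι → E) (C : ℝ) (hc : ∀ i, ‖c i‖ ≤ C) (i : ι)
    (z : ℂ) : lpOneLift c C hc (lp.single 1 i z) = z • c i := by
  refine (hasSum_lpOneLift c C hc _).unique ?_
  convert hasSum_single i fun k hk => ?_ using 1
  · simp
  · simp [hk]

end lift

/-! ### Power series indexed by words in the coordinates -/

section words

variable {n : ℕ}

/-- The normalized monomial attached to a word. -/
noncomputable def wordValue (ρ : Fin n → ℝ) (x : Fin n → ℂ) (w : List (Fin n)) : ℂ :=
  (w.map fun i => x i / ρ i).prod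

theorem norm_wordValue_le {ρ : Fin n → ℝ} (hρ : ∀ i, 0 < ρ i) {x : Fin n → ℂ}
    (hx : ∀ i, ‖x i‖ ≤ ρ i) (w : List (Fin n)) : ‖wordValue ρ x w‖ ≤ 1 := by
  induction w with
  | nil => simp [wordValue]
  | cons i w ih =>
    have h : wordValue ρ x (i :: w) = x i / ρ i * wordValue ρ x w := by simp [wordValue]
    rw [h, norm_mul, norm_div, Complex.norm_real, Real.norm_of_nonneg (hρ i).le]
    exact mul_le_one₀ ((div_le_one (hρ i)).2 (hx i)) (norm_nonneg _) ih

/-- Words, not multi-indices, index the series: a multilinear map expanded in the standard basis is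
a sum over words, and multiplication by a monomial is concatenation. -/
theorem wordValue_append (ρ : Fin n → ℝ) (x : Fin n → ℂ) (v w : List (Fin n)) :
    wordValue ρ x (v ++ w) = wordValue ρ x v * wordValue ρ x w := by
  simp [wordValue]

theorem wordValue_eq_prod_count (ρ : Fin n → ℝ) (x : Fin n → ℂ) (w : List (Fin n)) :
    wordValue ρ x w = ∏ i, (x i / ρ i) ^ w.count i := by
  rw [wordValue, Finset.prod_list_map_count]
  refine Finset.prod_subset (Finset.subset_univ _) fun i _ hi => ?_
  rw [List.mem_toFinset] at hi
  rw [List.count_eq_zero_of_not_mem hi, pow_zero]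

/-- The function `f` is the sum of an absolutely convergent series of monomials with coefficients
`b` on the closed polydisc of polyradius `ρ`. -/
def IsWordSeries (ρ : Fin n → ℝ) (b : lp (fun _ : List (Fin n) => ℂ) 1) (f : (Fin n → ℂ) → ℂ) :
    Prop :=
  ∀ x : Fin n → ℂ, (∀ i, ‖x i‖ ≤ ρ i) → HasSum (fun w => b w * wordValue ρ x w) (f x)

theorem eventually_mem_polydisc {ρ : Fin n → ℝ} (hρ : ∀ i, 0 < ρ i) :
    ∀ᶠ x : Fin n → ℂ in 𝓝 0, ∀ i, ‖x i‖ ≤ ρ i := by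
  rw [eventually_all]
  intro i
  have : Tendsto (fun x : Fin n → ℂ => ‖x i‖) (𝓝 0) (𝓝 0) := by
    have h : Continuous fun x : Fin n → ℂ => ‖x i‖ := by fun_prop
    simpa using h.tendsto 0
  exact (this.eventually_lt_const (hρ i)).mono fun _ h => h.le

/-- The `k`-th Taylor term has `nᵏ` word coefficients, each of norm at most `‖p k‖`, and `n ρ₀ ≤ r'`
keeps their sum below `‖p k‖ r'ᵏ`. The bound `C` does not depend on `ρ`; division relies on this
when it shrinks a single radius. -/
theorem exists_isWordSeries {f : (Fin n → ℂ) → ℂ} (hf : AnalyticAt ℂ f 0) :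
    ∃ ρ₀ > 0, ∃ C : ℝ, ∀ ρ : Fin n → ℝ, (∀ i, 0 < ρ i) → (∀ i, ρ i ≤ ρ₀) →
      ∃ b, ‖b‖ ≤ C ∧ IsWordSeries ρ b f := by
  obtain ⟨p, r, hp⟩ := hf
  obtain ⟨r', hr'0, hr'⟩ := ENNReal.lt_iff_exists_nnreal_btwn.1 hp.r_pos
  have hr'0 : 0 < r' := by exact_mod_cast hr'0
  set ρ₀ : ℝ := r' / (n + 1) with hρ₀
  have hρ₀0 : 0 < ρ₀ := by positivity
  have hρ₀r : ρ₀ * (n + 1) = r' := by rw [hρ₀]; field_simp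
  have hsum := p.summable_norm_mul_pow (hr'.trans_le hp.r_le)
  let t (k : ℕ) (i : Fin k → Fin n) : ℂ := p k fun l => Pi.single (i l) 1
  have ht (k : ℕ) (i : Fin k → Fin n) : ‖t k i‖ ≤ ‖p k‖ := by
    refine ((p k).le_opNorm _).trans_eq ?_
    rw [Finset.prod_eq_one fun l _ => by rw [Pi.norm_single, norm_one], mul_one]
  refine ⟨ρ₀, hρ₀0, ∑' k, ‖p k‖ * (r' : ℝ) ^ k, fun ρ hρ hρle => ?_⟩
  -- The product of radii undoes the normalization in `wordValue`.
  let a' : (Σ k, Fin k → Fin n) → ℂ := fun s => t s.1 s.2 * ∏ l, (ρ (s.2 l) : ℂ)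
  have ha' (s : Σ k, Fin k → Fin n) : ‖a' s‖ ≤ ‖p s.1‖ * ρ₀ ^ s.1 := by
    rw [norm_mul, norm_prod]
    refine mul_le_mul (ht _ _) ?_ (Finset.prod_nonneg fun _ _ => norm_nonneg _) (norm_nonneg _)
    refine (Finset.prod_le_prod (g := fun _ => ρ₀) (fun _ _ => norm_nonneg _)
      fun l _ => ?_).trans (by simp)
    rw [Complex.norm_real, Real.norm_of_nonneg (hρ _).le]
    exact hρle _
  have hfib (k : ℕ) : ∑ i : Fin k → Fin n, ‖a' ⟨k, i⟩‖ ≤ ‖p k‖ * (r' : ℝ) ^ k := by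
    refine (Finset.sum_le_card_nsmul _ _ (‖p k‖ * ρ₀ ^ k) fun i _ => ha' ⟨k, i⟩).trans ?_
    rw [Finset.card_univ, Fintype.card_fun, Fintype.card_fin, Fintype.card_fin,
      nsmul_eq_mul, ← hρ₀r, mul_pow, mul_left_comm, mul_comm (ρ₀ ^ k), Nat.cast_pow]
    gcongr
    linarith
  have hsig : Summable fun s => ‖a' s‖ := by
    rw [summable_sigma_of_nonneg fun _ => norm_nonneg _]
    refine ⟨fun k => .of_finite, ?_⟩
    refine .of_nonneg_of_le (fun k => tsum_nonneg fun _ => norm_nonneg _) (fun k => ?_) hsum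
    rw [tsum_fintype]
    exact hfib k
  let e := List.equivSigmaTuple (α := Fin n)
  have hword : Summable fun w => ‖a' (e w)‖ := e.summable_iff.2 hsig
  refine ⟨lpOneMk (fun w => a' (e w)) hword, ?_, fun x hx => ?_⟩
  · rw [norm_lp_one_eq_tsum]
    change ∑' w, ‖a' (e w)‖ ≤ _
    rw [e.tsum_eq fun s => ‖a' s‖, hsig.tsum_sigma]
    refine Summable.tsum_le_tsum (fun k => ?_) hsig.sigma hsum
    rw [tsum_fintype]
    exact hfib k
  · have hval (s : Σ k, Fin k → Fin n) :
        a' s * wordValue ρ x (e.symm s) = t s.1 s.2 * ∏ l, x (s.2 l) := by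
      obtain ⟨k, i⟩ := s
      have h1 : wordValue ρ x (e.symm ⟨k, i⟩) = ∏ l, (x (i l) / ρ (i l)) := by
        simp [e, wordValue, List.equivSigmaTuple, List.map_ofFn, List.prod_ofFn]
      rw [h1, mul_assoc, ← Finset.prod_mul_distrib]
      congr 1
      refine Finset.prod_congr rfl fun l _ => ?_
      exact mul_div_cancel₀ _ (Complex.ofReal_ne_zero.2 (hρ (i l)).ne')
    have hs : Summable fun s => a' s * wordValue ρ x (e.symm s) := by
      refine Summable.of_norm (.of_nonneg_of_le (fun _ => norm_nonneg _) (fun s => ?_) hsig)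
      rw [norm_mul]
      exact mul_le_of_le_one_right (norm_nonneg _) (norm_wordValue_le hρ hx _)
    have hxr : x ∈ Metric.eball (0 : Fin n → ℂ) r := by
      rw [Metric.mem_eball, edist_zero_right]
      refine lt_of_le_of_lt ?_ hr'
      rw [enorm_eq_nnnorm]
      rw [ENNReal.coe_le_coe, ← NNReal.coe_le_coe, coe_nnnorm]
      refine (pi_norm_le_iff_of_nonneg r'.2).2 fun i => ?_
      refine (hx i).trans ((hρle i).trans ?_)
      rw [hρ₀]
      exact div_le_self r'.2 (by linarith [(Nat.cast_nonneg n : (0 : ℝ) ≤ n)])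
    have hout := hs.hasSum.sigma (fun k => hasSum_fintype _)
    have hpx := hp.hasSum hxr
    rw [zero_add] at hpx
    have heq (k : ℕ) : ∑ i : Fin k → Fin n, a' ⟨k, i⟩ * wordValue ρ x (e.symm ⟨k, i⟩) =
        p k fun _ => x := by
      have hx' : (fun _ : Fin k => x) = fun _ => ∑ j, x j • Pi.single j (1 : ℂ) := by
        funext l i
        simp [Finset.sum_apply, Pi.single_apply]
      rw [hx', (p k).map_sum]
      refine Finset.sum_congr rfl fun i _ => ?_
      rw [hval, (p k).map_smul_univ, smul_eq_mul, mul_comm]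
    simp only [heq] at hout
    have := hs.hasSum
    rw [hout.unique hpx] at this
    rw [← e.hasSum_iff] at this
    convert this using 2 with w
    simp [lpOneMk]

/-- Grouping words by length gives a power series; with `δ` the least radius, a word of length `k`
contributes a multilinear form of norm at most `δ⁻ᵏ` times its coefficient, so the radius of
convergence is at least `δ`. -/
theorem IsWordSeries.analyticAt {ρ : Fin n → ℝ} {b : lp (fun _ : List (Fin n) => ℂ) 1}
    {f : (Fin n → ℂ) → ℂ} (h : IsWordSeries ρ b f) (hρ : ∀ i, 0 < ρ i) : AnalyticAt ℂ f 0 := by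
  obtain ⟨δ, hδ0, hδ⟩ : ∃ δ > 0, ∀ i, δ ≤ ρ i := by
    rcases isEmpty_or_nonempty (Fin n) with hn | hn
    · exact ⟨1, one_pos, fun i => (hn.false i).elim⟩
    · obtain ⟨i, hi⟩ := Finite.exists_min ρ
      exact ⟨ρ i, hρ i, hi⟩
  let M (k : ℕ) (i : Fin k → Fin n) : ContinuousMultilinearMap ℂ (fun _ : Fin k => Fin n → ℂ) ℂ :=
    (ContinuousMultilinearMap.mkPiAlgebra ℂ (Fin k) ℂ).compContinuousLinearMap
      fun l => (ρ (i l) : ℂ)⁻¹ • ContinuousLinearMap.proj (i l)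
  have hM (k : ℕ) (i : Fin k → Fin n) (v : Fin k → Fin n → ℂ) :
      M k i v = ∏ l, (v l (i l) / ρ (i l)) := by
    simp [M, div_eq_inv_mul]
  have hMn (k : ℕ) (i : Fin k → Fin n) : ‖M k i‖ ≤ (δ ^ k)⁻¹ := by
    refine ContinuousMultilinearMap.opNorm_le_bound (by positivity) fun v => ?_
    rw [hM, norm_prod, ← inv_pow, ← Fin.prod_const, ← Finset.prod_mul_distrib]
    refine Finset.prod_le_prod (fun _ _ => norm_nonneg _) fun l _ => ?_
    rw [norm_div, Complex.norm_real, Real.norm_of_nonneg (hρ _).le, div_eq_inv_mul]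
    gcongr
    · exact hδ _
    · exact norm_le_pi_norm (v l) (i l)
  let p : FormalMultilinearSeries ℂ (Fin n → ℂ) ℂ := fun k => ∑ i : Fin k → Fin n,
    b (List.ofFn i) • M k i
  let e := List.equivSigmaTuple (α := Fin n)
  have he (k : ℕ) (i : Fin k → Fin n) : e.symm ⟨k, i⟩ = List.ofFn i := rfl
  have hbs : Summable fun s => ‖b (e.symm s)‖ := e.symm.summable_iff.2 (summable_norm_lp_one b)
  have hrad : ENNReal.ofReal δ ≤ p.radius := by
    refine p.le_radius_of_bound ‖b‖ (r := δ.toNNReal) fun k => ?_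
    rw [Real.coe_toNNReal _ hδ0.le]
    calc ‖p k‖ * δ ^ k ≤ (∑ i : Fin k → Fin n, ‖b (List.ofFn i)‖ * (δ ^ k)⁻¹) * δ ^ k := by
          gcongr
          refine norm_sum_le_of_le _ fun i _ => ?_
          rw [norm_smul]
          gcongr
          exact hMn k i
      _ = ∑ i : Fin k → Fin n, ‖b (e.symm ⟨k, i⟩)‖ := by
          rw [← Finset.sum_mul, mul_assoc, inv_mul_cancel₀ (by positivity), mul_one]
          rfl
      _ ≤ ∑' k, ∑ i : Fin k → Fin n, ‖b (e.symm ⟨k, i⟩)‖ := by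
          have := hbs.sigma
          simp only [tsum_fintype] at this
          exact this.le_tsum k fun _ _ => Finset.sum_nonneg fun _ _ => norm_nonneg _
      _ = ‖b‖ := by
          rw [norm_lp_one_eq_tsum, ← e.symm.tsum_eq fun w => ‖b w‖, hbs.tsum_sigma]
          simp only [tsum_fintype]
  refine ⟨p, ENNReal.ofReal δ, hrad, by simpa using hδ0, fun {y} hy => ?_⟩
  have hy' (i : Fin n) : ‖y i‖ ≤ ρ i := by
    rw [Metric.mem_eball, edist_zero_right, enorm_eq_nnnorm] at hy
    have h1 : ‖y‖ < δ := by
      rw [ENNReal.ofReal, ENNReal.coe_lt_coe, ← NNReal.coe_lt_coe, Real.coe_toNNReal _ hδ0.le] at hy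
      exact hy
    exact (norm_le_pi_norm y i).trans (h1.le.trans (hδ i))
  have h1 := (e.symm.hasSum_iff.2 (h y hy')).sigma fun k => hasSum_fintype _
  rw [zero_add]
  have hterm (k : ℕ) : ∑ i : Fin k → Fin n, ((fun w => b w * wordValue ρ y w) ∘ e.symm) ⟨k, i⟩ =
      p k fun _ => y := by
    change _ = (∑ i : Fin k → Fin n, b (List.ofFn i) • M k i) (fun _ => y)
    rw [sum_apply]
    refine Finset.sum_congr rfl fun i _ => ?_
    change b (List.ofFn i) * _ = b (List.ofFn i) * M k i (fun _ => y)
    rw [hM, he, wordValue, List.map_ofFn, List.prod_ofFn]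
    rfl
  simp only [hterm] at h1
  exact h1

theorem O.mk_sum {ι : Type*} (s : Finset ι) (f : ι → (Fin n → ℂ) → ℂ)
    (hf : ∀ i, AnalyticAt ℂ (f i) 0) :
    ∑ i ∈ s, O.mk (f i) (hf i) =
      O.mk (fun x => ∑ i ∈ s, f i x) (s.analyticAt_fun_sum fun i _ => hf i) := by
  induction s using Finset.cons_induction with
  | empty => rfl
  | cons i s hi ih =>
    rw [Finset.sum_cons, ih, O.mk_add, O.mk_eq_mk]
    exact .of_forall fun x => (Finset.sum_cons (f := fun i => f i x) hi).symm

/-- Hadamard's lemma. -/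
theorem O.exists_eq_add_sum_coord_mul (f : O n) :
    ∃ g : Fin n → O n, f = algebraMap ℂ (O n) (O.ev f) + ∑ i, O.coord i * g i := by
  obtain ⟨f, hf, rfl⟩ := O.exists_mk f
  obtain ⟨ρ₀, hρ₀, C, H⟩ := exists_isWordSeries hf
  let ρ : Fin n → ℝ := fun _ => ρ₀
  have hρ (i : Fin n) : 0 < ρ i := hρ₀
  obtain ⟨b, -, hb⟩ := H ρ hρ fun _ => le_rfl
  have hinj (i : Fin n) : Function.Injective fun w : List (Fin n) => i :: w :=
    List.cons_injective
  -- The words that begin with `i`, with that first letter removed.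
  let c (i : Fin n) : lp (fun _ : List (Fin n) => ℂ) 1 :=
    lpOneMk (fun w => b (i :: w) / ρ₀) (by
      simp_rw [norm_div]
      exact ((summable_norm_lp_one b).comp_injective (hinj i)).div_const _)
  have hs (i : Fin n) (x : Fin n → ℂ) (hx : ∀ i, ‖x i‖ ≤ ρ i) :
      Summable fun w => c i w * wordValue ρ x w := by
    refine Summable.of_norm (.of_nonneg_of_le (fun _ => norm_nonneg _) (fun s => ?_)
      (summable_norm_lp_one (c i)))
    rw [norm_mul]
    exact mul_le_of_le_one_right (norm_nonneg _) (norm_wordValue_le hρ hx _)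
  let g (i : Fin n) (x : Fin n → ℂ) : ℂ := ∑' w, c i w * wordValue ρ x w
  have hg (i : Fin n) : IsWordSeries ρ (c i) (g i) := fun x hx => (hs i x hx).hasSum
  have key (x : Fin n → ℂ) (hx : ∀ i, ‖x i‖ ≤ ρ i) : f x = b [] + ∑ i, x i * g i x := by
    have hterm (i : Fin n) (w : List (Fin n)) :
        b (i :: w) * wordValue ρ x (i :: w) = x i * (c i w * wordValue ρ x w) := by
      simp [c, lpOneMk, wordValue, ρ]
      ring
    have h2 : HasSum (fun w => b w * wordValue ρ x w -
        (if w = [] then b [] else 0)) (f x - b []) := by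
      refine (hb x hx).sub ?_
      convert hasSum_ite_eq ([] : List (Fin n)) (b []) using 1
    have h3 : HasSum (fun p : (_ : Fin n) × List (Fin n) => x p.1 * (c p.1 p.2 * wordValue ρ x p.2))
        (f x - b []) := by
      have hi : Function.Injective fun p : (_ : Fin n) × List (Fin n) => p.1 :: p.2 := by
        rintro ⟨i, v⟩ ⟨j, w⟩ h
        simp only [List.cons.injEq] at h
        obtain ⟨rfl, rfl⟩ := h
        rfl
      have := (hi.hasSum_iff (f := fun w => b w * wordValue ρ x w - (if w = [] then b [] else 0))
        (a := f x - b []) (by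
          rintro (_ | ⟨i, w⟩) hw
          · simp [wordValue]
          · exact (hw ⟨⟨i, w⟩, rfl⟩).elim)).2 h2
      convert this using 2 with p
      simp [hterm]
    have h4 := h3.sigma fun i => (hg i x hx).mul_left (x i)
    rw [← sub_eq_iff_eq_add', h4.unique (hasSum_fintype _)]
  refine ⟨fun i => O.mk (g i) ((hg i).analyticAt hρ), ?_⟩
  have h0 : O.ev (O.mk f hf) = b [] := by
    rw [O.ev_mk, key 0 (fun i => by simp [hρ₀.le, ρ])]
    simp
  have hi (i : Fin n) : AnalyticAt ℂ (fun x : Fin n → ℂ => x i * g i x) 0 :=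
    ((ContinuousLinearMap.proj (R := ℂ) (φ := fun _ : Fin n => ℂ) i).analyticAt 0).mul
      ((hg i).analyticAt hρ)
  have hmk : ∑ i, O.coord i * O.mk (g i) ((hg i).analyticAt hρ) = ∑ i, O.mk _ (hi i) := rfl
  rw [h0, hmk, O.mk_sum, O.algebraMap_eq, O.mk_add, O.mk_eq_mk]
  filter_upwards [eventually_mem_polydisc hρ] with x hx
  exact key x hx

end words

end

section

/-! ### Division -/

theorem hasSum_of_forall_eq {ι : Type*} {f g : ι → ℂ} {a : ℂ} (h : HasSum f a)
    (e : ∀ w, g w = f w) : HasSum g a := by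
  rwa [funext e]

variable {n : ℕ}

/-- The variables commute, so `k` copies of the letter `i` can be moved to the front. -/
theorem exists_word_of_le_count {i : Fin n} {k : ℕ} {w : List (Fin n)} (h : k ≤ w.count i) :
    ∃ v : List (Fin n), ∀ (ρ : Fin n → ℝ) (x : Fin n → ℂ),
      wordValue ρ x w = (x i / ρ i) ^ k * wordValue ρ x v := by
  obtain ⟨v, hv⟩ := (List.replicate_sublist_iff.2 h).exists_perm_append
  refine ⟨v, fun ρ x => ?_⟩
  rw [wordValue, (hv.map _).prod_eq]
  simp [wordValue]

theorem analyticAt_tsum_pow {ι : Type*} (a : ι → ℂ) (ha : Summable fun w => ‖a w‖) (c : ι → ℕ)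
    {σ : ℝ} (hσ : 0 < σ) : AnalyticAt ℂ (fun s : ℂ => ∑' w, a w * (s / σ) ^ c w) 0 := by
  have h : DifferentiableOn ℂ (fun s : ℂ => ∑' w, a w * (s / σ) ^ c w) (Metric.ball 0 σ) := by
    refine Complex.differentiableOn_tsum_of_summable_norm ha (fun w => ?_) Metric.isOpen_ball
      fun w s hs => ?_
    · fun_prop
    · rw [norm_mul, norm_pow, norm_div, Complex.norm_real, Real.norm_of_nonneg hσ.le]
      refine mul_le_of_le_one_right (norm_nonneg _) (pow_le_one₀ (by positivity) ?_)
      rw [div_le_one hσ]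
      rw [mem_ball_zero_iff] at hs
      exact hs.le
  exact h.analyticAt (Metric.ball_mem_nhds _ hσ)


theorem hasSum_mul_wordValue {ρ : Fin n → ℝ} (hρ : ∀ i, 0 < ρ i) {x : Fin n → ℂ}
    (hx : ∀ i, ‖x i‖ ≤ ρ i) (b : lp (fun _ : List (Fin n) => ℂ) 1) :
    HasSum (fun w => b w * wordValue ρ x w) (∑' w, b w * wordValue ρ x w) := by
  refine (Summable.of_norm (.of_nonneg_of_le (fun _ => norm_nonneg _) (fun s => ?_)
      (summable_norm_lp_one b))).hasSum
  rw [norm_mul]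
  exact mul_le_of_le_one_right (norm_nonneg _) (norm_wordValue_le hρ hx _)

-- Call a word nonreduced if some letter `i ≠ j` occurs at least `k` times. Rewriting `xᵢᵏ` as `xⱼ
-- gᵢ` in nonreduced words, and sending reduced words to `0`, is an operator `T` on `ℓ¹` of norm at
-- most `ρⱼ C / ρ₀ᵏ < 1`, so `b - T b = a` is solvable by a Neumann series. Then `f` is the sum of
-- `b w` times (word minus rewriting). Reduced words form the remainder, and each nonreduced word
-- gives a multiple of `xᵢᵏ - xⱼ gᵢ`.
open Classical in
theorem exists_division_of_isWordSeries (j : Fin n) {k : ℕ} (hk : 0 < k) {ρ : Fin n → ℝ}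
    (hρ : ∀ i, 0 < ρ i) {C ρ₀ : ℝ} (hρ₀ : 0 < ρ₀) (hρρ₀ : ∀ i ≠ j, ρ i = ρ₀)
    (hC : ρ j * C / ρ₀ ^ k < 1) {g : Fin n → (Fin n → ℂ) → ℂ} {f : (Fin n → ℂ) → ℂ}
    (G : Fin n → lp (fun _ : List (Fin n) => ℂ) 1) (hGC : ∀ i, ‖G i‖ ≤ C)
    (hG : ∀ i, IsWordSeries ρ (G i) (g i)) (a : lp (fun _ : List (Fin n) => ℂ) 1)
    (ha : IsWordSeries ρ a f) :
    ∃ (h : (Fin n → Fin k) → ℂ → ℂ) (q : Fin n → (Fin n → ℂ) → ℂ),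
      (∀ α, AnalyticAt ℂ (h α) 0) ∧ (∀ i, AnalyticAt ℂ (q i) 0) ∧
      ∀ᶠ x in 𝓝 0, f x = ∑ α, h α (x j) * ∏ i, x i ^ (α i : ℕ) +
        ∑ i ∈ Finset.univ.erase j, q i x * (x i ^ k - x j * g i x) := by
  have hC0 : 0 ≤ C := (norm_nonneg _).trans (hGC j)
  let nonred (w : List (Fin n)) : Prop := ∃ i, i ≠ j ∧ k ≤ w.count i
  have hex (w : List (Fin n)) : ∃ (i : Fin n) (v : List (Fin n)), nonred w → i ≠ j ∧
      ∀ x : Fin n → ℂ, wordValue ρ x w = (x i / ρ i) ^ k * wordValue ρ x v := by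
    by_cases hw : nonred w
    · obtain ⟨i, hi, hik⟩ := hw
      obtain ⟨v, hv⟩ := exists_word_of_le_count hik
      exact ⟨i, v, fun _ => ⟨hi, hv ρ⟩⟩
    · exact ⟨j, [], fun h => (hw h).elim⟩
  choose I R hIR using hex
  have h1 (v : List (Fin n)) : ‖(lp.single 1 v (1 : ℂ) : lp (fun _ : List (Fin n) => ℂ) 1)‖ ≤ 1 := by
    rw [lp.norm_single (by simp)]
    simp
  let shift (u : List (Fin n)) := lpOneLift (fun v : List (Fin n) =>
    (lp.single 1 (u ++ v) (1 : ℂ) : lp (fun _ : List (Fin n) => ℂ) 1)) 1 fun v => h1 _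
  have hshift (u : List (Fin n)) : ‖shift u‖ ≤ 1 := norm_lpOneLift_le _ _ zero_le_one _
  let κ : ℝ := ρ j * C / ρ₀ ^ k
  have hκ0 : 0 ≤ κ := by have := (hρ j).le; positivity
  -- The rewriting of `w`: the factor `1 / ρ₀ᵏ` comes from the removed `(xᵢ / ρ₀)ᵏ`, and `ρⱼ` from
  -- writing `xⱼ` as `ρⱼ` times the normalized letter `j`.
  let c (w : List (Fin n)) : lp (fun _ : List (Fin n) => ℂ) 1 :=
    if nonred w then ((ρ j / ρ₀ ^ k : ℝ) : ℂ) • shift (j :: R w) (G (I w)) else 0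
  have hc (w : List (Fin n)) : ‖c w‖ ≤ κ := by
    by_cases hw : nonred w
    · simp only [c, if_pos hw]
      rw [norm_smul, Complex.norm_real, Real.norm_of_nonneg (by have := (hρ j).le; positivity)]
      have h2 : ‖shift (j :: R w) (G (I w))‖ ≤ C :=
        ((shift (j :: R w)).le_of_opNorm_le (hshift _) _).trans (by rw [one_mul]; exact hGC _)
      calc ρ j / ρ₀ ^ k * ‖shift (j :: R w) (G (I w))‖ ≤ ρ j / ρ₀ ^ k * C := by
            have := (hρ j).le
            gcongr
        _ = κ := by ring
    · simp only [c, if_neg hw, norm_zero]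
      exact hκ0
  let T := lpOneLift c κ hc
  have hT : ‖T‖ < 1 := (norm_lpOneLift_le c κ hκ0 hc).trans_lt hC
  obtain ⟨b, hb⟩ : ∃ b, b - T b = a := by
    let U := Units.oneSub T hT
    refine ⟨(U⁻¹).val a, ?_⟩
    exact congrArg (fun V : lp (fun _ : List (Fin n) => ℂ) 1 →L[ℂ] _ => V a) U.mul_inv
  let Q (i : Fin n) := lpOneLift (fun w => if nonred w ∧ I w = i then
    (lp.single 1 (R w) (1 : ℂ) : lp (fun _ : List (Fin n) => ℂ) 1) else 0) 1 (fun w => by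
      split_ifs
      · exact h1 _
      · simp) b
  -- The exponent at `j` is set to `0`: all powers of `xⱼ` go into the coefficient `h α`.
  let type (w : List (Fin n)) (i : Fin n) : Fin k :=
    if h : i ≠ j ∧ w.count i < k then ⟨w.count i, h.2⟩ else ⟨0, hk⟩
  let r (α : Fin n → Fin k) (w : List (Fin n)) : ℂ :=
    if ¬ nonred w ∧ type w = α then b w * ∏ i, ((ρ i : ℂ) ^ (α i : ℕ))⁻¹ else 0
  have hr (α : Fin n → Fin k) : Summable fun w => ‖r α w‖ := by
    refine .of_nonneg_of_le (fun _ => norm_nonneg _) (fun w => ?_)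
      ((summable_norm_lp_one b).mul_right ‖∏ i, ((ρ i : ℂ) ^ (α i : ℕ))⁻¹‖)
    simp only [r]
    split_ifs
    · rw [norm_mul]
    · rw [norm_zero]
      positivity
  refine ⟨fun α s => ∑' w, r α w * (s / ρ j) ^ w.count j,
    fun i x => (∑' w, Q i w * wordValue ρ x w) / ρ₀ ^ k,
    fun α => analyticAt_tsum_pow _ (hr α) _ (hρ j), fun i => ?_, ?_⟩
  · refine AnalyticAt.div_const ?_
    exact IsWordSeries.analyticAt (b := Q i) (fun x hx => hasSum_mul_wordValue hρ hx _) hρ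
  filter_upwards [eventually_mem_polydisc hρ] with x hx
  let L := lpOneLift (fun w : List (Fin n) => wordValue ρ x w) 1 (norm_wordValue_le hρ hx)
  have hL (b : lp (fun _ : List (Fin n) => ℂ) 1) : HasSum (fun w => b w * wordValue ρ x w) (L b) :=
    hasSum_lpOneLift _ _ _ b
  have hLs (v : List (Fin n)) (z : ℂ) : L (lp.single 1 v z) = z * wordValue ρ x v :=
    lpOneLift_single _ _ _ _ _
  have hLf : L a = f x := (hL a).unique (ha x hx)
  have hLG (i : Fin n) : L (G i) = g i x := (hL (G i)).unique (hG i x hx)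
  have hLshift (u : List (Fin n)) (y : lp (fun _ : List (Fin n) => ℂ) 1) :
      L (shift u y) = wordValue ρ x u * L y := by
    refine ((hasSum_lpOneLift _ _ _ y).mapL L).unique ?_
    refine hasSum_of_forall_eq ((hL y).mul_left (wordValue ρ x u)) fun w => ?_
    rw [map_smul, hLs, wordValue_append, smul_eq_mul]
    ring
  have hLc (w : List (Fin n)) : L (c w) =
      if nonred w then x j * g (I w) x * wordValue ρ x (R w) / ρ₀ ^ k else 0 := by
    by_cases hw : nonred w
    · have h3 : wordValue ρ x (j :: R w) = x j / ρ j * wordValue ρ x (R w) := by simp [wordValue]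
      have h4 : (ρ j : ℂ) ≠ 0 := Complex.ofReal_ne_zero.2 (hρ j).ne'
      simp only [c, if_pos hw]
      rw [map_smul, hLshift, hLG, h3, smul_eq_mul]
      push_cast
      field_simp
    · simp only [c, if_neg hw, map_zero]
  -- Evaluation at `x` of the identity `b - T b = a`, term by term.
  have hLT : HasSum (fun w => b w * (wordValue ρ x w - L (c w))) (f x) := by
    have h5 : L b - L (T b) = f x := by rw [← map_sub, hb, hLf]
    rw [← h5]
    refine hasSum_of_forall_eq ((hL b).sub ((hasSum_lpOneLift c κ hc b).mapL L)) fun w => ?_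
    rw [map_smul, smul_eq_mul]
    ring
  have hsR (α : Fin n → Fin k) : HasSum (fun w => r α w * (x j / ρ j) ^ w.count j)
      (∑' w, r α w * (x j / ρ j) ^ w.count j) := by
    refine (Summable.of_norm (.of_nonneg_of_le (fun _ => norm_nonneg _) (fun w => ?_) (hr α))).hasSum
    rw [norm_mul, norm_pow, norm_div, Complex.norm_real, Real.norm_of_nonneg (hρ j).le]
    exact mul_le_of_le_one_right (norm_nonneg _)
      (pow_le_one₀ (by have := (hρ j).le; positivity) ((div_le_one (hρ j)).2 (hx j)))
  have hsQ (i : Fin n) : HasSum (fun w => b w * if nonred w ∧ I w = i then wordValue ρ x (R w) else 0)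
      (∑' w, Q i w * wordValue ρ x w) := by
    rw [(hL (Q i)).tsum_eq]
    refine hasSum_of_forall_eq ((hasSum_lpOneLift _ _ _ b).mapL L) fun w => ?_
    rw [map_smul, smul_eq_mul]
    split_ifs
    · rw [hLs, one_mul]
    · rw [map_zero]
  have hR := hasSum_sum fun α (_ : α ∈ Finset.univ) =>
    (hsR α).mul_right (∏ i, x i ^ (α i : ℕ))
  have hQ := hasSum_sum fun i (_ : i ∈ Finset.univ.erase j) =>
    ((hsQ i).div_const ((ρ₀ : ℂ) ^ k)).mul_right (x i ^ k - x j * g i x)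
  refine hLT.unique ?_
  refine hasSum_of_forall_eq (hR.add hQ) fun w => ?_
  by_cases hw : nonred w
  · obtain ⟨hIj, hIw⟩ := hIR w hw
    have hz : ∀ α ∈ Finset.univ, r α w * (x j / ρ j) ^ w.count j * ∏ i, x i ^ (α i : ℕ) = 0 := by
      intro α _
      simp [r, hw]
    rw [Finset.sum_eq_zero hz, zero_add, Finset.sum_eq_single (I w)]
    · rw [hLc, if_pos hw, if_pos ⟨hw, rfl⟩, hIw, hρρ₀ _ hIj, div_pow]
      have : (ρ₀ : ℂ) ≠ 0 := Complex.ofReal_ne_zero.2 hρ₀.ne'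
      field_simp
    · intro i _ hi
      simp [hi.symm]
    · intro h
      exact (h (Finset.mem_erase.2 ⟨hIj, Finset.mem_univ _⟩)).elim
  · have hz : ∀ i ∈ Finset.univ.erase j, b w * (if nonred w ∧ I w = i then
        wordValue ρ x (R w) else 0) / (ρ₀ : ℂ) ^ k * (x i ^ k - x j * g i x) = 0 := by
      intro i _
      simp [hw]
    rw [Finset.sum_eq_zero hz, add_zero, Finset.sum_eq_single (type w)]
    · have hcount (i : Fin n) (hi : i ≠ j) : w.count i < k := by
        by_contra! h
        exact hw ⟨i, hi, h⟩
      simp only [r]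
      rw [hLc, if_neg hw, if_pos ⟨hw, trivial⟩, sub_zero, wordValue_eq_prod_count, mul_assoc, mul_assoc]
      congr 1
      rw [mul_left_comm, ← Finset.prod_mul_distrib, ← Finset.mul_prod_erase _ _ (Finset.mem_univ j),
        ← Finset.mul_prod_erase (a := j) _ _ (Finset.mem_univ j)]
      have : type w j = ⟨0, hk⟩ := by simp [type]
      rw [this]
      simp only [pow_zero, inv_one, one_mul]
      congr 1
      refine Finset.prod_congr rfl fun i hi => ?_
      have hij := (Finset.mem_erase.1 hi).1
      have : (type w i : ℕ) = w.count i := by simp [type, hij, hcount i hij]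
      rw [this, div_pow]
      ring
    · intro α _ hα
      simp [r, hα.symm]
    · intro h
      exact (h (Finset.mem_univ _)).elim

/-- Division by germs `xᵢᵏ - xⱼ gᵢ`, `i ≠ j`: every germ is congruent to a combination of monomials
with coefficients that are germs in `xⱼ`. -/
theorem O.exists_division (j : Fin n) {k : ℕ} (hk : 0 < k) (g : Fin n → O n) (f : O n) :
    ∃ (h : (Fin n → Fin k) → A) (q : Fin n → O n),
      f = ∑ α, O.ofLine (ContinuousLinearMap.proj j) (h α) * ∏ i, O.coord i ^ (α i : ℕ) +
        ∑ i ∈ Finset.univ.erase j, q i * (O.coord i ^ k - O.coord j * g i) := by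
  obtain ⟨f, hf, rfl⟩ := O.exists_mk f
  choose g hg hgg using fun i => O.exists_mk (g i)
  obtain ⟨ρf, hρf, Cf, Hf⟩ := exists_isWordSeries hf
  choose ρg hρg Cg Hg using fun i => exists_isWordSeries (hg i)
  obtain ⟨ρ₀, hρ₀, hρ₀f, hρ₀g⟩ : ∃ ρ₀ > 0, ρ₀ ≤ ρf ∧ ∀ i, ρ₀ ≤ ρg i := by
    have : Nonempty (Fin n) := ⟨j⟩
    obtain ⟨i, hi⟩ := Finite.exists_min ρg
    exact ⟨min ρf (ρg i), lt_min hρf (hρg i), min_le_left _ _,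
      fun l => (min_le_right _ _).trans (hi l)⟩
  let C := ∑ i, |Cg i|
  have hC (i : Fin n) : Cg i ≤ C := (le_abs_self _).trans
    (Finset.single_le_sum (f := fun i => |Cg i|) (fun _ _ => abs_nonneg _) (Finset.mem_univ i))
  have hC0 : 0 ≤ C := Finset.sum_nonneg fun _ _ => abs_nonneg _
  -- Only the radius in direction `j` is shrunk, enough for `ρⱼ C < ρ₀ᵏ`; the bound `C` on the `gᵢ`
  -- is unaffected.
  let σ := min ρ₀ (ρ₀ ^ k / (C + 1))
  have hσ : 0 < σ := lt_min hρ₀ (by positivity)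
  let ρ (i : Fin n) : ℝ := if i = j then σ else ρ₀
  have hρ (i : Fin n) : 0 < ρ i := by simp only [ρ]; split_ifs <;> assumption
  have hρle (i : Fin n) : ρ i ≤ ρ₀ := by
    simp only [ρ]
    split_ifs
    · exact min_le_left _ _
    · exact le_rfl
  obtain ⟨a, -, ha⟩ := Hf ρ hρ fun i => (hρle i).trans hρ₀f
  choose G hGC hG using fun i => Hg i ρ hρ fun l => (hρle l).trans (hρ₀g i)
  have hsmall : ρ j * C / ρ₀ ^ k < 1 := by
    have h1 : ρ j ≤ ρ₀ ^ k / (C + 1) := by simp [ρ, σ]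
    have h2 : 0 < ρ₀ ^ k := by positivity
    rw [div_lt_one h2]
    calc ρ j * C ≤ ρ₀ ^ k / (C + 1) * C := by gcongr
      _ < ρ₀ ^ k := by
        rw [div_mul_eq_mul_div, div_lt_iff₀ (by positivity)]
        nlinarith
  obtain ⟨h, q, hh, hq, H⟩ := exists_division_of_isWordSeries j hk hρ hρ₀
    (fun i hi => by simp [ρ, hi]) hsmall G (fun i => (hGC i).trans (hC i)) hG a ha
  have hmon (s : Finset (Fin n)) (α : Fin n → Fin k) :
      AnalyticAt ℂ (fun x : Fin n → ℂ => ∏ i ∈ s, x i ^ (α i : ℕ)) 0 := by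
    refine s.analyticAt_fun_prod fun i _ => ?_
    exact ((ContinuousLinearMap.proj (R := ℂ) (φ := fun _ : Fin n => ℂ) i).analyticAt 0).pow _
  have hprod (s : Finset (Fin n)) (α : Fin n → Fin k) :
      ∏ i ∈ s, O.coord i ^ (α i : ℕ) = O.mk (fun x => ∏ i ∈ s, x i ^ (α i : ℕ)) (hmon s α) := by
    induction s using Finset.cons_induction with
    | empty => rfl
    | cons i s hi ih =>
      rw [Finset.prod_cons, ih, O.coord, O.lin, O.mk_pow, O.mk_mul, O.mk_eq_mk]
      exact .of_forall fun x => (Finset.prod_cons (f := fun i => x i ^ (α i : ℕ)) hi).symm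
  refine ⟨fun α => A.mk (h α) (hh α), fun i => O.mk (q i) (hq i), ?_⟩
  simp only [hprod]
  simp only [hgg, O.coord, O.lin, O.ofLine_mk, O.mk_mul, O.mk_pow, O.mk_sub, O.mk_sum, O.mk_add]
  rw [O.mk_eq_mk]
  exact H

end

section

/-! ### Algebraic properties of the ring of germs -/

theorem A.eq_zero_of_forall_X_pow_dvd {a : A} (h : ∀ k, A.X ^ k ∣ a) : a = 0 := by
  by_contra ha
  obtain ⟨k, u, hu, rfl⟩ := A.exists_eq_X_pow_mul ha
  have := h (k + 1)
  rw [pow_succ, mul_dvd_mul_iff_left (A.X_pow_ne_zero k), A.X_dvd_iff] at this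
  exact hu this

namespace O

variable {n : ℕ}

theorem ev_coord (i : Fin n) : ev (coord i) = 0 := rfl

theorem maxIdeal_eq_span : maxIdeal n = Ideal.span (Set.range coord) := by
  apply le_antisymm
  · intro f hf
    rw [mem_maxIdeal] at hf
    obtain ⟨g, hg⟩ := exists_eq_add_sum_coord_mul f
    rw [hg, hf, map_zero, zero_add]
    exact Ideal.sum_mem _ fun i _ => Ideal.mul_mem_right _ _ (Ideal.subset_span ⟨i, rfl⟩)
  · rw [Ideal.span_le]
    rintro _ ⟨i, rfl⟩
    exact mem_maxIdeal.2 (ev_coord i)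

/-- By Hadamard's lemma, congruence modulo `Xᵏ` on all germs improves to `Xᵏ⁺¹`, because coordinates
go to multiples of `X`; no continuity has to be assumed. -/
theorem algHom_ext {ψ₁ ψ₂ : O n →ₐ[ℂ] A} (h : ∀ i, ψ₁ (coord i) = ψ₂ (coord i))
    (hX : ∀ i, A.X ∣ ψ₁ (coord i)) : ψ₁ = ψ₂ := by
  have key (k : ℕ) : ∀ f, A.X ^ k ∣ ψ₁ f - ψ₂ f := by
    induction k with
    | zero => simp
    | succ k ih =>
      intro f
      obtain ⟨g, hg⟩ := exists_eq_add_sum_coord_mul f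
      have : ψ₁ f - ψ₂ f = ∑ i, ψ₁ (coord i) * (ψ₁ (g i) - ψ₂ (g i)) := by
        conv_lhs => rw [hg]
        simp only [map_add, map_sum, map_mul, AlgHom.commutes, ← h, mul_sub,
          Finset.sum_sub_distrib]
        ring
      rw [this]
      refine Finset.dvd_sum fun i _ => ?_
      rw [pow_succ']
      exact mul_dvd_mul (hX i) (ih _)
  ext f : 1
  exact sub_eq_zero.1 (A.eq_zero_of_forall_X_pow_dvd fun k => key k f)

/-- Every algebra homomorphism `𝒪ₙ → ℂ{t}` is the restriction to a parametrized curve. -/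
theorem exists_eq_along (ψ : O n →ₐ[ℂ] A) (hX : ∀ i, A.X ∣ ψ (coord i)) :
    ∃ (φ : ℂ → Fin n → ℂ) (hφ : AnalyticAt ℂ φ 0) (h0 : φ 0 = 0), ψ = along φ hφ h0 := by
  choose φ hφ hψ using fun i => A.exists_mk (ψ (coord i))
  have h0 : (fun t i => φ i t) 0 = 0 := by
    funext i
    have := A.X_dvd_iff.1 (hX i)
    rwa [hψ, A.ev_mk] at this
  refine ⟨fun t i => φ i t, analyticAt_pi_iff.2 hφ, h0, algHom_ext (fun i => ?_) hX⟩
  rw [hψ]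
  rfl

/-! ### Quotients that are finite over `ℂ{xⱼ}` -/

section finite

variable {P : Ideal (O n)} {j : Fin n} {k : ℕ} {g : Fin n → O n}

/-- Division leaves the monomials with all exponents below `k` as generators. -/
theorem finite_quotient_of_mem (hk : 0 < k)
    (hP : ∀ i ≠ j, coord i ^ k - coord j * g i ∈ P) :
    ((Ideal.Quotient.mk P).comp
      (ofLine (ContinuousLinearMap.proj j) : A →ₐ[ℂ] O n).toRingHom).Finite := by
  set θ := (Ideal.Quotient.mk P).comp
    (ofLine (ContinuousLinearMap.proj j) : A →ₐ[ℂ] O n).toRingHom with hθ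
  let := θ.toAlgebra
  change Module.Finite A (O n ⧸ P)
  classical
  refine ⟨⟨Finset.univ.image fun α : Fin n → Fin k =>
    Ideal.Quotient.mk P (∏ i, coord i ^ (α i : ℕ)), ?_⟩⟩
  rw [eq_top_iff]
  rintro x -
  obtain ⟨f, rfl⟩ := Ideal.Quotient.mk_surjective x
  obtain ⟨h, q, hf⟩ := exists_division j hk g f
  have h2 : Ideal.Quotient.mk P (∑ i ∈ Finset.univ.erase j, q i * (coord i ^ k - coord j * g i)) =
      0 := by
    rw [Ideal.Quotient.eq_zero_iff_mem]
    exact Ideal.sum_mem _ fun i hi => Ideal.mul_mem_left _ _ (hP i (Finset.mem_erase.1 hi).1)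
  rw [hf, map_add, h2, add_zero, map_sum]
  refine Submodule.sum_mem _ fun α _ => ?_
  rw [map_mul]
  change h α • Ideal.Quotient.mk P (∏ i, coord i ^ (α i : ℕ)) ∈ _
  exact Submodule.smul_mem _ _ (Submodule.subset_span (by simp))

/-- The given elements generate an ideal `J ≤ P` whose quotient is finite over `ℂ{xⱼ}`, hence
Noetherian; so `P` is finitely generated modulo `J`. The Noetherian property of `O n` itself is not
needed. -/
theorem fg_of_mem (hk : 0 < k) (hP : ∀ i ≠ j, coord i ^ k - coord j * g i ∈ P) : P.FG := by
  let J : Ideal (O n) := Ideal.span (Set.range fun i : {i // i ≠ j} =>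
    coord (i : Fin n) ^ k - coord j * g i)
  have hJ : ∀ i ≠ j, coord i ^ k - coord j * g i ∈ J := fun i hi =>
    Ideal.subset_span ⟨⟨i, hi⟩, rfl⟩
  have hJP : J ≤ P := by
    rw [Ideal.span_le]
    rintro _ ⟨i, rfl⟩
    exact hP i i.2
  have hfin := finite_quotient_of_mem hk hJ
  set θ := (Ideal.Quotient.mk J).comp
    (ofLine (ContinuousLinearMap.proj j) : A →ₐ[ℂ] O n).toRingHom
  let := θ.toAlgebra
  have : Module.Finite A (O n ⧸ J) := hfin
  have : IsNoetherianRing (O n ⧸ J) := IsNoetherianRing.of_finite A (O n ⧸ J)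
  have h1 : (P.map (Ideal.Quotient.mk J)).FG := IsNoetherian.noetherian _
  refine Submodule.fg_of_fg_map_of_fg_inf_ker (Ideal.Quotient.mkₐ (O n) J).toLinearMap ?_ ?_
  · have : Submodule.map (Ideal.Quotient.mkₐ (O n) J).toLinearMap P =
        (P.map (Ideal.Quotient.mk J)).restrictScalars (O n) := by
      ext x
      rw [Submodule.restrictScalars_mem,
        Ideal.mem_map_iff_of_surjective _ Ideal.Quotient.mk_surjective]
      rfl
    rw [this]
    exact Submodule.FG.restrictScalars_of_surjective h1 Ideal.Quotient.mk_surjective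
  · have : P ⊓ LinearMap.ker (Ideal.Quotient.mkₐ (O n) J).toLinearMap = J := by
      ext x
      simp only [Submodule.mem_inf, LinearMap.mem_ker]
      change x ∈ P ∧ Ideal.Quotient.mk J x = 0 ↔ _
      rw [Ideal.Quotient.eq_zero_iff_mem]
      exact ⟨fun h => h.2, fun h => ⟨hJP h, h⟩⟩
    rw [this]
    exact Submodule.fg_span (Set.finite_range _)

end finite

/-- The primes of coheight one. -/
structure IsCurvePrime (P : Ideal (O n)) : Prop where
  isPrime : P.IsPrime
  ne_maxIdeal : P ≠ maxIdeal n
  eq_maxIdeal : ∀ Q : Ideal (O n), Q.IsPrime → P < Q → Q = maxIdeal n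

/-- If the maximal ideal were minimal over `I`, it would be the only prime over `I` and the
dimension would be `0`. The quotient by `P` has dimension at most one, so its nonzero primes are
maximal. -/
theorem IsCurvePrime.of_mem_minimalPrimes {I P : Ideal (O n)} (hI : ringKrullDim (O n ⧸ I) = 1)
    (hP : P ∈ I.minimalPrimes) : IsCurvePrime P where
  isPrime := hP.1.1
  ne_maxIdeal := by
    rintro rfl
    have : Ring.KrullDimLE 0 (O n ⧸ I) := by
      refine .mk₀ fun J hJ => ?_
      have h1 : (J.comap (Ideal.Quotient.mk I)).IsPrime := inferInstance
      have h2 : I ≤ J.comap (Ideal.Quotient.mk I) := by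
        intro x hx
        rw [Ideal.mem_comap, Ideal.Quotient.eq_zero_iff_mem.2 hx]
        exact J.zero_mem
      have h3 : J.comap (Ideal.Quotient.mk I) ≤ maxIdeal n := by
        rw [← maximalIdeal_eq]
        exact IsLocalRing.le_maximalIdeal h1.ne_top
      have h4 : J.comap (Ideal.Quotient.mk I) = maxIdeal n := le_antisymm h3 (hP.2 ⟨h1, h2⟩ h3)
      have h5 := Ideal.map_comap_of_surjective _ (Ideal.Quotient.mk_surjective (I := I)) J
      rw [h4, ← maximalIdeal_eq] at h5
      rcases Ideal.map_eq_top_or_isMaximal_of_surjective _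
        (Ideal.Quotient.mk_surjective (I := I)) (IsLocalRing.maximalIdeal.isMaximal (O n)) with h | h
      · rw [h5] at h
        exact (hJ.ne_top h).elim
      · rwa [h5] at h
    have h := Ring.krullDimLE_iff.1 this
    rw [hI] at h
    norm_num at h
  eq_maxIdeal := by
    intro Q hQ hPQ
    have hPp : P.IsPrime := hP.1.1
    have hdim : Ring.KrullDimLE 1 (O n ⧸ P) := by
      rw [Ring.krullDimLE_iff]
      refine (ringKrullDim_le_of_surjective (Ideal.Quotient.factor hP.1.2)
        (Ideal.Quotient.factor_surjective hP.1.2)).trans ?_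
      rw [hI]
      norm_num
    have h1 : (Q.map (Ideal.Quotient.mk P)).IsPrime :=
      Ideal.map_isPrime_of_surjective Ideal.Quotient.mk_surjective (by rw [Ideal.mk_ker]; exact hPQ.le)
    have h2 : Q.map (Ideal.Quotient.mk P) ≠ ⊥ := by
      rw [Ne, Ideal.map_eq_bot_iff_le_ker, Ideal.mk_ker]
      exact hPQ.not_ge
    have h3 := Ring.krullDimLE_one_iff_of_noZeroDivisors.1 hdim _ h2 h1
    have h4 : Q = (Q.map (Ideal.Quotient.mk P)).comap (Ideal.Quotient.mk P) := by
      rw [Ideal.comap_map_of_surjective _ Ideal.Quotient.mk_surjective, ← RingHom.ker,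
        Ideal.mk_ker, sup_eq_left.2 hPQ.le]
    have h5 : Q.IsMaximal := by
      rw [h4]
      exact Ideal.comap_isMaximal_of_surjective _ Ideal.Quotient.mk_surjective
    rw [← maximalIdeal_eq]
    exact IsLocalRing.eq_maximalIdeal h5

theorem IsCurvePrime.le_maxIdeal {P : Ideal (O n)} (hP : IsCurvePrime P) : P ≤ maxIdeal n := by
  rw [← maximalIdeal_eq]
  exact IsLocalRing.le_maximalIdeal hP.isPrime.ne_top

theorem IsCurvePrime.exists_coord_notMem {P : Ideal (O n)} (hP : IsCurvePrime P) :
    ∃ j, coord j ∉ P := by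
  by_contra! h
  refine hP.ne_maxIdeal (le_antisymm hP.le_maxIdeal ?_)
  rw [maxIdeal_eq_span, Ideal.span_le]
  rintro _ ⟨i, rfl⟩
  exact h i

/-- The only prime above `P` and `xⱼ` is the maximal ideal, so every coordinate lies in the radical
of `P + (xⱼ)`. -/
theorem IsCurvePrime.exists_pow_sub_mem {P : Ideal (O n)} (hP : IsCurvePrime P) {j : Fin n}
    (hj : coord j ∉ P) : ∃ k > 0, ∃ g : Fin n → O n, ∀ i, coord i ^ k - coord j * g i ∈ P := by
  have h1 (i : Fin n) : coord i ∈ (P ⊔ Ideal.span {coord j}).radical := by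
    rw [Ideal.radical_eq_sInf, Submodule.mem_sInf]
    rintro Q ⟨hQ, hQp⟩
    rw [sup_le_iff] at hQ
    have hPQ : P < Q := by
      refine lt_of_le_of_ne hQ.1 ?_
      rintro rfl
      exact hj (hQ.2 (Ideal.mem_span_singleton_self _))
    rw [hP.eq_maxIdeal Q hQp hPQ]
    exact mem_maxIdeal.2 (ev_coord i)
  choose k hk using h1
  let K := ∑ i, k i + 1
  have h2 (i : Fin n) : coord i ^ K ∈ P ⊔ Ideal.span {coord j} := by
    have : k i ≤ K := (Finset.single_le_sum (f := k) (fun _ _ => zero_le) (Finset.mem_univ i)).trans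
      (Nat.le_succ _)
    exact Ideal.pow_mem_of_pow_mem _ (hk i) this
  simp only [Submodule.mem_sup, Ideal.mem_span_singleton'] at h2
  choose p hp z hz hpz using h2
  choose g hg using hz
  refine ⟨K, Nat.succ_pos _, g, fun i => ?_⟩
  rw [← hpz, ← hg, mul_comm, add_sub_cancel_right]
  exact hp i

theorem IsCurvePrime.fg {P : Ideal (O n)} (hP : IsCurvePrime P) : P.FG := by
  obtain ⟨j, hj⟩ := hP.exists_coord_notMem
  obtain ⟨k, hk, g, hg⟩ := hP.exists_pow_sub_mem hj
  exact fg_of_mem hk fun i _ => hg i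

end O

end

section

/-! ### Lifting of coprime factorizations -/

section Hensel

open Polynomial

/-- The coefficients of the monic polynomial of degree `p` with lower coefficients `u`. -/
def monicCoeff {R : Type*} [CommRing R] {p : ℕ} (u : Fin p → R) (a : ℕ) : R :=
  if h : a < p then u ⟨a, h⟩ else if a = p then 1 else 0

/-- The monic polynomial of degree `p` with lower coefficients `u`. -/
noncomputable def monicPoly {R : Type*} [CommRing R] {p : ℕ} (u : Fin p → R) : R[X] :=
  X ^ p + ∑ i : Fin p, C (u i) * X ^ (i : ℕ)

section

variable {R : Type*} [CommRing R] {p : ℕ}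

theorem coeff_sum_fin (u : Fin p → R) (a : ℕ) :
    (∑ i : Fin p, C (u i) * X ^ (i : ℕ)).coeff a = if h : a < p then u ⟨a, h⟩ else 0 := by
  simp only [finsetSum_coeff, coeff_C_mul, coeff_X_pow, mul_ite, mul_one, mul_zero]
  split_ifs with h
  · rw [Finset.sum_eq_single ⟨a, h⟩]
    · simp
    · intro i _ hi
      rw [if_neg]
      rintro rfl
      exact hi rfl
    · simp
  · refine Finset.sum_eq_zero fun i _ => ?_
    rw [if_neg]
    rintro rfl
    exact h i.2

theorem coeff_monicPoly (u : Fin p → R) (a : ℕ) : (monicPoly u).coeff a = monicCoeff u a := by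
  rw [monicPoly, coeff_add, coeff_sum_fin, coeff_X_pow, monicCoeff]
  split_ifs with h1 h2
  · omega
  · simp
  · simp
  · simp

theorem degree_sum_fin_lt (u : Fin p → R) : (∑ i : Fin p, C (u i) * X ^ (i : ℕ)).degree < (p : WithBot ℕ) := by
  rw [degree_lt_iff_coeff_zero]
  intro m hm
  rw [coeff_sum_fin, dif_neg (by omega)]

theorem monic_monicPoly (u : Fin p → R) : (monicPoly u).Monic :=
  monic_X_pow_add (degree_sum_fin_lt u)

theorem natDegree_monicPoly [Nontrivial R] (u : Fin p → R) : (monicPoly u).natDegree = p :=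
  natDegree_eq_of_degree_eq_some (by
    rw [monicPoly, degree_add_eq_left_of_degree_lt, degree_X_pow]
    rw [degree_X_pow]
    exact degree_sum_fin_lt u)

theorem eq_monicPoly {f : R[X]} (hf : f.Monic) (hp : f.natDegree = p) :
    f = monicPoly fun i : Fin p => f.coeff i := by
  ext a
  rw [coeff_monicPoly, monicCoeff]
  split_ifs with h1 h2
  · rfl
  · rw [h2, ← hp]
    exact hf
  · exact coeff_eq_zero_of_natDegree_lt (by omega)

/-- The lower coefficients of the product of two monic polynomials. -/
def mulCoeff {p q : ℕ} (z : (Fin p → R) × (Fin q → R)) (k : Fin (p + q)) : R :=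
  ∑ x ∈ Finset.HasAntidiagonal.antidiagonal (k : ℕ), monicCoeff z.1 x.1 * monicCoeff z.2 x.2

theorem monicPoly_mul_monicPoly [Nontrivial R] {p q : ℕ} (u : Fin p → R) (v : Fin q → R) :
    monicPoly u * monicPoly v = monicPoly (mulCoeff (u, v)) := by
  have h := (monic_monicPoly u).mul (monic_monicPoly v)
  have hd : (monicPoly u * monicPoly v).natDegree = p + q := by
    rw [(monic_monicPoly u).natDegree_mul (monic_monicPoly v), natDegree_monicPoly,
      natDegree_monicPoly]
  rw [eq_monicPoly h hd]
  congr 1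
  funext k
  rw [coeff_mul, mulCoeff]
  simp only [coeff_monicPoly]

end

variable {p q : ℕ}

theorem analyticAt_monicCoeff {E : Type*} [NormedAddCommGroup E] [NormedSpace ℂ E]
    {u : E → Fin p → ℂ} {z : E} (hu : AnalyticAt ℂ u z) (a : ℕ) :
    AnalyticAt ℂ (fun x => monicCoeff (u x) a) z := by
  unfold monicCoeff
  split_ifs
  · exact analyticAt_pi_iff.1 hu _
  · exact analyticAt_const
  · exact analyticAt_const

theorem analyticAt_mulCoeff (z : (Fin p → ℂ) × (Fin q → ℂ)) :
    AnalyticAt ℂ (mulCoeff : (Fin p → ℂ) × (Fin q → ℂ) → Fin (p + q) → ℂ) z := by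
  refine analyticAt_pi_iff.2 fun k => ?_
  exact Finset.analyticAt_fun_sum _ fun x _ =>
    (analyticAt_monicCoeff analyticAt_fst _).mul (analyticAt_monicCoeff analyticAt_snd _)

/-- Along the line `z + t d` the product of the two polynomials is quadratic in `t`; the derivative
is its linear coefficient. -/
theorem fderiv_mulCoeff_apply (z d : (Fin p → ℂ) × (Fin q → ℂ)) (k : Fin (p + q)) :
    fderiv ℂ mulCoeff z d k =
      ((∑ i : Fin p, C (d.1 i) * X ^ (i : ℕ)) * monicPoly z.2 +
        monicPoly z.1 * ∑ i : Fin q, C (d.2 i) * X ^ (i : ℕ)).coeff k := by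
  have h1 : HasDerivAt (fun t : ℂ => z + t • d) d 0 := by
    simpa using ((hasDerivAt_id (0 : ℂ)).smul_const d).const_add z
  have h2 : HasFDerivAt mulCoeff (fderiv ℂ mulCoeff z) (z + (0 : ℂ) • d) := by
    rw [zero_smul, add_zero]
    exact (analyticAt_mulCoeff z).differentiableAt.hasFDerivAt
  have h3 := hasDerivAt_pi.1 (h2.comp_hasDerivAt (0 : ℂ) h1) k
  set D₁ := ∑ i : Fin p, C (d.1 i) * X ^ (i : ℕ) with hD₁
  set D₂ := ∑ i : Fin q, C (d.2 i) * X ^ (i : ℕ) with hD₂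
  have h4 (t : ℂ) : mulCoeff (z + t • d) k = (monicPoly z.1 * monicPoly z.2).coeff k +
      t * (D₁ * monicPoly z.2 + monicPoly z.1 * D₂).coeff k + t ^ 2 * (D₁ * D₂).coeff k := by
    have e1 : monicPoly (z + t • d).1 = monicPoly z.1 + C t * D₁ := by
      rw [monicPoly, monicPoly, hD₁, Finset.mul_sum, add_assoc, ← Finset.sum_add_distrib]
      congr 1
      refine Finset.sum_congr rfl fun i _ => ?_
      simp
      ring
    have e2 : monicPoly (z + t • d).2 = monicPoly z.2 + C t * D₂ := by
      rw [monicPoly, monicPoly, hD₂, Finset.mul_sum, add_assoc, ← Finset.sum_add_distrib]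
      congr 1
      refine Finset.sum_congr rfl fun i _ => ?_
      simp
      ring
    have e3 : mulCoeff (z + t • d) k = (monicPoly (z + t • d).1 * monicPoly (z + t • d).2).coeff k := by
      rw [monicPoly_mul_monicPoly, coeff_monicPoly, monicCoeff, dif_pos k.2]
    have e4 : (monicPoly z.1 + C t * D₁) * (monicPoly z.2 + C t * D₂) =
        monicPoly z.1 * monicPoly z.2 + C t * (D₁ * monicPoly z.2 + monicPoly z.1 * D₂) +
          C (t ^ 2) * (D₁ * D₂) := by
      rw [C_pow]
      ring
    rw [e3, e1, e2, e4, coeff_add, coeff_add, coeff_C_mul, coeff_C_mul]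
  have h5 : HasDerivAt (fun t : ℂ => (monicPoly z.1 * monicPoly z.2).coeff k +
      t * (D₁ * monicPoly z.2 + monicPoly z.1 * D₂).coeff k + t ^ 2 * (D₁ * D₂).coeff k)
      ((D₁ * monicPoly z.2 + monicPoly z.1 * D₂).coeff k) 0 := by
    have a1 := ((hasDerivAt_id (0 : ℂ)).mul_const
      ((D₁ * monicPoly z.2 + monicPoly z.1 * D₂).coeff k)).const_add
      ((monicPoly z.1 * monicPoly z.2).coeff k)
    have a2 := ((hasDerivAt_id (0 : ℂ)).pow 2).mul_const ((D₁ * D₂).coeff k)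
    simpa using a1.fun_add a2
  have h6 : HasDerivAt (fun t : ℂ => mulCoeff (z + t • d) k) _ 0 := h3
  simp only [h4] at h6
  exact h6.unique h5

/-- For `d` in the kernel, `D₁ h + g D₂ = 0` with `g`, `h` coprime, so `g` divides `D₁`, which has
smaller degree. Hence `D₁ = 0`, and then `D₂ = 0`. -/
theorem injective_fderiv_mulCoeff (z : (Fin p → ℂ) × (Fin q → ℂ))
    (hz : IsCoprime (monicPoly z.1) (monicPoly z.2)) :
    Function.Injective (fderiv ℂ (mulCoeff : (Fin p → ℂ) × (Fin q → ℂ) → Fin (p + q) → ℂ) z) := by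
  rw [injective_iff_map_eq_zero]
  intro d hd
  set D₁ := ∑ i : Fin p, C (d.1 i) * X ^ (i : ℕ) with hD₁
  set D₂ := ∑ i : Fin q, C (d.2 i) * X ^ (i : ℕ) with hD₂
  have l1 : D₁.degree < (monicPoly z.1).degree := by
    rw [degree_eq_natDegree (monic_monicPoly _).ne_zero, natDegree_monicPoly]
    exact degree_sum_fin_lt _
  have l2 : D₂.degree < (monicPoly z.2).degree := by
    rw [degree_eq_natDegree (monic_monicPoly _).ne_zero, natDegree_monicPoly]
    exact degree_sum_fin_lt _
  have m1 : (monicPoly z.1).degree ≠ ⊥ := degree_ne_bot.2 (monic_monicPoly _).ne_zero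
  have m2 : (monicPoly z.2).degree ≠ ⊥ := degree_ne_bot.2 (monic_monicPoly _).ne_zero
  have hsum : D₁ * monicPoly z.2 + monicPoly z.1 * D₂ = 0 := by
    ext k
    rw [coeff_zero]
    by_cases hk : k < p + q
    · have := fderiv_mulCoeff_apply z d ⟨k, hk⟩
      rw [hd] at this
      exact this.symm
    · have hdeg : (D₁ * monicPoly z.2 + monicPoly z.1 * D₂).degree < (p + q : ℕ) := by
        have e : ((p + q : ℕ) : WithBot ℕ) = (monicPoly z.1 * monicPoly z.2).degree := by
          rw [degree_mul, degree_eq_natDegree (monic_monicPoly z.1).ne_zero,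
            degree_eq_natDegree (monic_monicPoly z.2).ne_zero, natDegree_monicPoly,
            natDegree_monicPoly]
          rfl
        rw [e]
        refine (degree_add_le _ _).trans_lt (max_lt ?_ ?_)
        · rw [degree_mul, degree_mul]
          exact WithBot.add_lt_add_right m2 l1
        · rw [degree_mul, degree_mul]
          exact WithBot.add_lt_add_left m1 l2
      exact coeff_eq_zero_of_degree_lt (hdeg.trans_le (by exact_mod_cast not_lt.1 hk))
  have hD₁0 : D₁ = 0 := by
    by_contra h
    have : monicPoly z.1 ∣ D₁ := by
      refine hz.dvd_of_dvd_mul_right ⟨-D₂, ?_⟩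
      linear_combination hsum
    exact absurd (degree_le_of_dvd this h) (not_le.2 l1)
  have hD₂0 : D₂ = 0 := by
    rw [hD₁0, zero_mul, zero_add] at hsum
    exact (mul_eq_zero.1 hsum).resolve_left (monic_monicPoly _).ne_zero
  ext i
  · have := coeff_sum_fin d.1 (i : ℕ)
    rw [← hD₁, hD₁0, dif_pos i.2] at this
    exact this.symm
  · have := coeff_sum_fin d.2 (i : ℕ)
    rw [← hD₂, hD₂0, dif_pos i.2] at this
    exact this.symm

/-- The multiplication of monic polynomials has an analytic local section at coprime pairs. -/
theorem exists_analyticAt_section_mulCoeff (z : (Fin p → ℂ) × (Fin q → ℂ))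
    (hz : IsCoprime (monicPoly z.1) (monicPoly z.2)) :
    ∃ Ψ : (Fin (p + q) → ℂ) → (Fin p → ℂ) × (Fin q → ℂ), AnalyticAt ℂ Ψ (mulCoeff z) ∧
      ∀ᶠ c in 𝓝 (mulCoeff z), mulCoeff (Ψ c) = c := by
  let e : ((Fin p → ℂ) × (Fin q → ℂ)) ≃L[ℂ] (Fin (p + q) → ℂ) :=
    (LinearEquiv.ofInjectiveOfFinrankEq (fderiv ℂ mulCoeff z).toLinearMap
      (injective_fderiv_mulCoeff z hz) (by simp)).toContinuousLinearEquiv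
  have he : (e : ((Fin p → ℂ) × (Fin q → ℂ)) →L[ℂ] (Fin (p + q) → ℂ)) = fderiv ℂ mulCoeff z := by
    refine ContinuousLinearMap.ext fun d => ?_
    rfl
  have hs : HasStrictFDerivAt mulCoeff
      (e : ((Fin p → ℂ) × (Fin q → ℂ)) →L[ℂ] (Fin (p + q) → ℂ)) z := by
    rw [he]
    exact (analyticAt_mulCoeff z).hasStrictFDerivAt
  refine ⟨hs.localInverse _ _ _, ?_, hs.eventually_right_inverse⟩
  exact (hs.toOpenPartialHomeomorph _).analyticAt_symm' hs.mem_toOpenPartialHomeomorph_source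
    (analyticAt_mulCoeff z) he.symm

theorem A.mk_sum {ι : Type*} (s : Finset ι) (f : ι → ℂ → ℂ) (hf : ∀ i, AnalyticAt ℂ (f i) 0) :
    ∑ i ∈ s, A.mk (f i) (hf i) =
      A.mk (fun x => ∑ i ∈ s, f i x) (s.analyticAt_fun_sum fun i _ => hf i) := by
  induction s using Finset.cons_induction with
  | empty => rfl
  | cons i s hi ih =>
    rw [Finset.sum_cons, ih, A.mk_add, A.mk_eq_mk]
    exact .of_forall fun x => (Finset.sum_cons (f := fun i => f i x) hi).symm

/-- Hensel's lemma for `ℂ{t}`: the coefficients of `G` form an analytic arc starting at the product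
of `g₀` and `h₀`, and the local section of multiplication lifts this arc. -/
theorem exists_factorization_of_isCoprime {G : A[X]} (hG : G.Monic) {g₀ h₀ : ℂ[X]} (hg₀ : g₀.Monic)
    (hh₀ : h₀.Monic) (hgh : IsCoprime g₀ h₀) (h : G.map A.ev.toRingHom = g₀ * h₀) :
    ∃ g h : A[X], g.Monic ∧ h.Monic ∧ g.natDegree = g₀.natDegree ∧
      h.natDegree = h₀.natDegree ∧ G = g * h := by
  let z : (Fin g₀.natDegree → ℂ) × (Fin h₀.natDegree → ℂ) := (fun i => g₀.coeff i, fun i => h₀.coeff i)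
  have e1 : g₀ = monicPoly z.1 := eq_monicPoly hg₀ rfl
  have e2 : h₀ = monicPoly z.2 := eq_monicPoly hh₀ rfl
  have hd : G.natDegree = g₀.natDegree + h₀.natDegree := by
    rw [← hg₀.natDegree_mul hh₀, ← h, hG.natDegree_map]
  obtain ⟨Ψ, hΨ, hΨs⟩ := exists_analyticAt_section_mulCoeff z (by rwa [← e1, ← e2])
  choose c hc hcG using fun i : Fin (g₀.natDegree + h₀.natDegree) => A.exists_mk (G.coeff i)
  have hc' : AnalyticAt ℂ (fun t i => c i t) 0 := analyticAt_pi_iff.2 hc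
  have hc0 : (fun t i => c i t) 0 = mulCoeff z := by
    funext i
    have h1 := congrArg (fun f : ℂ[X] => f.coeff i) h
    have h2 : g₀ * h₀ = monicPoly (mulCoeff z) := by
      rw [← monicPoly_mul_monicPoly, ← e1, ← e2]
    rw [coeff_map, hcG, h2, coeff_monicPoly, monicCoeff, dif_pos i.2] at h1
    exact h1
  have hΨc : AnalyticAt ℂ (fun t => Ψ fun i => c i t) 0 := by
    rw [← hc0] at hΨ
    exact hΨ.comp hc'
  have hu (i : Fin g₀.natDegree) : AnalyticAt ℂ (fun t => (Ψ fun i => c i t).1 i) 0 :=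
    analyticAt_pi_iff.1 (analyticAt_fst.comp hΨc) i
  have hv (i : Fin h₀.natDegree) : AnalyticAt ℂ (fun t => (Ψ fun i => c i t).2 i) 0 :=
    analyticAt_pi_iff.1 (analyticAt_snd.comp hΨc) i
  refine ⟨monicPoly fun i => A.mk _ (hu i), monicPoly fun i => A.mk _ (hv i), monic_monicPoly _,
    monic_monicPoly _, natDegree_monicPoly _, natDegree_monicPoly _, ?_⟩
  rw [monicPoly_mul_monicPoly, eq_monicPoly hG hd]
  congr 1
  funext k
  have hmc {p : ℕ} (u : ℂ → Fin p → ℂ) (hu : ∀ i, AnalyticAt ℂ (fun t => u t i) 0) (a : ℕ) :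
      monicCoeff (fun i => A.mk _ (hu i)) a = A.mk (fun t => monicCoeff (u t) a)
        (analyticAt_monicCoeff (analyticAt_pi_iff.2 hu) a) := by
    unfold monicCoeff
    split_ifs <;> rfl
  simp only [mulCoeff]
  rw [hcG, Finset.sum_congr rfl fun x _ => by
    rw [hmc (fun t => (Ψ fun i => c i t).1) hu, hmc (fun t => (Ψ fun i => c i t).2) hv, A.mk_mul],
    A.mk_sum, A.mk_eq_mk]
  have hev : ∀ᶠ t in 𝓝 (0 : ℂ), mulCoeff (Ψ fun i => c i t) = fun i => c i t := by
    rw [← hc0] at hΨs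
    exact hc'.continuousAt.eventually hΨs
  filter_upwards [hev] with t ht
  exact (congrFun ht k).symm

end Hensel

end

section

/-! ### The theorem of Newton and Puiseux -/

/-- The substitution `t ↦ tᴺ`. -/
noncomputable def powSubst (N : ℕ) (hN : N ≠ 0) : A →ₐ[ℂ] A :=
  A.subst (fun t => t ^ N) (analyticAt_id.pow N) (zero_pow hN)

theorem powSubst_X (N : ℕ) (hN : N ≠ 0) : powSubst N hN A.X = A.X ^ N := rfl

theorem powSubst_powSubst {M N : ℕ} (hM : M ≠ 0) (hN : N ≠ 0) (a : A) :
    powSubst N hN (powSubst M hM a) = powSubst (N * M) (mul_ne_zero hN hM) a := by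
  obtain ⟨f, hf, rfl⟩ := A.exists_mk a
  rw [powSubst, powSubst, powSubst, A.subst_mk, A.subst_mk, A.subst_mk, A.mk_eq_mk]
  exact .of_forall fun t => congrArg f (pow_mul t N M).symm

theorem ev_subst (τ : ℂ → ℂ) (hτ : AnalyticAt ℂ τ 0) (h0 : τ 0 = 0) (a : A) :
    A.ev (A.subst τ hτ h0 a) = A.ev a := by
  obtain ⟨f, hf, rfl⟩ := A.exists_mk a
  rw [A.subst_mk, A.ev_mk, A.ev_mk, h0]

theorem ev_powSubst (N : ℕ) (hN : N ≠ 0) (a : A) : A.ev (powSubst N hN a) = A.ev a :=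
  ev_subst _ _ _ a

theorem powSubst_injective (N : ℕ) (hN : N ≠ 0) : Function.Injective (powSubst N hN) := by
  rw [injective_iff_map_eq_zero]
  intro a ha
  by_contra h
  obtain ⟨k, u, hu, rfl⟩ := A.exists_eq_X_pow_mul h
  rw [map_mul, map_pow, powSubst_X, ← pow_mul] at ha
  refine mul_ne_zero (A.X_pow_ne_zero _) ?_ ha
  intro h0
  apply hu
  rw [← ev_powSubst N hN, h0, map_zero]

open Polynomial

section

variable {F : A[X]}

/-- Tschirnhaus translation: `r` is the mean of the roots. -/
theorem exists_taylor_coeff_eq_zero (hF : F.Monic) {n : ℕ} (hn : F.natDegree = n + 1) :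
    ∃ r : A, (taylor r F).coeff n = 0 := by
  refine ⟨algebraMap ℂ A (-((n : ℂ) + 1)⁻¹) * F.coeff n, ?_⟩
  set r := algebraMap ℂ A (-((n : ℂ) + 1)⁻¹) * F.coeff n with hr
  have hd : (hasseDeriv n F).natDegree < 2 := by
    have := natDegree_hasseDeriv_le F n
    omega
  rw [taylor_coeff, eval_eq_sum_range' hd, Finset.sum_range_succ, Finset.sum_range_one,
    hasseDeriv_coeff, hasseDeriv_coeff, zero_add, Nat.choose_self, add_comm 1 n, ← hn,
    hF.coeff_natDegree, hn, Nat.choose_succ_self_right, hr]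
  have h1 : ((n + 1 : ℕ) : A) = algebraMap ℂ A ((n : ℂ) + 1) := by simp
  have h2 : algebraMap ℂ A ((n : ℂ) + 1) * algebraMap ℂ A (-((n : ℂ) + 1)⁻¹) = -1 := by
    rw [← map_mul, mul_neg, mul_inv_cancel₀ (by exact_mod_cast Nat.succ_ne_zero n), map_neg, map_one]
  rw [h1]
  linear_combination (F.coeff n) * h2

/-- After the substitution of a power, a polynomial is obtained by scaling the roots of one whose
reduction is not a power of the variable. -/
theorem exists_scaleRoots (hF : F.Monic) (h : ∃ k < F.natDegree, F.coeff k ≠ 0) :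
    ∃ (M : ℕ) (hM : M ≠ 0) (s : A) (G : A[X]), s ≠ 0 ∧ G.Monic ∧ G.natDegree = F.natDegree ∧
      F.map (powSubst M hM).toRingHom = G.scaleRoots s ∧
      ∃ k < F.natDegree, A.ev (G.coeff k) ≠ 0 := by
  classical
  set n := F.natDegree with hn
  have hex (k : ℕ) : ∃ (ν : ℕ) (u : A), F.coeff k ≠ 0 → A.ev u ≠ 0 ∧ F.coeff k = A.X ^ ν * u := by
    by_cases hk : F.coeff k = 0
    · exact ⟨0, 0, fun h => (h hk).elim⟩
    · obtain ⟨ν, u, hu⟩ := A.exists_eq_X_pow_mul hk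
      exact ⟨ν, u, fun _ => hu⟩
  choose ν u hu using hex
  -- After `t ↦ tᴹ` all slopes `M νₖ / (n - k)` of the Newton polygon are integers.
  let M := n.factorial
  have hM : M ≠ 0 := Nat.factorial_ne_zero n
  let S := (Finset.range n).filter fun k => F.coeff k ≠ 0
  have hS : S.Nonempty := by
    obtain ⟨k, hk, hk0⟩ := h
    exact ⟨k, Finset.mem_filter.2 ⟨Finset.mem_range.2 hk, hk0⟩⟩
  obtain ⟨k₀, hk₀, hmin⟩ := S.exists_min_image (fun k => M * ν k / (n - k)) hS
  -- The minimal slope: scaling the roots by `Xʳ` keeps all coefficients holomorphic and makes the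
  -- one at `k₀` a unit.
  let r := M * ν k₀ / (n - k₀)
  have hdiv (k : ℕ) (hk : k < n) : (n - k) * (M * ν k / (n - k)) = M * ν k :=
    Nat.mul_div_cancel' ((Nat.dvd_factorial (by omega) (by omega)).mul_right _)
  have hle (k : ℕ) (hk : k < n) (hk0 : F.coeff k ≠ 0) : r * (n - k) ≤ M * ν k := by
    rw [← hdiv k hk, mul_comm]
    exact Nat.mul_le_mul_left _ (hmin k (Finset.mem_filter.2 ⟨Finset.mem_range.2 hk, hk0⟩))
  let c (k : Fin n) : A := if F.coeff k = 0 then 0 else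
    A.X ^ (M * ν k - r * (n - k)) * powSubst M hM (u k)
  have hc (k : ℕ) (hk : k < n) :
      powSubst M hM (F.coeff k) = c ⟨k, hk⟩ * (A.X ^ r) ^ (n - k) := by
    by_cases h0 : F.coeff k = 0
    · simp [c, h0]
    · simp only [c, if_neg h0]
      conv_lhs => rw [(hu k h0).2]
      rw [map_mul, map_pow, powSubst_X, ← pow_mul, ← pow_mul, mul_right_comm, ← pow_add,
        Nat.sub_add_cancel (hle k hk h0)]
  refine ⟨M, hM, A.X ^ r, monicPoly c, A.X_pow_ne_zero r, monic_monicPoly c, natDegree_monicPoly c,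
    ?_, k₀, ?_⟩
  · refine Polynomial.ext fun k => ?_
    rw [coeff_map, coeff_scaleRoots, natDegree_monicPoly, coeff_monicPoly, monicCoeff]
    split_ifs with h1 h2
    · exact hc k h1
    · rw [h2, hn, hF.coeff_natDegree]
      simp
    · rw [coeff_eq_zero_of_natDegree_lt (by omega)]
      simp
  · rw [Finset.mem_filter, Finset.mem_range] at hk₀
    refine ⟨hk₀.1, ?_⟩
    rw [coeff_monicPoly, monicCoeff, dif_pos hk₀.1]
    simp only [c, if_neg hk₀.2]
    have : M * ν k₀ - r * (n - k₀) = 0 := by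
      rw [← hdiv k₀ hk₀.1, mul_comm (n - k₀)]
      exact Nat.sub_self _
    rw [this, pow_zero, one_mul, ev_powSubst]
    exact (hu k₀ hk₀.2).1

/-- Splitting off one root `z` with its full multiplicity fails only if `G = (X - z)ⁿ⁺¹`. The
vanishing coefficient in degree `n` then forces `z = 0`, against the nonzero lower coefficient. -/
theorem exists_coprime_factorization {G : ℂ[X]} (hG : G.Monic) {n : ℕ} (hn : G.natDegree = n + 1)
    (h0 : G.coeff n = 0) (h : ∃ k < n + 1, G.coeff k ≠ 0) :
    ∃ g h : ℂ[X], g.Monic ∧ h.Monic ∧ IsCoprime g h ∧ G = g * h ∧ g.natDegree < n + 1 ∧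
      h.natDegree < n + 1 := by
  obtain ⟨z, hz⟩ := IsAlgClosed.exists_root G (by
    rw [degree_eq_natDegree hG.ne_zero, hn]
    exact_mod_cast Nat.succ_ne_zero n)
  obtain ⟨q, hq, hqz⟩ := exists_eq_pow_rootMultiplicity_mul_and_not_dvd G hG.ne_zero z
  set m := rootMultiplicity z G
  have hm : 0 < m := (rootMultiplicity_pos hG.ne_zero).2 hz
  have hqm : q.Monic := ((monic_X_sub_C z).pow m).of_mul_monic_left (hq ▸ hG)
  have hdeg : m + q.natDegree = n + 1 := by
    rw [← hn, hq, ((monic_X_sub_C z).pow m).natDegree_mul hqm, (monic_X_sub_C z).natDegree_pow,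
      natDegree_X_sub_C, mul_one]
  refine ⟨(X - C z) ^ m, q, (monic_X_sub_C z).pow m, hqm, ?_, hq, ?_, by omega⟩
  · exact IsCoprime.pow_left (((irreducible_X_sub_C z).coprime_iff_not_dvd).2 hqz)
  · rw [(monic_X_sub_C z).natDegree_pow, natDegree_X_sub_C, mul_one]
    by_contra hlt
    have hq0 : q = 1 := hqm.natDegree_eq_zero.1 (by omega)
    have hm1 : m = n + 1 := by
      rw [hq0, natDegree_one] at hdeg
      exact hdeg
    rw [hq0, mul_one, hm1] at hq
    have hz0 : z = 0 := by
      have h1 := hq ▸ h0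
      rw [sub_eq_add_neg, ← C_neg, coeff_X_add_C_pow] at h1
      have h2 : ((n : ℂ) + 1) ≠ 0 := by exact_mod_cast Nat.succ_ne_zero n
      simpa [h2] using h1
    obtain ⟨k, hk, hk0⟩ := h
    rw [hq, hz0, C_0, sub_zero, coeff_X_pow, if_neg (by omega)] at hk0
    exact hk0 rfl

theorem splits_map_powSubst_mul {M N : ℕ} (hM : M ≠ 0) (hN : N ≠ 0)
    (h : (F.map (powSubst M hM).toRingHom).Splits) :
    (F.map (powSubst (N * M) (mul_ne_zero hN hM)).toRingHom).Splits := by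
  have := h.map (powSubst N hN).toRingHom
  rw [Polynomial.map_map] at this
  convert this using 2
  ext a : 1
  exact (powSubst_powSubst hM hN a).symm

/-- Every monic polynomial over `ℂ{x}` splits after the substitution `x = tᴺ` for some `N`. -/
theorem exists_splits_map_powSubst (hF : F.Monic) :
    ∃ (N : ℕ) (hN : N ≠ 0), (F.map (powSubst N hN).toRingHom).Splits := by
  induction hd : F.natDegree using Nat.strong_induction_on generalizing F with
  | _ d ih =>
    rcases d with _ | n
    · refine ⟨1, one_ne_zero, .of_natDegree_eq_zero ?_⟩
      rw [hF.natDegree_map, hd]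
    obtain ⟨r, hr⟩ := exists_taylor_coeff_eq_zero hF hd
    have hT : (taylor r F).Monic := by rw [Monic, leadingCoeff_taylor]; exact hF
    have hTd : (taylor r F).natDegree = n + 1 := by rw [natDegree_taylor, hd]
    suffices h : ∃ (N : ℕ) (hN : N ≠ 0), ((taylor r F).map (powSubst N hN).toRingHom).Splits by
      obtain ⟨N, hN, h⟩ := h
      refine ⟨N, hN, ?_⟩
      have h1 := h.taylor (-(powSubst N hN r))
      have h2 : F = taylor (-r) (taylor r F) := by rw [taylor_taylor, neg_add_cancel, taylor_zero]
      rw [h2, map_taylor]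
      rwa [map_neg]
    -- If some lower coefficient survives, scaling the roots and Hensel's lemma give two factors of
    -- smaller degree; otherwise the translated polynomial is `Xⁿ⁺¹`.
    by_cases hc : ∃ k < (taylor r F).natDegree, (taylor r F).coeff k ≠ 0
    · obtain ⟨M, hM, s, G, hs, hG, hGd, hGs, k, hk, hGk⟩ := exists_scaleRoots hT hc
      have hGn : G.coeff n = 0 := by
        have h1 := congrArg (fun p : A[X] => p.coeff n) hGs
        rw [coeff_map, hr, map_zero, coeff_scaleRoots] at h1
        exact (mul_eq_zero.1 h1.symm).resolve_right (pow_ne_zero _ hs)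
      obtain ⟨g₀, h₀, hg₀, hh₀, hgh, hprod, hg₀d, hh₀d⟩ := exists_coprime_factorization
        (hG.map A.ev.toRingHom) (n := n) (by rw [hG.natDegree_map, hGd, hTd])
        (by rw [coeff_map, hGn, map_zero]) ⟨k, hTd ▸ hk, by rw [coeff_map]; exact hGk⟩
      obtain ⟨g, h, hg, hh, hgd, hhd, hGgh⟩ :=
        exists_factorization_of_isCoprime hG hg₀ hh₀ hgh hprod
      obtain ⟨N₁, hN₁, h₁⟩ := ih g.natDegree (by omega) hg rfl
      obtain ⟨N₂, hN₂, h₂⟩ := ih h.natDegree (by omega) hh rfl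
      refine ⟨N₁ * N₂ * M, mul_ne_zero (mul_ne_zero hN₁ hN₂) hM, ?_⟩
      have h3 : (G.map (powSubst (N₁ * N₂) (mul_ne_zero hN₁ hN₂)).toRingHom).Splits := by
        rw [hGgh, Polynomial.map_mul]
        refine Splits.mul ?_ (splits_map_powSubst_mul hN₂ hN₁ h₂)
        have := splits_map_powSubst_mul hN₁ hN₂ h₁
        simpa only [mul_comm N₂ N₁] using this
      have h4 : (taylor r F).map (powSubst (N₁ * N₂ * M)
          (mul_ne_zero (mul_ne_zero hN₁ hN₂) hM)).toRingHom =
          ((taylor r F).map (powSubst M hM).toRingHom).map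
            (powSubst (N₁ * N₂) (mul_ne_zero hN₁ hN₂)).toRingHom := by
        rw [Polynomial.map_map]
        congr 1
        ext a : 1
        exact (powSubst_powSubst hM (mul_ne_zero hN₁ hN₂) a).symm
      rw [h4, hGs, map_scaleRoots]
      · exact h3.scaleRoots _
      · rw [hG.leadingCoeff, map_one]
        exact one_ne_zero
    · push Not at hc
      refine ⟨1, one_ne_zero, ?_⟩
      have : taylor r F = X ^ (n + 1) := by
        ext k
        rw [coeff_X_pow]
        rcases lt_trichotomy k (n + 1) with hk | hk | hk
        · rw [hc k (by omega), if_neg (by omega)]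
        · rw [if_pos hk, hk, ← hTd, hT.coeff_natDegree]
        · rw [coeff_eq_zero_of_natDegree_lt (by omega), if_neg (by omega)]
      rw [this, Polynomial.map_pow, map_X]
      exact Splits.X_pow _

end

end

section

/-! ### Parametrization of irreducible curve germs -/

section extension

open Polynomial

/-- A finite integral domain extension of `R₀` embeds into any integrally closed extension of `R₀`
over which a certain polynomial splits. -/
theorem exists_injective_ringHom_of_splits (R₀ R B : Type) [CommRing R₀] [IsDomain R₀] [CommRing R]
    [IsDomain R] [CommRing B] [IsDomain B] [IsIntegrallyClosed B] [Algebra R₀ R]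
    [Module.Finite R₀ R] (hinj : Function.Injective (algebraMap R₀ R)) :
    ∃ F : R₀[X], F.Monic ∧ ∀ σ : R₀ →+* B, Function.Injective σ → (F.map σ).Splits →
      ∃ ψ : R →+* B, Function.Injective ψ ∧ ∀ a, ψ (algebraMap R₀ R a) = σ a := by
  obtain ⟨S, hS⟩ := Module.Finite.fg_top (R := R₀) (M := R)
  have hint (s : R) : IsIntegral R₀ s := IsIntegral.of_finite R₀ s
  -- One polynomial that controls all generators: if it splits over `B`, their minimal polynomials
  -- over the fraction field split too, and the field they generate embeds in `Frac B`.
  refine ⟨∏ s ∈ S, minpoly R₀ s, monic_prod_of_monic _ _ fun s _ => minpoly.monic (hint s),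
    fun σ hσ hsplit => ?_⟩
  let : Algebra R₀ B := σ.toAlgebra
  let K := FractionRing R₀
  let E := FractionRing R
  let L := FractionRing B
  have hRE : Function.Injective (algebraMap R E) := IsFractionRing.injective R E
  have hBL : Function.Injective (algebraMap B L) := IsFractionRing.injective B L
  have : FaithfulSMul R₀ E := by
    rw [faithfulSMul_iff_algebraMap_injective, IsScalarTower.algebraMap_eq R₀ R E]
    exact hRE.comp hinj
  have : FaithfulSMul R₀ L := by
    rw [faithfulSMul_iff_algebraMap_injective, IsScalarTower.algebraMap_eq R₀ B L]
    exact hBL.comp hσ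
  let : Algebra K E := FractionRing.liftAlgebra R₀ E
  let : Algebra K L := FractionRing.liftAlgebra R₀ L
  have : IsScalarTower R₀ K E := FractionRing.isScalarTower_liftAlgebra R₀ E
  have : IsScalarTower R₀ K L := FractionRing.isScalarTower_liftAlgebra R₀ L
  let S' : Set E := algebraMap R E '' (S : Set R)
  have hK : ∀ s ∈ S', IsIntegral K s ∧ ((minpoly K s).map (algebraMap K L)).Splits := by
    rintro _ ⟨s, hs, rfl⟩
    have h1 : IsIntegral R₀ (algebraMap R E s) := (hint s).algebraMap
    refine ⟨h1.tower_top, ?_⟩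
    have h2 : minpoly K (algebraMap R E s) ∣ (minpoly R₀ s).map (algebraMap R₀ K) := by
      refine minpoly.dvd _ _ ?_
      rw [aeval_map_algebraMap, aeval_algebraMap_apply, minpoly.aeval, map_zero]
    have h3 : ((minpoly R₀ s).map (algebraMap R₀ K)).map (algebraMap K L) ∣
        ((∏ s ∈ S, minpoly R₀ s).map σ).map (algebraMap B L) := by
      rw [Polynomial.map_map, ← IsScalarTower.algebraMap_eq, IsScalarTower.algebraMap_eq R₀ B L,
        ← Polynomial.map_map]
      exact Polynomial.map_dvd _ (Polynomial.map_dvd _ (Finset.dvd_prod_of_mem _ hs))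
    refine (hsplit.map (algebraMap B L)).of_dvd ?_ ((Polynomial.map_dvd _ h2).trans h3)
    exact (((monic_prod_of_monic _ _ fun s _ => minpoly.monic (hint s)).map _).map _).ne_zero
  obtain ⟨φ⟩ := IntermediateField.nonempty_algHom_adjoin_of_splits hK
  have hmem (r : R) : algebraMap R E r ∈ IntermediateField.adjoin K S' := by
    have hr : r ∈ Submodule.span R₀ (S : Set R) := hS ▸ Submodule.mem_top
    induction hr using Submodule.span_induction with
    | mem s hs => exact IntermediateField.subset_adjoin K S' ⟨s, hs, rfl⟩
    | zero => rw [map_zero]; exact zero_mem _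
    | add x y _ _ hx hy => rw [map_add]; exact add_mem hx hy
    | smul a x _ hx =>
      have : algebraMap R E (a • x) = algebraMap K E (algebraMap R₀ K a) * algebraMap R E x := by
        rw [Algebra.smul_def, map_mul, ← IsScalarTower.algebraMap_apply R₀ R E,
          ← IsScalarTower.algebraMap_apply R₀ K E]
      rw [this]
      exact mul_mem (IntermediateField.algebraMap_mem _ _) hx
  let φ' : R →+* L := φ.toRingHom.comp ((algebraMap R E).codRestrict (IntermediateField.adjoin K S') hmem)
  have hφ'inj : Function.Injective φ' := by
    refine (RingHom.injective φ.toRingHom).comp fun x y hxy => ?_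
    exact hRE (congrArg Subtype.val hxy)
  have hφ'a (a : R₀) : φ' (algebraMap R₀ R a) = algebraMap B L (σ a) := by
    have h1 : (algebraMap R E).codRestrict (IntermediateField.adjoin K S') hmem
        (algebraMap R₀ R a) = algebraMap K (IntermediateField.adjoin K S') (algebraMap R₀ K a) := by
      refine Subtype.ext ?_
      change algebraMap R E (algebraMap R₀ R a) = algebraMap K E (algebraMap R₀ K a)
      rw [← IsScalarTower.algebraMap_apply R₀ R E, ← IsScalarTower.algebraMap_apply R₀ K E]
    change φ ((algebraMap R E).codRestrict (IntermediateField.adjoin K S') hmem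
        (algebraMap R₀ R a)) = _
    rw [h1, AlgHom.commutes, ← IsScalarTower.algebraMap_apply R₀ K L,
      IsScalarTower.algebraMap_apply R₀ B L]
    rfl
  -- Elements of `R` are integral over `R₀`, so their images are integral over the integrally closed
  -- ring `B`.
  have hrange (r : R) : φ' r ∈ (algebraMap B L).range := by
    have h1 : IsIntegral B (φ' r) := by
      refine ⟨(minpoly R₀ r).map σ, (minpoly.monic (hint r)).map σ, ?_⟩
      have h2 : (algebraMap B L).comp σ = φ'.comp (algebraMap R₀ R) := by
        ext a
        exact (hφ'a a).symm
      rw [eval₂_map, h2, ← Polynomial.hom_eval₂, ← aeval_def, minpoly.aeval, map_zero]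
    exact IsIntegrallyClosed.algebraMap_eq_of_integral h1
  let e := RingEquiv.ofBijective (algebraMap B L).rangeRestrict
    ⟨fun x y hxy => hBL (congrArg Subtype.val hxy), (algebraMap B L).rangeRestrict_surjective⟩
  have he (z : (algebraMap B L).range) : algebraMap B L (e.symm z) = z :=
    congrArg Subtype.val (e.apply_symm_apply z)
  refine ⟨(e.symm : _ →+* B).comp (φ'.codRestrict _ hrange), ?_, fun a => ?_⟩
  · refine e.symm.injective.comp fun x y hxy => ?_
    exact hφ'inj (congrArg Subtype.val hxy)
  · apply hBL
    change algebraMap B L (e.symm (φ'.codRestrict _ hrange (algebraMap R₀ R a))) = _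
    rw [he]
    exact hφ'a a

end extension

/-- The rotation of angle `ζ`. -/
noncomputable def rot (ζ : ℂ) : A →ₐ[ℂ] A :=
  A.subst (fun t => ζ * t) (analyticAt_const.mul analyticAt_id) (mul_zero ζ)

theorem rot_X (ζ : ℂ) : rot ζ A.X = algebraMap ℂ A ζ * A.X := rfl

theorem rot_rot (ζ ξ : ℂ) (a : A) : rot ζ (rot ξ a) = rot (ξ * ζ) a := by
  obtain ⟨f, hf, rfl⟩ := A.exists_mk a
  rw [rot, rot, rot, A.subst_mk, A.subst_mk, A.subst_mk, A.mk_eq_mk]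
  exact .of_forall fun t => congrArg f (mul_assoc ξ ζ t).symm

theorem rot_one (a : A) : rot 1 a = a := by
  obtain ⟨f, hf, rfl⟩ := A.exists_mk a
  rw [rot, A.subst_mk, A.mk_eq_mk]
  exact .of_forall fun t => congrArg f (one_mul t)

theorem rot_powSubst {ζ : ℂ} {N : ℕ} (hN : N ≠ 0) (hζ : ζ ^ N = 1) (a : A) :
    rot ζ (powSubst N hN a) = powSubst N hN a := by
  obtain ⟨f, hf, rfl⟩ := A.exists_mk a
  rw [rot, powSubst, A.subst_mk, A.subst_mk, A.mk_eq_mk]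
  exact .of_forall fun t => congrArg f (by rw [mul_pow, hζ, one_mul])

/-- Division of `a(x₁)` by `x₁ᴺ - x₀`, restricted to the curve `(tᴺ, t)`, on which the divisor
vanishes. -/
theorem exists_eq_sum_powSubst (N : ℕ) (hN : N ≠ 0) (a : A) :
    ∃ h : Fin N → A, a = ∑ i, powSubst N hN (h i) * A.X ^ (i : ℕ) := by
  obtain ⟨h, q, hq⟩ := O.exists_division (n := 2) 0 (Nat.pos_of_ne_zero hN) (fun _ => 1)
    (O.ofLine (ContinuousLinearMap.proj 1) a)
  have hφ : AnalyticAt ℂ (fun t : ℂ => ![t ^ N, t]) 0 := by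
    refine analyticAt_pi_iff.2 fun i => ?_
    fin_cases i
    · exact analyticAt_id.pow N
    · exact analyticAt_id
  have h0 : (fun t : ℂ => ![t ^ N, t]) 0 = 0 := by
    funext i
    fin_cases i
    · exact zero_pow hN
    · rfl
  let ψ := O.along _ hφ h0
  have e0 : ψ (O.coord 0) = A.X ^ N := rfl
  have e1 : ψ (O.coord 1) = A.X := rfl
  have e2 (b : A) : ψ (O.ofLine (ContinuousLinearMap.proj 1) b) = b := by
    obtain ⟨f, hf, rfl⟩ := A.exists_mk b
    rfl
  have e3 (b : A) : ψ (O.ofLine (ContinuousLinearMap.proj 0) b) = powSubst N hN b := by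
    obtain ⟨f, hf, rfl⟩ := A.exists_mk b
    rfl
  have e4 : (Finset.univ : Finset (Fin 2)).erase 0 = {1} := by decide
  have key := congrArg ψ hq
  rw [e4, Finset.sum_singleton, map_add, map_mul, map_sub, map_mul, map_pow, map_one, e0, e1, e2,
    mul_one, sub_self, mul_zero, add_zero, map_sum] at key
  have key' : a = ∑ α : Fin 2 → Fin N,
      powSubst N hN (h α * A.X ^ (α 0 : ℕ)) * A.X ^ (α 1 : ℕ) := by
    rw [key]
    refine Finset.sum_congr rfl fun α _ => ?_
    rw [map_mul, e3, Fin.prod_univ_two, map_mul, map_pow, map_pow, e0, e1, map_mul, map_pow,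
      powSubst_X, mul_assoc]
  refine ⟨fun i => ∑ α : Fin 2 → Fin N with α 1 = i, h α * A.X ^ (α 0 : ℕ), ?_⟩
  rw [key', ← Finset.sum_fiberwise Finset.univ fun α : Fin 2 → Fin N => α 1]
  refine Finset.sum_congr rfl fun i _ => ?_
  rw [map_sum, Finset.sum_mul]
  refine Finset.sum_congr rfl fun α hα => ?_
  rw [(Finset.mem_filter.1 hα).2]

/-- A germ that is invariant under the rotations of order `N` is a germ in `tᴺ`. -/
theorem exists_eq_powSubst_of_rot_eq {N : ℕ} (hN : N ≠ 0) {ζ : ℂ} (hζ : IsPrimitiveRoot ζ N) {a : A}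
    (ha : rot ζ a = a) : ∃ b, a = powSubst N hN b := by
  obtain ⟨h, hh⟩ := exists_eq_sum_powSubst N hN a
  have hk (k : ℕ) : a = ∑ i : Fin N, algebraMap ℂ A ((ζ ^ (i : ℕ)) ^ k) *
      (powSubst N hN (h i) * A.X ^ (i : ℕ)) := by
    have h1 : rot (ζ ^ k) a = a := by
      induction k with
      | zero => rw [pow_zero, rot_one]
      | succ k ih => rw [pow_succ', ← rot_rot, ha, ih]
    have h2 : (ζ ^ k) ^ N = 1 := by rw [← pow_mul, mul_comm, pow_mul, hζ.pow_eq_one, one_pow]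
    conv_lhs => rw [← h1, hh]
    rw [map_sum]
    refine Finset.sum_congr rfl fun i _ => ?_
    rw [map_mul, map_pow, rot_X, rot_powSubst hN h2, mul_pow, ← map_pow, ← pow_mul, ← pow_mul,
      mul_comm k]
    ring
  have hN' : (N : ℂ) ≠ 0 := Nat.cast_ne_zero.2 hN
  -- Summing over all rotations by powers of `ζ` annihilates every term with `i ≠ 0`.
  have hsum : (N : A) * a = (N : A) * powSubst N hN (h ⟨0, Nat.pos_of_ne_zero hN⟩) := by
    calc (N : A) * a = ∑ k ∈ Finset.range N, a := by simp
      _ = ∑ k ∈ Finset.range N, ∑ i : Fin N, algebraMap ℂ A ((ζ ^ (i : ℕ)) ^ k) *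
          (powSubst N hN (h i) * A.X ^ (i : ℕ)) := Finset.sum_congr rfl fun k _ => hk k
      _ = ∑ i : Fin N, algebraMap ℂ A (∑ k ∈ Finset.range N, (ζ ^ (i : ℕ)) ^ k) *
          (powSubst N hN (h i) * A.X ^ (i : ℕ)) := by
        rw [Finset.sum_comm]
        refine Finset.sum_congr rfl fun i _ => ?_
        rw [map_sum, Finset.sum_mul]
      _ = (N : A) * powSubst N hN (h ⟨0, Nat.pos_of_ne_zero hN⟩) := by
        rw [Finset.sum_eq_single ⟨0, Nat.pos_of_ne_zero hN⟩]
        · simp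
        · intro i _ hi
          have hi0 : (i : ℕ) ≠ 0 := fun h => hi (Fin.ext h)
          have h1 : ζ ^ (i : ℕ) ≠ 1 := hζ.pow_ne_one_of_pos_of_lt hi0 i.2
          have h2 : (ζ ^ (i : ℕ)) ^ N = 1 := by
            rw [← pow_mul, mul_comm, pow_mul, hζ.pow_eq_one, one_pow]
          rw [geom_sum_eq h1, h2, sub_self, zero_div, map_zero, zero_mul]
        · intro h
          exact (h (Finset.mem_univ _)).elim
  refine ⟨_, mul_left_cancel₀ ?_ hsum⟩
  have h1 : (N : A) = algebraMap ℂ A N := by simp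
  rw [h1, Ne, ← map_zero (algebraMap ℂ A)]
  exact fun h => hN' ((algebraMap ℂ A).injective h)

end

/-! ### Construction of injective parametrizations -/

section

variable {n : ℕ}

/-- `φ` is an injective parametrization of the irreducible germ with ideal `P`. -/
structure IsParam (P : Ideal (O n)) (φ : ℂ → Fin n → ℂ) : Prop where
  analyticAt : AnalyticAt ℂ φ 0
  map_zero : φ 0 = 0
  injOn : ∃ U ∈ 𝓝 (0 : ℂ), Set.InjOn φ U
  ker_eq : RingHom.ker (O.along φ analyticAt map_zero) = P

theorem injective_mk_comp_ofLine {P : Ideal (O n)} (hP : P.IsPrime) {j : Fin n}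
    (hj : O.coord j ∉ P) : Function.Injective ((Ideal.Quotient.mk P).comp
      (O.ofLine (ContinuousLinearMap.proj j) : A →ₐ[ℂ] O n).toRingHom) := by
  rw [injective_iff_map_eq_zero]
  intro a ha
  by_contra h
  obtain ⟨k, u, hu, rfl⟩ := A.exists_eq_X_pow_mul h
  rw [map_mul] at ha
  have h1 := ((A.isUnit_iff.2 hu).map ((Ideal.Quotient.mk P).comp
      (O.ofLine (ContinuousLinearMap.proj j) : A →ₐ[ℂ] O n).toRingHom)).mul_left_eq_zero.1 ha
  rw [map_pow] at h1
  have h2 := Ideal.Quotient.eq_zero_iff_mem.1 (eq_zero_of_pow_eq_zero h1)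
  exact hj h2

/-- `O n / P` is a domain finite over `ℂ{xⱼ}`; by Newton-Puiseux it embeds in `ℂ{t}` over `xⱼ = tᴺ`,
and the composite `O n → ℂ{t}` is restriction to a curve. -/
theorem O.IsCurvePrime.exists_ker_along {P : Ideal (O n)} (hP : O.IsCurvePrime P) {j : Fin n}
    (hj : O.coord j ∉ P) : ∃ (N : ℕ) (_ : N ≠ 0) (φ : ℂ → Fin n → ℂ) (hφ : AnalyticAt ℂ φ 0)
      (h0 : φ 0 = 0), O.along φ hφ h0 (O.coord j) = A.X ^ N ∧
        RingHom.ker (O.along φ hφ h0) = P := by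
  obtain ⟨k, hk, g, hg⟩ := hP.exists_pow_sub_mem hj
  have hfin := O.finite_quotient_of_mem hk fun i (_ : i ≠ j) => hg i
  have hinj := injective_mk_comp_ofLine hP.isPrime hj
  have := hP.isPrime
  set θ := (Ideal.Quotient.mk P).comp
    (O.ofLine (ContinuousLinearMap.proj j) : A →ₐ[ℂ] O n).toRingHom with hθ
  let : Algebra A (O n ⧸ P) := θ.toAlgebra
  have : Module.Finite A (O n ⧸ P) := hfin
  obtain ⟨F, hF, H⟩ := exists_injective_ringHom_of_splits A (O n ⧸ P) A hinj
  obtain ⟨N, hN, hs⟩ := exists_splits_map_powSubst hF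
  obtain ⟨ψ, hψ, hψa⟩ := H _ (powSubst_injective N hN) hs
  have hline (a : A) : ψ (Ideal.Quotient.mk P (O.ofLine (ContinuousLinearMap.proj j) a)) =
      powSubst N hN a := hψa a
  let Ψ : O n →ₐ[ℂ] A :=
    { ψ.comp (Ideal.Quotient.mk P) with
      commutes' := fun c => by
        have := hline (algebraMap ℂ A c)
        rwa [AlgHom.commutes, AlgHom.commutes] at this }
  have hΨj : Ψ (O.coord j) = A.X ^ N := hline A.X
  have hΨ0 (f : O n) : Ψ f = 0 ↔ f ∈ P := by
    change ψ (Ideal.Quotient.mk P f) = 0 ↔ _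
    rw [map_eq_zero_iff ψ hψ, Ideal.Quotient.eq_zero_iff_mem]
  -- The relation `xᵢᵏ ≡ xⱼ gᵢ` makes a power of the image divisible by the prime `X`.
  have hX (i : Fin n) : A.X ∣ Ψ (O.coord i) := by
    have h1 := (hΨ0 _).2 (hg i)
    rw [map_sub, map_mul, map_pow, hΨj, sub_eq_zero] at h1
    refine A.irreducible_X.prime.dvd_of_dvd_pow (n := k) ?_
    rw [h1]
    exact (dvd_pow_self _ hN).mul_right _
  obtain ⟨φ, hφ, h0, hΨφ⟩ := O.exists_eq_along Ψ hX
  refine ⟨N, hN, φ, hφ, h0, hΨφ ▸ hΨj, ?_⟩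
  rw [← hΨφ]
  ext f
  exact hΨ0 f

theorem rot_mk {ζ : ℂ} {f : ℂ → ℂ} {hf : AnalyticAt ℂ f 0} :
    rot ζ (A.mk f hf) = A.mk (fun t => f (ζ * t))
      (A.comp_analyticAt hf (analyticAt_const.mul analyticAt_id) (mul_zero ζ)) := rfl

theorem powSubst_mk {N : ℕ} {hN : N ≠ 0} {f : ℂ → ℂ} {hf : AnalyticAt ℂ f 0} :
    powSubst N hN (A.mk f hf) = A.mk (fun t => f (t ^ N))
      (A.comp_analyticAt hf (analyticAt_id.pow N) (zero_pow hN)) := rfl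

/-- Every irreducible germ of curve has an injective parametrization. -/
theorem O.IsCurvePrime.exists_isParam {P : Ideal (O n)} (hP : O.IsCurvePrime P) :
    ∃ φ, IsParam P φ := by
  classical
  obtain ⟨j, hj⟩ := hP.exists_coord_notMem
  have hex := hP.exists_ker_along hj
  -- Minimality of `N` excludes rotational symmetry: if `φ(ζt) = φ(t)` with `ζ ≠ 1` of order `e`,
  -- then `φ` is a function of `tᵉ`, and `N / e` would also do.
  set N := Nat.find hex with hNdef
  obtain ⟨hN, φ, hφ, h0, hφj, hker⟩ := Nat.find_spec hex
  rw [← hNdef] at hN hφj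
  refine ⟨φ, hφ, h0, ?_, hker⟩
  have hφjt : ∀ᶠ t in 𝓝 0, φ t j = t ^ N :=
    A.mk_eq_mk (hf := analyticAt_pi_iff.1 hφ j) (hg := analyticAt_id.pow N) |>.1 hφj
  have hprim (ζ : ℂ) (hζN : ζ ^ N = 1) (hζ : ζ ≠ 1) : ¬ ∀ᶠ t in 𝓝 0, φ (ζ * t) = φ t := by
    intro h
    set e := orderOf ζ
    have hζe : IsPrimitiveRoot ζ e := IsPrimitiveRoot.orderOf ζ
    have heN : e ∣ N := orderOf_dvd_of_pow_eq_one hζN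
    have he0 : e ≠ 0 := fun h => hN (Nat.eq_zero_of_zero_dvd (h ▸ heN))
    have he1 : e ≠ 1 := fun h => hζ (orderOf_eq_one_iff.1 h)
    obtain ⟨d, hd⟩ := heN
    have hφi (i : Fin n) : AnalyticAt ℂ (fun t => φ t i) 0 := analyticAt_pi_iff.1 hφ i
    have hb (i : Fin n) : ∃ b, A.mk _ (hφi i) = powSubst e he0 b := by
      refine exists_eq_powSubst_of_rot_eq he0 hζe ?_
      rw [rot_mk, A.mk_eq_mk]
      filter_upwards [h] with t ht
      rw [ht]
    choose b hb using hb
    choose φ' hφ' hbφ using fun i => A.exists_mk (b i)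
    have h0' : (fun t i => φ' i t) 0 = 0 := by
      funext i
      have h1 := congrArg A.ev (hb i)
      rw [ev_powSubst, hbφ, A.ev_mk, A.ev_mk, h0] at h1
      exact h1.symm
    have hcomp : O.along φ hφ h0 = (powSubst e he0).comp
        (O.along _ (analyticAt_pi_iff.2 hφ') h0') := by
      refine O.algHom_ext (fun i => ?_) fun i => ?_
      · refine (hb i).trans ?_
        rw [hbφ]
        rfl
      · rw [A.X_dvd_iff]
        exact congrFun h0 i
    have hd0 : d ≠ 0 := by
      rintro rfl
      exact hN (by rw [hd, mul_zero])
    refine Nat.find_min hex (m := d) ?_ ⟨hd0, fun t i => φ' i t, analyticAt_pi_iff.2 hφ', h0', ?_, ?_⟩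
    · rw [← hNdef, hd]
      exact lt_mul_left (Nat.pos_of_ne_zero hd0) (by omega)
    · apply powSubst_injective e he0
      rw [map_pow, powSubst_X, ← pow_mul, ← hd, ← hφj, hcomp]
      rfl
    · rw [← hker, hcomp]
      ext f
      rw [RingHom.mem_ker, RingHom.mem_ker, AlgHom.comp_apply,
        map_eq_zero_iff _ (powSubst_injective e he0)]
  have hne (ζ : ℂ) (hζ : ζ ∈ (Polynomial.nthRootsFinset N (1 : ℂ)).erase 1) :
      ∀ᶠ t in 𝓝[≠] (0 : ℂ), φ (ζ * t) ≠ φ t := by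
    rw [Finset.mem_erase, Polynomial.mem_nthRootsFinset (Nat.pos_of_ne_zero hN)] at hζ
    have h1 : AnalyticAt ℂ (fun t => φ (ζ * t)) 0 := by
      have h2 : AnalyticAt ℂ φ (ζ * 0) := by rwa [mul_zero]
      exact h2.comp (analyticAt_const.mul analyticAt_id)
    exact (h1.eventually_eq_or_eventually_ne hφ).resolve_left (hprim ζ hζ.2 hζ.1)
  have hall : ∀ᶠ t in 𝓝[≠] (0 : ℂ), ∀ ζ ∈ (Polynomial.nthRootsFinset N (1 : ℂ)).erase 1,
      φ (ζ * t) ≠ φ t := (Finset.eventually_all _).2 hne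
  rw [eventually_nhdsWithin_iff] at hall
  -- Two parameters with the same image have equal `N`-th powers, hence differ by a root of unity
  -- `ζ`; for `ζ ≠ 1` the identity principle gives `φ(ζt) ≠ φ(t)` near `0`, away from `0`.
  refine ⟨_, hall.and hφjt, ?_⟩
  rintro t ⟨-, ht⟩ s ⟨hs, hs'⟩ hts
  have hpow : t ^ N = s ^ N := by rw [← ht, ← hs', hts]
  by_cases hs0 : s = 0
  · rw [hs0, zero_pow hN] at hpow
    rw [hs0, pow_eq_zero_iff hN |>.1 hpow]
  · by_contra hne
    refine hs hs0 (t / s) ?_ ?_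
    · rw [Finset.mem_erase, Polynomial.mem_nthRootsFinset (Nat.pos_of_ne_zero hN), div_pow, hpow]
      exact ⟨fun h => hne ((div_eq_one_iff_eq hs0).1 h), div_self (pow_ne_zero _ hs0)⟩
    · rw [div_mul_cancel₀ _ hs0, hts]

end

section

/-! ### Lengths -/

section length

variable {V W : Type*} [AddCommGroup V] [Module ℂ V] [AddCommGroup W] [Module ℂ W]

/-- The sequence `0 → V/J → W/ψ(J) → W/ψ(V) → 0` is exact. It transfers lengths from germs in
several variables to `ℂ{t}`. -/
theorem length_quotient_map (ψ : V →ₗ[ℂ] W) (J : Submodule ℂ V) (h : LinearMap.ker ψ ≤ J) :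
    Module.length ℂ (W ⧸ J.map ψ) =
      Module.length ℂ (V ⧸ J) + Module.length ℂ (W ⧸ LinearMap.range ψ) := by
  have hle : J.map ψ ≤ LinearMap.range ψ := LinearMap.map_le_range
  refine Module.length_eq_add_of_exact (J.mapQ (J.map ψ) ψ (Submodule.le_comap_map ψ J))
    (Submodule.factor hle) ?_ (Submodule.factor_surjective hle) ?_
  · rw [← LinearMap.ker_eq_bot, Submodule.ker_mapQ, Submodule.comap_map_eq, sup_eq_left.2 h,
      Submodule.mkQ_map_self]
  · rw [LinearMap.exact_iff]
    ext x
    obtain ⟨w, rfl⟩ := Submodule.Quotient.mk_surjective _ x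
    rw [LinearMap.mem_ker]
    change (Submodule.Quotient.mk w : W ⧸ LinearMap.range ψ) = 0 ↔ _
    rw [Submodule.Quotient.mk_eq_zero]
    constructor
    · rintro ⟨v, rfl⟩
      exact ⟨Submodule.Quotient.mk v, rfl⟩
    · rintro ⟨y, hy⟩
      obtain ⟨v, rfl⟩ := Submodule.Quotient.mk_surjective _ y
      have h1 : (Submodule.Quotient.mk (ψ v) : W ⧸ J.map ψ) = Submodule.Quotient.mk w := hy
      rw [Submodule.Quotient.eq] at h1
      have h2 := (LinearMap.range ψ).sub_mem ⟨v, rfl⟩ (hle h1)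
      rwa [sub_sub_cancel] at h2

theorem length_quotient_le {S T : Submodule ℂ V} (h : S ≤ T) :
    Module.length ℂ (V ⧸ T) ≤ Module.length ℂ (V ⧸ S) :=
  Module.length_le_of_surjective (Submodule.factor h) (Submodule.factor_surjective h)

end length

namespace A

/-- Multiplication by `a` as a linear map. -/
noncomputable abbrev mulLin (a : A) : A →ₗ[ℂ] A := LinearMap.mulLeft ℂ a

theorem ker_mulLin {a : A} (ha : a ≠ 0) : LinearMap.ker (mulLin a) = ⊥ :=
  LinearMap.ker_eq_bot.2 fun _ _ h => mul_left_cancel₀ ha h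

/-- Here `S` is only a subspace; it will be the image of a ring of germs, which is not an ideal. -/
theorem length_quotient_map_mulLin {a : A} (ha : a ≠ 0) (S : Submodule ℂ A) :
    Module.length ℂ (A ⧸ S.map (mulLin a)) =
      Module.length ℂ (A ⧸ S) + Module.length ℂ (A ⧸ LinearMap.range (mulLin a)) :=
  length_quotient_map _ _ (by rw [ker_mulLin ha]; exact bot_le)

theorem mulLin_mul (a b : A) : mulLin (a * b) = mulLin a ∘ₗ mulLin b := by
  exact LinearMap.ext fun x => mul_assoc a b x

theorem range_mulLin_unit {u : A} (hu : ev u ≠ 0) : LinearMap.range (mulLin u) = ⊤ := by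
  obtain ⟨w, hw⟩ := isUnit_iff_exists_inv.1 (isUnit_iff.2 hu)
  rw [LinearMap.range_eq_top]
  intro x
  refine ⟨w * x, ?_⟩
  change u * (w * x) = x
  rw [← mul_assoc, hw, one_mul]

theorem length_quotient_range_X : Module.length ℂ (A ⧸ LinearMap.range (mulLin X)) = 1 := by
  have h : LinearMap.range (mulLin X) = LinearMap.ker ev.toLinearMap := by
    ext x
    rw [LinearMap.mem_ker]
    change _ ↔ ev x = 0
    rw [← X_dvd_iff]
    exact ⟨fun ⟨y, hy⟩ => ⟨y, hy.symm⟩, fun ⟨y, hy⟩ => ⟨y, hy.symm⟩⟩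
  rw [h, (LinearMap.quotKerEquivOfSurjective ev.toLinearMap
    fun c => ⟨algebraMap ℂ A c, ev.commutes c⟩).length_eq, Module.length_eq_finrank,
    Module.finrank_self, Nat.cast_one]

theorem length_quotient_range_X_pow (k : ℕ) :
    Module.length ℂ (A ⧸ LinearMap.range (mulLin (X ^ k))) = k := by
  induction k with
  | zero =>
    have : ev (X ^ 0) ≠ 0 := by simp
    rw [range_mulLin_unit this, Nat.cast_zero, Module.length_eq_zero_iff]
    exact Submodule.Quotient.subsingleton_iff.2 rfl
  | succ k ih =>
    rw [pow_succ', mulLin_mul, LinearMap.range_comp, length_quotient_map_mulLin X_ne_zero, ih,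
      length_quotient_range_X]
    push_cast
    rfl

theorem length_quotient_range {k : ℕ} {u : A} (hu : ev u ≠ 0) :
    Module.length ℂ (A ⧸ LinearMap.range (mulLin (X ^ k * u))) = k := by
  rw [mulLin_mul, LinearMap.range_comp, range_mulLin_unit hu, ← LinearMap.range_eq_map,
    length_quotient_range_X_pow]

theorem length_quotient_range_ne_top {a : A} (ha : a ≠ 0) :
    Module.length ℂ (A ⧸ LinearMap.range (mulLin a)) ≠ ⊤ := by
  obtain ⟨k, u, hu, rfl⟩ := exists_eq_X_pow_mul ha
  rw [length_quotient_range hu]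
  exact ENat.natCast_ne_top k

end A

/-! ### Norms -/

section norm

open Polynomial

/-- A standard primitive root of unity. -/
noncomputable def zetaRoot (N : ℕ) : ℂ := Complex.exp (2 * Real.pi * Complex.I / N)

theorem isPrimitiveRoot_zetaRoot {N : ℕ} (hN : N ≠ 0) : IsPrimitiveRoot (zetaRoot N) N :=
  Complex.isPrimitiveRoot_exp N hN

theorem exists_map_powSubst_eq {N : ℕ} (hN : N ≠ 0) {p : A[X]}
    (hp : p.map (rot (zetaRoot N)).toRingHom = p) :
    ∃ q : A[X], q.map (powSubst N hN).toRingHom = p := by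
  rw [← mem_lifts, lifts_iff_coeff_lifts]
  intro k
  have h1 : rot (zetaRoot N) (p.coeff k) = p.coeff k := by
    conv_rhs => rw [← hp, coeff_map]
    rfl
  obtain ⟨b, hb⟩ := exists_eq_powSubst_of_rot_eq hN (isPrimitiveRoot_zetaRoot hN) h1
  exact ⟨b, hb.symm⟩

theorem zetaRoot_pow_pow {N : ℕ} (hN : N ≠ 0) (k : ℕ) : (zetaRoot N ^ k) ^ N = 1 := by
  rw [← pow_mul, mul_comm, pow_mul, (isPrimitiveRoot_zetaRoot hN).pow_eq_one, one_pow]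

/-- The conjugates of a germ under rotations. -/
noncomputable def conj (N : ℕ) (b : A) (k : ℕ) : A := rot (zetaRoot N ^ k) b

theorem conj_zero (N : ℕ) (b : A) : conj N b 0 = b := by rw [conj, pow_zero, rot_one]

theorem conj_self {N : ℕ} (hN : N ≠ 0) (b : A) : conj N b N = b := by
  rw [conj, (isPrimitiveRoot_zetaRoot hN).pow_eq_one, rot_one]

theorem rot_conj (N : ℕ) (b : A) (k : ℕ) : rot (zetaRoot N) (conj N b k) = conj N b (k + 1) := by
  rw [conj, rot_rot, conj, pow_succ]

theorem rot_injective {ζ : ℂ} (hζ : ζ ≠ 0) : Function.Injective (rot ζ) := by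
  intro a b h
  have := congrArg (rot ζ⁻¹) h
  rwa [rot_rot, rot_rot, mul_inv_cancel₀ hζ, rot_one, rot_one] at this

/-- The polynomial whose roots are the conjugates of `b` descends to `ℂ{x}`, `x = tᴺ`. -/
theorem exists_normPoly {N : ℕ} (hN : N ≠ 0) (b : A) :
    ∃ Q : A[X], Q.map (powSubst N hN).toRingHom =
      ∏ k ∈ Finset.range N, (Polynomial.X - C (conj N b k)) := by
  apply exists_map_powSubst_eq
  rw [Polynomial.map_prod]
  have h1 (k : ℕ) : (Polynomial.X - C (conj N b k)).map (rot (zetaRoot N)).toRingHom =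
      Polynomial.X - C (conj N b (k + 1)) := by
    rw [Polynomial.map_sub, map_X, map_C]
    exact congrArg (fun a => Polynomial.X - C a) (rot_conj N b k)
  simp only [h1]
  -- The rotation shifts the conjugates cyclically: splitting off either end of the product over `N
  -- + 1` indices gives the same factor.
  have h2 := Finset.prod_range_succ (fun k => Polynomial.X - C (conj N b k)) N
  rw [Finset.prod_range_succ', conj_self hN, conj_zero] at h2
  exact mul_right_cancel₀ (monic_X_sub_C b).ne_zero h2

theorem exists_normPoly_spec {N : ℕ} (hN : N ≠ 0) (b : A) :
    ∃ Q : A[X], Q.Monic ∧ Q.natDegree = N ∧ Q.map (powSubst N hN).toRingHom =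
      ∏ k ∈ Finset.range N, (Polynomial.X - C (conj N b k)) := by
  obtain ⟨Q, hQ⟩ := exists_normPoly hN b
  have hm : (∏ k ∈ Finset.range N, (Polynomial.X - C (conj N b k))).Monic :=
    monic_prod_of_monic _ _ fun _ _ => monic_X_sub_C _
  refine ⟨Q, ?_, ?_, hQ⟩
  · exact monic_of_injective (powSubst_injective N hN) (hQ ▸ hm)
  · rw [← natDegree_map_eq_of_injective (powSubst_injective N hN) Q]
    rw [hQ, natDegree_prod_of_monic _ _ fun _ _ => monic_X_sub_C _]
    simp

end norm

end

section

/-! ### Branches of plane curves -/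

section planeBranch

open Polynomial

theorem algHom_ofLine {n : ℕ} {ψ : O n →ₐ[ℂ] A} (hX : ∀ i, A.X ∣ ψ (O.coord i))
    {l : (Fin n → ℂ) →L[ℂ] ℂ} {m : ℕ} (hm : m ≠ 0) (h : ψ (O.lin l) = A.X ^ m) (a : A) :
    ψ (O.ofLine l a) = powSubst m hm a := by
  obtain ⟨φ, hφ, h0, rfl⟩ := O.exists_eq_along ψ hX
  obtain ⟨f, hf, rfl⟩ := A.exists_mk a
  have h1 : ∀ᶠ t in 𝓝 0, l (φ t) = t ^ m :=
    A.mk_eq_mk (hf := O.comp_analyticAt (l.analyticAt 0) hφ h0) (hg := analyticAt_id.pow m) |>.1 h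
  rw [powSubst_mk, O.ofLine_mk, O.along_mk, A.mk_eq_mk]
  filter_upwards [h1] with t ht
  rw [ht]

/-- The homomorphism `ψ` is the restriction to a primitive parametrized plane branch
`t ↦ (tᵐ, tᵐ c(t))`. -/
structure IsPlaneBranch (ψ : O 2 →ₐ[ℂ] A) (m : ℕ) (c : A) : Prop where
  ne_zero : m ≠ 0
  coord_zero : ψ (O.coord 0) = A.X ^ m
  coord_one : ψ (O.coord 1) = A.X ^ m * c
  conj_ne : ∀ k, 0 < k → k < m → conj m c k ≠ c

theorem rot_X_pow {m : ℕ} {ζ : ℂ} (hζ : ζ ^ m = 1) : rot ζ (A.X ^ m) = A.X ^ m := by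
  rw [map_pow, rot_X, mul_pow, ← map_pow, hζ, map_one, one_mul]

theorem conj_X_pow_mul {m : ℕ} (hm : m ≠ 0) (c : A) (k : ℕ) :
    conj m (A.X ^ m * c) k = A.X ^ m * conj m c k := by
  rw [conj, map_mul, rot_X_pow (zetaRoot_pow_pow hm k), conj]

theorem ev_rot (ζ : ℂ) (a : A) : A.ev (rot ζ a) = A.ev a := ev_subst _ _ _ a

theorem ev_conj (m : ℕ) (c : A) (k : ℕ) : A.ev (conj m c k) = A.ev c := ev_rot _ _

namespace IsPlaneBranch

variable {ψ : O 2 →ₐ[ℂ] A} {m : ℕ} {c : A} (h : IsPlaneBranch ψ m c)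

include h

theorem X_dvd (i : Fin 2) : A.X ∣ ψ (O.coord i) := by
  have h1 := dvd_pow_self A.X h.ne_zero
  fin_cases i
  · exact h.coord_zero ▸ h1
  · exact h.coord_one ▸ h1.mul_right c

theorem apply_ofLine (a : A) :
    ψ (O.ofLine (ContinuousLinearMap.proj 0) a) = powSubst m h.ne_zero a :=
  algHom_ofLine h.X_dvd h.ne_zero h.coord_zero a

theorem apply_eval₂ (G : A[X]) :
    ψ (G.eval₂ (O.ofLine (ContinuousLinearMap.proj 0) : A →ₐ[ℂ] O 2).toRingHom (O.coord 1)) =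
      (G.map (powSubst m h.ne_zero).toRingHom).eval (A.X ^ m * c) := by
  rw [eval_map, ← h.coord_one, ← AlgHom.coe_toRingHom ψ]
  refine (hom_eval₂ G _ ψ.toRingHom _).trans ?_
  congr 1
  exact RingHom.ext h.apply_ofLine

theorem conj_injOn : Set.InjOn (conj m (A.X ^ m * c)) (Finset.range m) := by
  have key : ∀ k l, k < l → l < m → conj m (A.X ^ m * c) k ≠ conj m (A.X ^ m * c) l := by
    intro k l hkl hlm hkl'
    rw [conj_X_pow_mul h.ne_zero, conj_X_pow_mul h.ne_zero] at hkl'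
    have h1 := mul_left_cancel₀ (A.X_pow_ne_zero m) hkl'
    have h2 : conj m c l = rot (zetaRoot m ^ k) (conj m c (l - k)) := by
      rw [conj, conj, rot_rot, ← pow_add, Nat.sub_add_cancel hkl.le]
    rw [h2, conj] at h1
    exact h.conj_ne (l - k) (by omega) (by omega) (rot_injective
      (pow_ne_zero _ ((isPrimitiveRoot_zetaRoot h.ne_zero).ne_zero h.ne_zero)) h1).symm
  intro k hk l hl hkl
  rw [Finset.coe_range, Set.mem_Iio] at hk hl
  rcases lt_trichotomy k l with h1 | h1 | h1
  · exact (key k l h1 hl hkl).elim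
  · exact h1
  · exact (key l k h1 hk hkl.symm).elim

/-- Lagrange interpolation: `F(Y) = ∑ₖ a⁽ᵏ⁾ ∏_{l≠k} (Y - b⁽ˡ⁾)`, with upper indices for conjugates,
is invariant under rotation, so it descends to `ℂ{x}[Y]`. Its value at `Y = b` is `D a` with `D =
∏_{l≠0} (b - b⁽ˡ⁾)`. Indices in `ZMod m` turn rotation into a translation. -/
theorem exists_mul_mem_range : ∃ D : A, D ≠ 0 ∧ ∀ a, D * a ∈ ψ.range := by
  have hm := h.ne_zero
  have : NeZero m := ⟨hm⟩
  set b := A.X ^ m * c with hb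
  have hval (k : ZMod m) : zetaRoot m ^ (k + 1).val = zetaRoot m ^ (k.val + 1) := by
    rw [ZMod.val_add, ZMod.val_one_eq_one_mod, Nat.add_mod_mod,
      pow_eq_pow_mod (k.val + 1) (isPrimitiveRoot_zetaRoot hm).pow_eq_one]
  have hrot (a : A) (k : ZMod m) : rot (zetaRoot m) (conj m a k.val) = conj m a (k + 1).val := by
    rw [rot_conj, conj, conj, hval]
  refine ⟨∏ l ∈ Finset.univ.erase (0 : ZMod m), (b - conj m b l.val), ?_, fun a => ?_⟩
  · rw [Finset.prod_ne_zero_iff]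
    intro l hl h1
    have h2 := h.conj_injOn (x₁ := 0) (x₂ := l.val) (by simpa using Nat.pos_of_ne_zero hm)
      (by simpa using ZMod.val_lt l) (by rw [conj_zero]; exact sub_eq_zero.1 h1)
    exact Finset.ne_of_mem_erase hl ((ZMod.val_eq_zero l).1 h2.symm)
  · let F : A[X] := ∑ k : ZMod m, C (conj m a k.val) *
      ∏ l ∈ Finset.univ.erase k, (Polynomial.X - C (conj m b l.val))
    have hF : F.map (rot (zetaRoot m)).toRingHom = F := by
      have h1 (a : A) (k : ZMod m) : C ((rot (zetaRoot m)).toRingHom (conj m a k.val)) =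
          C (conj m a (k + 1).val) := congrArg C (hrot a k)
      simp only [F, Polynomial.map_sum, Polynomial.map_mul, Polynomial.map_prod,
        Polynomial.map_sub, map_X, map_C, h1]
      refine Fintype.sum_equiv (Equiv.addRight 1) _ _ fun k => ?_
      congr 1
      refine Finset.prod_equiv (Equiv.addRight 1) (fun l => ?_) fun l _ => rfl
      simp
    obtain ⟨G, hG⟩ := exists_map_powSubst_eq hm hF
    refine ⟨_, (h.apply_eval₂ G).trans ?_⟩
    rw [hG, eval_finsetSum, Finset.sum_eq_single 0]
    · rw [eval_mul, eval_C, eval_prod, ZMod.val_zero, conj_zero, mul_comm]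
      simp [hb]
    · intro k _ hk
      rw [eval_mul, eval_prod, Finset.prod_eq_zero (i := 0)
        (Finset.mem_erase.2 ⟨hk.symm, Finset.mem_univ _⟩), mul_zero]
      simp [conj_zero, hb]
    · simp

/-- The image contains `D ℂ{t}`, so the delta invariant is finite. -/
theorem length_quotient_range_ne_top :
    Module.length ℂ (A ⧸ LinearMap.range ψ.toLinearMap) ≠ ⊤ := by
  obtain ⟨D, hD, hr⟩ := h.exists_mul_mem_range
  refine ne_top_of_le_ne_top (A.length_quotient_range_ne_top hD) (length_quotient_le ?_)
  rintro _ ⟨a, rfl⟩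
  exact hr a

/-- `f` is the norm polynomial of `b = tᵐ c`. Division by `f` leaves a remainder of degree less than
`m` in `y`; if it vanishes at `b` it vanishes at the `m` distinct conjugates, so it is zero. The
value along another branch is stated after `t ↦ tᵐ`, where the product over conjugates becomes
available. -/
theorem exists_ker_eq : ∃ f : O 2, RingHom.ker ψ = Ideal.span {f} ∧
    ∀ {ψ' : O 2 →ₐ[ℂ] A} {m' : ℕ} {c' : A} (h' : IsPlaneBranch ψ' m' c'),
      powSubst m h.ne_zero (ψ' f) = A.X ^ (m * (m * m')) *
        ∏ k ∈ Finset.range m, (powSubst m h.ne_zero c' - powSubst m' h'.ne_zero (conj m c k)) := by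
  have hm := h.ne_zero
  obtain ⟨Q, hQm, hQd, hQ⟩ := exists_normPoly_spec hm (A.X ^ m * c)
  set f := Q.eval₂ (O.ofLine (ContinuousLinearMap.proj 0) : A →ₐ[ℂ] O 2).toRingHom (O.coord 1)
    with hf
  refine ⟨f, ?_, fun {ψ' m' c'} h' => ?_⟩
  · have hfψ : ψ f = 0 := by
      rw [hf, h.apply_eval₂, hQ, eval_prod, Finset.prod_eq_zero (i := 0)]
      · simpa using Nat.pos_of_ne_zero hm
      · simp [conj_zero]
    -- All conjugates vanish at `0`, so `f` has the shape `yᵐ - x g` required for division.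
    have hQi (i : ℕ) (hi : i < m) : A.X ∣ Q.coeff i := by
      rw [A.X_dvd_iff, ← ev_powSubst m hm]
      have h1 := congrArg (fun p => (p.map A.ev.toRingHom).coeff i) hQ
      have h2 (k : ℕ) : A.ev.toRingHom (conj m (A.X ^ m * c) k) = 0 := by
        refine (ev_conj _ _ _).trans (A.X_dvd_iff.1 ?_)
        exact (dvd_pow_self A.X hm).mul_right c
      simp only [Polynomial.map_prod, Polynomial.map_sub, map_X, map_C, h2, C_0, sub_zero,
        Finset.prod_const, Finset.card_range, coeff_X_pow, if_neg hi.ne] at h1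
      rwa [coeff_map, coeff_map] at h1
    choose! Q' hQ' using hQi
    have hf' : f = O.coord 1 ^ m - O.coord 0 * -∑ i ∈ Finset.range m,
        O.ofLine (ContinuousLinearMap.proj 0) (Q' i) * O.coord 1 ^ i := by
      rw [hf, eval₂_eq_sum_range, hQd, Finset.sum_range_succ, ← hQd, hQm.coeff_natDegree, hQd,
        mul_neg, sub_neg_eq_add, add_comm, Finset.mul_sum, map_one, one_mul]
      congr 1
      refine Finset.sum_congr rfl fun i hi => ?_
      rw [hQ' i (Finset.mem_range.1 hi), map_mul, mul_assoc]
      rfl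
    refine le_antisymm (fun F hF => ?_) ((Ideal.span_singleton_le_iff_mem _).2 hfψ)
    obtain ⟨H, q, hq⟩ := O.exists_division (n := 2) 0 (Nat.pos_of_ne_zero hm)
      (fun _ => -∑ i ∈ Finset.range m,
        O.ofLine (ContinuousLinearMap.proj 0) (Q' i) * O.coord 1 ^ i) F
    have e4 : (Finset.univ : Finset (Fin 2)).erase 0 = {1} := by decide
    rw [e4, Finset.sum_singleton, ← hf'] at hq
    let R : A[X] := ∑ α : Fin 2 → Fin m,
      C (H α * A.X ^ (α 0 : ℕ)) * Polynomial.X ^ (α 1 : ℕ)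
    have hR : R.eval₂ (O.ofLine (ContinuousLinearMap.proj 0) : A →ₐ[ℂ] O 2).toRingHom
        (O.coord 1) = ∑ α : Fin 2 → Fin m, O.ofLine (ContinuousLinearMap.proj 0) (H α) *
          ∏ i, O.coord i ^ (α i : ℕ) := by
      rw [eval₂_finsetSum]
      refine Finset.sum_congr rfl fun α _ => ?_
      rw [eval₂_mul, eval₂_C, eval₂_X_pow, Fin.prod_univ_two, map_mul, map_pow, mul_assoc]
      rfl
    rw [← hR] at hq
    have hRψ : (R.map (powSubst m hm).toRingHom).eval (A.X ^ m * c) = 0 := by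
      rw [← h.apply_eval₂]
      have h1 := congrArg ψ hq
      rwa [map_add, map_mul, hfψ, mul_zero, add_zero, RingHom.mem_ker.1 hF, eq_comm] at h1
    classical
    have hR0 : R.map (powSubst m hm).toRingHom = 0 := by
      refine eq_zero_of_natDegree_lt_card_of_eval_eq_zero' _
        ((Finset.range m).image (conj m (A.X ^ m * c))) ?_ ?_
      · intro a ha
        obtain ⟨k, -, rfl⟩ := Finset.mem_image.1 ha
        have h1 := congrArg (rot (zetaRoot m ^ k)).toRingHom hRψ
        rw [map_zero, eval_map, hom_eval₂] at h1
        rw [eval_map, ← h1]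
        congr 1
        exact RingHom.ext fun a => (rot_powSubst hm (zetaRoot_pow_pow hm k) a).symm
      · rw [Finset.card_image_of_injOn h.conj_injOn, Finset.card_range]
        refine (natDegree_map_le).trans_lt ?_
        refine Nat.lt_of_le_pred (Nat.pos_of_ne_zero hm) (natDegree_sum_le_of_forall_le _ _ ?_)
        intro α _
        exact (natDegree_C_mul_X_pow_le _ _).trans (Nat.le_pred_of_lt (α 1).2)
    have hR1 : R = 0 := map_injective _ (powSubst_injective m hm) (by rw [Polynomial.map_zero]; exact hR0)
    rw [hR1, eval₂_zero, zero_add] at hq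
    exact Ideal.mem_span_singleton'.2 ⟨_, hq.symm⟩
  · rw [hf, h'.apply_eval₂]
    have hcomm (a : A) : powSubst m hm (powSubst m' h'.ne_zero a) =
        powSubst m' h'.ne_zero (powSubst m hm a) := by
      rw [powSubst_powSubst, powSubst_powSubst]
      simp only [mul_comm]
    have h1 : powSubst m hm ((Q.map (powSubst m' h'.ne_zero).toRingHom).eval (A.X ^ m' * c')) =
        ((Q.map (powSubst m hm).toRingHom).map (powSubst m' h'.ne_zero).toRingHom).eval
          (powSubst m hm (A.X ^ m' * c')) := by
      refine (congrArg _ (eval_map _ _)).trans ?_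
      refine (hom_eval₂ Q _ (powSubst m hm).toRingHom _).trans ?_
      rw [Polynomial.map_map, eval_map]
      congr 1
      exact RingHom.ext hcomm
    have h2 : A.X ^ (m * (m * m')) = ∏ k ∈ Finset.range m, A.X ^ (m * m') := by
      rw [Finset.prod_const, Finset.card_range, mul_comm m, pow_mul]
    rw [h1, hQ, Polynomial.map_prod, eval_prod, h2, ← Finset.prod_mul_distrib]
    refine Finset.prod_congr rfl fun k _ => ?_
    rw [Polynomial.map_sub, map_X, map_C, eval_sub, eval_X, eval_C, conj_X_pow_mul hm, map_mul,
      map_pow, powSubst_X, mul_sub, ← pow_mul]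
    congr 1
    refine (map_mul (powSubst m' h'.ne_zero) _ _).trans ?_
    rw [map_pow, powSubst_X, ← pow_mul, mul_comm m']

end IsPlaneBranch

theorem dimC_eq_length (V : Type) [AddCommGroup V] [Module ℂ V] : dimC V = Module.length ℂ V :=
  (Module.length_eq_rank ℂ V).symm

theorem le_of_X_pow_dvd {a b : ℕ} {u : A} (hu : A.ev u ≠ 0) (h : A.X ^ a ∣ A.X ^ b * u) :
    a ≤ b :=
  (pow_dvd_pow_iff A.X_ne_zero A.irreducible_X.not_isUnit).1
    ((A.isUnit_iff.2 hu).dvd_mul_right.1 h)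

/-- In `ℂ{t}` the ideal `ker ψ + ker ψ'` becomes `ψ'(f)` times the image of `ψ'`. The finite
colength of that image appears on both sides and cancels, leaving the order of `ψ'(f)`. -/
theorem IsPlaneBranch.intersectionMultiplicity_eq {ψ ψ' : O 2 →ₐ[ℂ] A} {m m' : ℕ} {c c' : A}
    (h : IsPlaneBranch ψ m c) (h' : IsPlaneBranch ψ' m' c')
    (hne : ∀ k, powSubst m h.ne_zero c' ≠ powSubst m' h'.ne_zero (conj m c k)) :
    ∃ d : ℕ, intersectionMultiplicity (RingHom.ker ψ) (RingHom.ker ψ') = d ∧ m * m' ≤ d ∧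
      (d = m * m' ↔ A.ev c ≠ A.ev c') := by
  obtain ⟨f, hf, hval⟩ := h.exists_ker_eq
  have hm := h.ne_zero
  set E := ∏ k ∈ Finset.range m,
    (powSubst m hm c' - powSubst m' h'.ne_zero (conj m c k)) with hE
  have hE0 : E ≠ 0 := Finset.prod_ne_zero_iff.2 fun k _ => sub_ne_zero.2 (hne k)
  have hpow := hval h'
  rw [← hE] at hpow
  have hf0 : ψ' f ≠ 0 := by
    intro h0
    rw [h0, map_zero, eq_comm, mul_eq_zero] at hpow
    exact hpow.elim (A.X_pow_ne_zero _) hE0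
  have hlen : intersectionMultiplicity (RingHom.ker ψ) (RingHom.ker ψ') =
      Module.length ℂ (A ⧸ LinearMap.range (A.mulLin (ψ' f))) := by
    have h1 := length_quotient_map ψ'.toLinearMap
      ((RingHom.ker ψ ⊔ RingHom.ker ψ').restrictScalars ℂ)
      (fun x hx => (le_sup_right : RingHom.ker ψ' ≤ RingHom.ker ψ ⊔ RingHom.ker ψ') hx)
    have h2 : ((RingHom.ker ψ ⊔ RingHom.ker ψ').restrictScalars ℂ).map ψ'.toLinearMap =
        (LinearMap.range ψ'.toLinearMap).map (A.mulLin (ψ' f)) := by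
      apply le_antisymm
      · rintro _ ⟨x, hx, rfl⟩
        obtain ⟨y, hy, z, hz, rfl⟩ := Submodule.mem_sup.1 (show x ∈ RingHom.ker ψ ⊔ RingHom.ker ψ' from hx)
        rw [hf] at hy
        obtain ⟨w, rfl⟩ := Ideal.mem_span_singleton'.1 hy
        refine ⟨ψ' w, ⟨w, rfl⟩, ?_⟩
        change ψ' f * ψ' w = ψ' (w * f + z)
        rw [map_add, RingHom.mem_ker.1 hz, add_zero, map_mul, mul_comm]
      · rintro _ ⟨_, ⟨w, rfl⟩, rfl⟩
        refine ⟨f * w, ?_, map_mul ψ' f w⟩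
        refine (le_sup_left : RingHom.ker ψ ≤ RingHom.ker ψ ⊔ RingHom.ker ψ') ?_
        rw [hf]
        exact Ideal.mul_mem_right _ _ (Ideal.mem_span_singleton_self f)
    rw [h2, A.length_quotient_map_mulLin hf0, add_comm] at h1
    rw [intersectionMultiplicity, dimC_eq_length]
    exact ENat.add_left_injective_of_ne_top h'.length_quotient_range_ne_top h1.symm
  obtain ⟨d, u, hu, hd⟩ := A.exists_eq_X_pow_mul hf0
  rw [hd, A.length_quotient_range hu] at hlen
  rw [hd, map_mul, map_pow, powSubst_X, ← pow_mul] at hpow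
  have hu' : A.ev (powSubst m hm u) ≠ 0 := by rwa [ev_powSubst]
  have hle : m * m' ≤ d :=
    Nat.le_of_mul_le_mul_left (le_of_X_pow_dvd hu' (hpow ▸ dvd_mul_right _ _))
      (Nat.pos_of_ne_zero hm)
  have hev (k : ℕ) : A.ev (powSubst m hm c' - powSubst m' h'.ne_zero (conj m c k)) =
      A.ev c' - A.ev c := by
    rw [map_sub, ev_powSubst, ev_powSubst, ev_conj]
  refine ⟨d, hlen, hle, fun hdm hcc => ?_, fun hcc => le_antisymm ?_ hle⟩
  -- If the values at `0` agree, each of the `m` factors vanishes there, so `m d ≥ m · m m' + m`.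
  · have h1 : A.X ^ m ∣ E := by
      conv_lhs => rw [← Finset.card_range m, ← Finset.prod_const]
      refine Finset.prod_dvd_prod_of_dvd _ _ fun k _ => ?_
      rw [A.X_dvd_iff, hev, hcc, sub_self]
    have h2 : A.X ^ (m * (m * m') + m) ∣ A.X ^ (m * d) * powSubst m hm u := by
      rw [hpow, pow_add]
      exact mul_dvd_mul_left _ h1
    have h3 := le_of_X_pow_dvd hu' h2
    rw [hdm] at h3
    omega
  · have h1 : A.ev E ≠ 0 := by
      rw [hE, map_prod, Finset.prod_ne_zero_iff]
      intro k _
      rw [hev]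
      exact sub_ne_zero.2 (Ne.symm hcc)
    exact Nat.le_of_mul_le_mul_left (le_of_X_pow_dvd h1 (hpow ▸ dvd_mul_right _ _))
      (Nat.pos_of_ne_zero hm)

end planeBranch

end

section

/-! ### Parametrizations and multiplicities -/

section param

variable {n : ℕ} {P : Ideal (O n)}

/-- The germ with ideal `P` is parametrized by `φ(t) = tᵐ v(t)`, `v(0) ≠ 0`. -/
structure IsTangentParam (P : Ideal (O n)) (m : ℕ) (φ v : ℂ → Fin n → ℂ) : Prop
    extends IsParam P φ where
  ne_zero : m ≠ 0
  analyticAt_dir : AnalyticAt ℂ v 0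
  dir_ne_zero : v 0 ≠ 0
  eventually_eq : ∀ᶠ t in 𝓝 0, φ t = t ^ m • v t

theorem IsParam.exists_isTangentParam {φ : ℂ → Fin n → ℂ} (h : IsParam P φ) :
    ∃ m v, IsTangentParam P m φ v := by
  have hne : analyticOrderAt φ 0 ≠ ⊤ := by
    intro htop
    rw [analyticOrderAt_eq_top] at htop
    obtain ⟨U, hU, hinj⟩ := h.injOn
    have h1 : ∀ᶠ t in 𝓝[≠] (0 : ℂ), φ t = 0 ∧ t ∈ U :=
      (htop.and (eventually_mem_set.2 hU)).filter_mono nhdsWithin_le_nhds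
    obtain ⟨t, ⟨ht, htU⟩, ht0⟩ := (h1.and self_mem_nhdsWithin).exists
    exact ht0 (hinj htU (mem_of_mem_nhds hU) (ht.trans h.map_zero.symm))
  obtain ⟨v, hv, hv0, heq⟩ := h.analyticAt.analyticOrderAt_ne_top.1 hne
  refine ⟨analyticOrderNatAt φ 0, v, h, fun h0 => hv0 ?_, hv, hv0, ?_⟩
  · have h1 : φ 0 = ((0 : ℂ) - 0) ^ analyticOrderNatAt φ 0 • v 0 := heq.self_of_nhds
    rwa [h0, pow_zero, one_smul, h.map_zero, eq_comm] at h1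
  · filter_upwards [heq] with t ht
    rw [ht, sub_zero]

theorem exists_pow_eq {u : ℂ → ℂ} (hu : AnalyticAt ℂ u 0) (h0 : u 0 ≠ 0) {m : ℕ} (hm : m ≠ 0) :
    ∃ w : ℂ → ℂ, AnalyticAt ℂ w 0 ∧ w 0 ≠ 0 ∧ ∀ᶠ t in 𝓝 0, w t ^ m = u t := by
  obtain ⟨r, hr⟩ := IsAlgClosed.exists_pow_nat_eq (u 0) (Nat.pos_of_ne_zero hm)
  have hr0 : r ≠ 0 := by
    rintro rfl
    exact h0 (by rw [← hr, zero_pow hm])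
  have hq : AnalyticAt ℂ (fun t => u t / u 0) 0 := hu.div analyticAt_const h0
  have hs : (fun t => u t / u 0) 0 ∈ Complex.slitPlane := by
    simp only [div_self h0, Complex.one_mem_slitPlane]
  refine ⟨fun t => r * Complex.exp (Complex.log (u t / u 0) / m), ?_, ?_, ?_⟩
  · exact analyticAt_const.mul (((hq.clog hs).div analyticAt_const (Nat.cast_ne_zero.2 hm)).cexp)
  · exact mul_ne_zero hr0 (Complex.exp_ne_zero _)
  · filter_upwards [hu.continuousAt.eventually_ne h0] with t ht
    rw [mul_pow, hr, ← Complex.exp_nat_mul, mul_div_cancel₀ _ (Nat.cast_ne_zero.2 hm),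
      Complex.exp_log (div_ne_zero ht h0), mul_div_cancel₀ _ h0]

theorem exists_localInverse {σ : ℂ → ℂ} (hσ : AnalyticAt ℂ σ 0) (h0 : σ 0 = 0)
    (hd : deriv σ 0 ≠ 0) : ∃ τ : ℂ → ℂ, AnalyticAt ℂ τ 0 ∧ τ 0 = 0 ∧
      (∀ᶠ t in 𝓝 0, τ (σ t) = t) ∧ ∀ᶠ s in 𝓝 0, σ (τ s) = s := by
  have h1 := hσ.analyticAt_localInverse hd
  have h2 := hσ.hasStrictDerivAt.eventually_left_inverse hd
  have h3 := hσ.hasStrictDerivAt.eventually_right_inverse hd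
  have h4 := h2.self_of_nhds
  rw [h0] at h1 h3 h4
  exact ⟨_, h1, h4, h2, h3⟩

/-- Any linear form that does not vanish on the tangent can be taken as `tᵐ`. -/
theorem IsTangentParam.exists_reparam {m : ℕ} {φ v : ℂ → Fin n → ℂ} (h : IsTangentParam P m φ v)
    (l : (Fin n → ℂ) →L[ℂ] ℂ) (hl : l (v 0) ≠ 0) :
    ∃ φ' v', IsTangentParam P m φ' v' ∧ (∀ᶠ t in 𝓝 0, l (v' t) = 1) ∧
      v' 0 = (l (v 0))⁻¹ • v 0 := by
  have hlv : AnalyticAt ℂ (fun t => l (v t)) 0 := (l.analyticAt _).comp h.analyticAt_dir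
  obtain ⟨w, hw, hw0, hwm⟩ := exists_pow_eq hlv hl h.ne_zero
  -- The new parameter: `(t w)ᵐ = tᵐ l(v) = l(φ)`.
  have hσ : AnalyticAt ℂ (fun t => t * w t) 0 := analyticAt_id.mul hw
  have hd : deriv (fun t => t * w t) 0 ≠ 0 := by
    have h1 := (hasDerivAt_id (0 : ℂ)).mul hw.differentiableAt.hasDerivAt
    rw [id, one_mul, zero_mul, add_zero] at h1
    exact h1.deriv.symm ▸ hw0
  obtain ⟨τ, hτ, hτ0, hl', hr'⟩ := exists_localInverse hσ (zero_mul _) hd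
  have hτt : Tendsto τ (𝓝 0) (𝓝 0) := by simpa only [hτ0] using hτ.continuousAt.tendsto
  have hφτ : AnalyticAt ℂ (fun t => φ (τ t)) 0 := AnalyticAt.comp (g := φ) (by rw [hτ0]; exact h.analyticAt) hτ
  have hvτ : AnalyticAt ℂ (fun t => v (τ t)) 0 := AnalyticAt.comp (g := v) (by rw [hτ0]; exact h.analyticAt_dir) hτ
  have hlvτ : AnalyticAt ℂ (fun t => l (v (τ t))) 0 := (l.analyticAt _).comp hvτ
  have hlvτ0 : l (v (τ 0)) ≠ 0 := by rwa [hτ0]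
  refine ⟨fun t => φ (τ t), fun t => (l (v (τ t)))⁻¹ • v (τ t),
    ⟨⟨hφτ, by rw [hτ0, h.map_zero], ?_, ?_⟩, h.ne_zero, (hlvτ.inv hlvτ0).smul hvτ,
      smul_ne_zero (inv_ne_zero hlvτ0) (by rw [hτ0]; exact h.dir_ne_zero), ?_⟩, ?_, by simp only [hτ0]⟩
  · obtain ⟨U, hU, hinj⟩ := h.injOn
    refine ⟨_, hr'.and (hτt.eventually hU), fun s hs t ht hst => ?_⟩
    have h1 := hinj hs.2 ht.2 hst
    rw [← hs.1, ← ht.1, h1]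
  · have hcomp (f : O n) : O.along _ hφτ (by rw [hτ0, h.map_zero]) f =
        A.subst τ hτ hτ0 (O.along φ h.analyticAt h.map_zero f) := by
      obtain ⟨f, hf, rfl⟩ := O.exists_mk f
      rfl
    have hinj : Function.Injective (A.subst τ hτ hτ0) := by
      refine Function.LeftInverse.injective (g := A.subst _ hσ (zero_mul _)) fun a => ?_
      obtain ⟨f, hf, rfl⟩ := A.exists_mk a
      rw [A.subst_mk, A.subst_mk, A.mk_eq_mk]
      filter_upwards [hl'] with t ht
      rw [ht]
    refine Eq.trans ?_ h.ker_eq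
    ext f
    rw [RingHom.mem_ker, RingHom.mem_ker, hcomp, map_eq_zero_iff _ hinj]
  · filter_upwards [hτt.eventually h.eventually_eq, hτt.eventually hwm, hr',
      hlvτ.continuousAt.eventually_ne hlvτ0] with s h1 h2 h3 h4
    have h5 : s ^ m = τ s ^ m * l (v (τ s)) := by rw [← h2, ← mul_pow, h3]
    rw [h1, h5, smul_smul, mul_assoc, mul_inv_cancel₀ h4, mul_one]
  · filter_upwards [hlvτ.continuousAt.eventually_ne hlvτ0] with s h4
    rw [map_smul, smul_eq_mul, inv_mul_cancel₀ h4]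

theorem IsTangentParam.along_lin {m : ℕ} {φ v : ℂ → Fin n → ℂ} (h : IsTangentParam P m φ v)
    (l : (Fin n → ℂ) →L[ℂ] ℂ) : O.along φ h.analyticAt h.map_zero (O.lin l) =
      A.X ^ m * A.mk (fun t => l (v t)) ((l.analyticAt _).comp h.analyticAt_dir) := by
  rw [O.lin, O.along_mk, A.X, A.mk_pow, A.mk_mul, A.mk_eq_mk]
  filter_upwards [h.eventually_eq] with t ht
  rw [ht, map_smul, smul_eq_mul]

theorem dimC_quotient_pow (P : Ideal (O n)) (k : ℕ) :
    dimC ((O n ⧸ P) ⧸ (maxIdeal n).map (Ideal.Quotient.mk P) ^ k) =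
      Module.length ℂ (O n ⧸ (P ⊔ maxIdeal n ^ k)) := by
  rw [dimC_eq_length, ← Ideal.map_pow]
  exact (DoubleQuot.quotQuotEquivQuotSupₐ ℂ P (maxIdeal n ^ k)).toLinearEquiv.length_eq

theorem tendsto_div_of_le_of_le {u : ℕ → ℕ∞} {m : ℕ} {δ : ℕ∞} (hδ : δ ≠ ⊤)
    (h1 : ∀ k : ℕ, ((m * k : ℕ) : ℕ∞) ≤ u k + δ) (h2 : ∀ k : ℕ, u k ≤ (m * k : ℕ)) :
    Tendsto (fun k : ℕ => (u k : ℝ≥0∞) / k) atTop (𝓝 (m : ℝ≥0∞)) := by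
  lift δ to ℕ using hδ
  have h3 : Tendsto (fun k : ℕ => (m : ℝ≥0∞) - (δ : ℝ≥0∞) / k) atTop (𝓝 (m : ℝ≥0∞)) := by
    have h4 : Tendsto (fun k : ℕ => (δ : ℝ≥0∞) / k) atTop (𝓝 0) := by
      have h5 := ENNReal.Tendsto.const_div (a := (δ : ℝ≥0∞)) ENNReal.tendsto_nat_nhds_top
        (Or.inr (ENNReal.natCast_ne_top δ))
      rwa [ENNReal.div_top] at h5
    have h6 := ENNReal.Tendsto.sub (tendsto_const_nhds (x := (m : ℝ≥0∞))) h4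
      (Or.inl (ENNReal.natCast_ne_top m))
    rwa [tsub_zero] at h6
  refine tendsto_of_tendsto_of_tendsto_of_le_of_le' h3 tendsto_const_nhds ?_ ?_
  · filter_upwards [eventually_ne_atTop 0] with k hk
    rw [tsub_le_iff_right, ENNReal.div_add_div_same, ENNReal.le_div_iff_mul_le
      (Or.inl (Nat.cast_ne_zero.2 hk)) (Or.inl (ENNReal.natCast_ne_top k))]
    exact_mod_cast ENat.toENNReal_le.2 (h1 k)
  · filter_upwards [eventually_ne_atTop 0] with k hk
    rw [ENNReal.div_le_iff_le_mul
      (Or.inl (Nat.cast_ne_zero.2 hk)) (Or.inl (ENNReal.natCast_ne_top k))]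
    exact_mod_cast ENat.toENNReal_le.2 (h2 k)

/-- With `δ` the colength of the image of `ψ`, the image of `P + 𝔪ᵏ` lies between `Xᵐᵏ uᵏ ψ(O n)`
and `Xᵐᵏ ℂ{t}`. Hence the length of `O n / (P + 𝔪ᵏ)` lies between `mk - δ` and `mk`. -/
theorem IsTangentParam.multiplicity_eq {m : ℕ} {φ v : ℂ → Fin n → ℂ} (h : IsTangentParam P m φ v)
    (hδ : Module.length ℂ
      (A ⧸ LinearMap.range (O.along φ h.analyticAt h.map_zero).toLinearMap) ≠ ⊤) :
    multiplicity P = m := by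
  set ψ := O.along φ h.analyticAt h.map_zero with hψ
  obtain ⟨i, hi⟩ : ∃ i, v 0 i ≠ 0 := by
    by_contra! hall
    exact h.dir_ne_zero (funext hall)
  have hi' := h.along_lin (ContinuousLinearMap.proj i)
  rw [← hψ] at hi'
  set u := A.mk (fun t => (ContinuousLinearMap.proj i : (Fin n → ℂ) →L[ℂ] ℂ) (v t))
    (((ContinuousLinearMap.proj i : (Fin n → ℂ) →L[ℂ] ℂ).analyticAt _).comp h.analyticAt_dir)
  have hu : A.ev u ≠ 0 := hi
  have hJ (k : ℕ) : Module.length ℂ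
      (A ⧸ ((P ⊔ maxIdeal n ^ k).restrictScalars ℂ).map ψ.toLinearMap) =
      Module.length ℂ (O n ⧸ (P ⊔ maxIdeal n ^ k)) +
        Module.length ℂ (A ⧸ LinearMap.range ψ.toLinearMap) := by
    refine length_quotient_map ψ.toLinearMap ((P ⊔ maxIdeal n ^ k).restrictScalars ℂ) fun x hx => ?_
    refine (le_sup_left : P ≤ P ⊔ maxIdeal n ^ k) ?_
    rw [← h.ker_eq]
    exact hx
  have hmax : maxIdeal n ≤ (Ideal.span {A.X ^ m}).comap ψ := by
    rw [O.maxIdeal_eq_span, Ideal.span_le]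
    rintro _ ⟨j, rfl⟩
    exact Ideal.mem_span_singleton.2 (Dvd.intro _ (h.along_lin (ContinuousLinearMap.proj j)).symm)
  have hlow (k : ℕ) : ((P ⊔ maxIdeal n ^ k).restrictScalars ℂ).map ψ.toLinearMap ≤
      LinearMap.range (A.mulLin (A.X ^ (m * k) * 1)) := by
    have h1 : P ⊔ maxIdeal n ^ k ≤ (Ideal.span {A.X ^ (m * k)}).comap ψ := by
      refine sup_le ?_ ?_
      · rw [← h.ker_eq]
        exact Ideal.ker_le_comap _
      · rw [pow_mul, ← Ideal.span_singleton_pow]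
        exact (Ideal.pow_right_mono hmax k).trans (Ideal.le_comap_pow ψ k)
    rintro _ ⟨x, hx, rfl⟩
    obtain ⟨y, hy⟩ := Ideal.mem_span_singleton.1 (h1 hx)
    exact ⟨y, by rw [mul_one]; exact hy.symm⟩
  have hupp (k : ℕ) : (LinearMap.range ψ.toLinearMap).map (A.mulLin (A.X ^ (m * k) * u ^ k)) ≤
      ((P ⊔ maxIdeal n ^ k).restrictScalars ℂ).map ψ.toLinearMap := by
    rintro _ ⟨_, ⟨f, rfl⟩, rfl⟩
    refine ⟨O.coord i ^ k * f, ?_, ?_⟩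
    · refine (le_sup_right : maxIdeal n ^ k ≤ P ⊔ maxIdeal n ^ k) ?_
      exact Ideal.mul_mem_right _ _ (Ideal.pow_mem_pow (O.mem_maxIdeal.2 (O.ev_coord i)) k)
    · change ψ (O.coord i ^ k * f) = A.X ^ (m * k) * u ^ k * ψ f
      rw [map_mul, map_pow, O.coord, hi', mul_pow, pow_mul]
  have hev1 : A.ev 1 ≠ 0 := by simp
  have huk (k : ℕ) : A.ev (u ^ k) ≠ 0 := by rw [map_pow]; exact pow_ne_zero k hu
  have key1 (k : ℕ) := length_quotient_le (hlow k)
  have key2 (k : ℕ) := length_quotient_le (hupp k)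
  simp only [hJ, A.length_quotient_range hev1] at key1
  simp only [hJ, A.length_quotient_map_mulLin (mul_ne_zero (A.X_pow_ne_zero _)
    ((A.isUnit_iff.2 (huk _)).ne_zero)), A.length_quotient_range (huk _)] at key2
  have key3 := tendsto_div_of_le_of_le hδ key1 fun k => by
    have h1 := key2 k
    rw [add_comm] at h1
    exact (ENat.add_le_add_iff_left hδ).1 h1
  rw [multiplicity, hilbertSamuelMultiplicity]
  simp only [dimC_quotient_pow, Nat.factorial_one, Nat.cast_one, one_mul, pow_one]
  exact key3.limsup_eq

end param

end

section

/-! ### Representatives, tangent cones and the cone `C₅` -/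

section cones

variable {n : ℕ} {I P Q : Ideal (O n)}

theorem IsModel.eventually_eq_zero {k : ℕ} {U : Set (Fin n → ℂ)} {f : Fin k → (Fin n → ℂ) → ℂ}
    (h : IsModel I U f) {F : (Fin n → ℂ) → ℂ} {hF : AnalyticAt ℂ F 0} (hFI : O.mk F hF ∈ I) :
    ∀ᶠ x in 𝓝 0, (∀ i, f i x = 0) → F x = 0 := by
  have key : ∀ u ∈ idealAt f 0, ∀ (G : (Fin n → ℂ) → ℂ) (hG : AnalyticAt ℂ G 0), u = O.mk G hG →
      ∀ᶠ x in 𝓝 0, (∀ i, f i x = 0) → G x = 0 := by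
    intro u hu
    refine Submodule.span_induction (p := fun u _ => ∀ (G : (Fin n → ℂ) → ℂ)
      (hG : AnalyticAt ℂ G 0), u = O.mk G hG → ∀ᶠ x in 𝓝 0, (∀ i, f i x = 0) → G x = 0)
      ?_ ?_ ?_ ?_ hu
    · rintro u ⟨i, hi⟩ G hG rfl
      have h1 : G =ᶠ[𝓝 0] f i := Germ.coe_eq.1 hi
      filter_upwards [h1] with x hx hf
      rw [hx, hf i]
    · intro G hG h0
      filter_upwards [O.mk_eq_zero.1 h0.symm] with x hx _
      exact hx
    · intro u v _ _ hu hv G hG huv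
      obtain ⟨a, ha, rfl⟩ := O.exists_mk u
      obtain ⟨b, hb, rfl⟩ := O.exists_mk v
      rw [O.mk_add, O.mk_eq_mk] at huv
      filter_upwards [huv, hu a ha rfl, hv b hb rfl] with x h1 h2 h3 hx
      have h4 : a x + b x = G x := h1
      rw [← h4, h2 hx, h3 hx, add_zero]
    · intro r u _ hu G hG hru
      obtain ⟨a, ha, rfl⟩ := O.exists_mk u
      obtain ⟨b, hb, rfl⟩ := O.exists_mk r
      rw [smul_eq_mul, O.mk_mul, O.mk_eq_mk] at hru
      filter_upwards [hru, hu a ha rfl] with x h1 h2 hx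
      have h4 : b x * a x = G x := h1
      rw [← h4, h2 hx, mul_zero]
  exact key _ (h.span_eq.symm ▸ hFI) F hF rfl

theorem exists_isRepresentative (hI : I.FG) : ∃ W, IsRepresentative I W := by
  obtain ⟨k, u, hu⟩ := Submodule.fg_iff_exists_fin_generating_family.1 hI
  choose f hf huf using fun i => O.exists_mk (u i)
  have hU : ∀ᶠ x in 𝓝 (0 : Fin n → ℂ), ∀ i, AnalyticAt ℂ (f i) x :=
    eventually_all.2 fun i => (hf i).eventually_analyticAt
  obtain ⟨U, hUf, hUo, hU0⟩ := eventually_nhds_iff.1 hU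
  refine ⟨_, k, U, f, ⟨hUo, hU0, fun i x hx => hUf x hx i, ?_⟩, rfl⟩
  rw [← hu, idealAt]
  congr 1
  ext v
  constructor
  · rintro ⟨i, hi⟩
    exact ⟨i, (huf i).trans (Subtype.ext hi.symm)⟩
  · rintro ⟨i, rfl⟩
    exact ⟨i, by rw [huf i]; rfl⟩

theorem IsParam.eventually_mem {W : Set (Fin n → ℂ)} (hW : IsRepresentative I W) (hIP : I ≤ P)
    {φ : ℂ → Fin n → ℂ} (h : IsParam P φ) : ∀ᶠ t in 𝓝 0, φ t ∈ W := by
  obtain ⟨k, U, f, hm, rfl⟩ := hW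
  have hφ : Tendsto φ (𝓝 0) (𝓝 0) := by
    simpa only [h.map_zero] using h.analyticAt.continuousAt.tendsto
  refine (hφ.eventually (hm.isOpen.mem_nhds hm.zero_mem)).and (eventually_all.2 fun i => ?_)
  have hfi := hm.analytic i 0 hm.zero_mem
  have h1 : O.mk (f i) hfi ∈ P := by
    apply hIP
    rw [← hm.span_eq]
    exact Ideal.subset_span ⟨i, rfl⟩
  rw [← h.ker_eq, RingHom.mem_ker, O.along_mk, A.mk_eq_zero] at h1
  exact h1

theorem exists_seq_of_eventually {p : ℂ → Prop} (hp : ∀ᶠ t in 𝓝[≠] (0 : ℂ), p t) :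
    ∃ t : ℕ → ℂ, (∀ k, p (t k)) ∧ Tendsto t atTop (𝓝[≠] 0) := by
  obtain ⟨t, ht⟩ := exists_seq_tendsto (𝓝[≠] (0 : ℂ))
  obtain ⟨K, hK⟩ := eventually_atTop.1 (ht.eventually hp)
  exact ⟨fun k => t (k + K), fun k => hK _ (Nat.le_add_left K k),
    ht.comp (tendsto_add_atTop_nat K)⟩

theorem tendsto_const_mul_pow (α : ℂ) {m : ℕ} (hm : m ≠ 0) :
    Tendsto (fun t : ℂ => α * t ^ m) (𝓝[≠] 0) (𝓝 0) := by
  have h : Continuous fun t : ℂ => α * t ^ m := by fun_prop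
  have h1 := h.tendsto 0
  rw [zero_pow hm, mul_zero] at h1
  exact h1.mono_left nhdsWithin_le_nhds

/-- The power `tˡ` synchronizes two branches: with `l` the multiplicity of the other branch, both
are scaled by the same `t^(m l)`. -/
theorem IsTangentParam.tendsto_smul {m : ℕ} {φ v : ℂ → Fin n → ℂ} (h : IsTangentParam P m φ v)
    (α : ℂ) {l : ℕ} (hl : l ≠ 0) :
    Tendsto (fun t : ℂ => (t ^ (m * l))⁻¹ • φ (α * t ^ l)) (𝓝[≠] 0) (𝓝 (α ^ m • v 0)) := by
  have h1 := tendsto_const_mul_pow α hl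
  have h2 : Tendsto (fun t : ℂ => α ^ m • v (α * t ^ l)) (𝓝[≠] 0) (𝓝 (α ^ m • v 0)) :=
    (h.analyticAt_dir.continuousAt.tendsto.comp h1).const_smul _
  refine h2.congr' ?_
  filter_upwards [h1.eventually h.eventually_eq, self_mem_nhdsWithin] with t ht ht0
  have h3 : t ^ (m * l) ≠ 0 := pow_ne_zero _ ht0
  rw [ht, smul_smul, mul_pow, ← pow_mul, mul_comm l, mul_comm (α ^ m), ← mul_assoc,
    inv_mul_cancel₀ h3, one_mul]

theorem IsTangentParam.tendsto_zero {m : ℕ} {φ v : ℂ → Fin n → ℂ} (h : IsTangentParam P m φ v) :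
    Tendsto φ (𝓝 0) (𝓝 0) := by
  simpa only [h.map_zero] using h.analyticAt.continuousAt.tendsto

theorem IsTangentParam.sub_mem_coneC5 {W : Set (Fin n → ℂ)} (hW : IsRepresentative I W)
    (hP : I ≤ P) (hQ : I ≤ Q) {m m' : ℕ} {φ v φ' v' : ℂ → Fin n → ℂ}
    (h : IsTangentParam P m φ v) (h' : IsTangentParam Q m' φ' v') (α β : ℂ) :
    α ^ m • v 0 - β ^ m' • v' 0 ∈ coneC5 I := by
  have h1 := tendsto_const_mul_pow α h'.ne_zero
  have h2 := tendsto_const_mul_pow β h.ne_zero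
  obtain ⟨t, htW, ht⟩ := exists_seq_of_eventually
    ((h1.eventually (h.eventually_mem hW hP)).and (h2.eventually (h'.eventually_mem hW hQ)))
  refine ⟨W, hW, fun k => φ (α * t k ^ m'), fun k => φ' (β * t k ^ m),
    fun k => (t k ^ (m * m'))⁻¹, fun k => (htW k).1, fun k => (htW k).2,
    h.tendsto_zero.comp (h1.comp ht), h'.tendsto_zero.comp (h2.comp ht), ?_⟩
  have h3 := (h.tendsto_smul α h'.ne_zero).sub (h'.tendsto_smul β h.ne_zero)
  rw [mul_comm m'] at h3
  simp only [← smul_sub] at h3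
  exact h3.comp ht

/-- Any scalar is an `m`-th power `αᵐ`, reached by the parameter `αt`; finite generation provides a
representative. -/
theorem IsTangentParam.smul_mem_tangentCone {m : ℕ} {φ v : ℂ → Fin n → ℂ}
    (h : IsTangentParam P m φ v) (hP : P.FG) (a : ℂ) : a • v 0 ∈ tangentCone P := by
  obtain ⟨W, hW⟩ := exists_isRepresentative hP
  obtain ⟨α, rfl⟩ := IsAlgClosed.exists_pow_nat_eq a (Nat.pos_of_ne_zero h.ne_zero)
  have h1 := tendsto_const_mul_pow α one_ne_zero
  obtain ⟨t, htW, ht⟩ := exists_seq_of_eventually (h1.eventually (h.eventually_mem hW le_rfl))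
  exact ⟨W, hW, fun k => φ (α * t k ^ 1), fun k => (t k ^ (m * 1))⁻¹, htW,
    h.tendsto_zero.comp (h1.comp ht), (h.tendsto_smul α one_ne_zero).comp ht⟩

open Polynomial in
/-- The equation of a plane projection of the germ, in homogeneous form. -/
theorem IsTangentParam.exists_equation {m : ℕ} {φ v : ℂ → Fin n → ℂ} (h : IsTangentParam P m φ v)
    {l : (Fin n → ℂ) →L[ℂ] ℂ} (hl : ∀ᶠ t in 𝓝 0, l (v t) = 1) (l' : (Fin n → ℂ) →L[ℂ] ℂ) :
    ∃ (q : ℕ → ℂ → ℂ) (_ : ∀ i, AnalyticAt ℂ (q i) 0)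
      (hF : AnalyticAt ℂ (fun x => ∑ i ∈ Finset.range (m + 1),
        q i (l x) * l x ^ (m - i) * l' x ^ i) 0),
      O.mk _ hF ∈ P ∧ ∀ a b : ℂ, ∑ i ∈ Finset.range (m + 1), q i 0 * a ^ (m - i) * b ^ i =
        (b - l' (v 0) * a) ^ m := by
  have hc : AnalyticAt ℂ (fun t => l' (v t)) 0 := (l'.analyticAt _).comp h.analyticAt_dir
  set c := A.mk _ hc with hcdef
  -- The slope `c = l'(v)` is a root of its norm polynomial; homogenizing in `l`, `l'` gives the
  -- equation. All conjugates of `c` share its value at `0`, hence the `m`-th power at the origin.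
  obtain ⟨R, hRm, hRd, hR⟩ := exists_normPoly_spec h.ne_zero c
  choose q hq hRq using fun i => A.exists_mk (R.coeff i)
  refine ⟨q, hq, ?_, ?_, ?_⟩
  · refine Finset.analyticAt_fun_sum _ fun i _ => ?_
    exact ((A.comp_analyticAt (hq i) (l.analyticAt 0) (map_zero l)).mul ((l.analyticAt 0).pow _)).mul
      ((l'.analyticAt 0).pow _)
  · have h1 : ∑ i ∈ Finset.range (m + 1), powSubst m h.ne_zero (R.coeff i) * c ^ i = 0 := by
      have h2 := congrArg (Polynomial.eval c) hR
      rw [eval_prod, Finset.prod_eq_zero (Finset.mem_range.2 (Nat.pos_of_ne_zero h.ne_zero))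
        (by simp [conj_zero]), eval_map, eval₂_eq_sum_range, hRd] at h2
      exact h2
    have h3 : ∀ᶠ t in 𝓝 0, ∑ i ∈ Finset.range (m + 1), q i (t ^ m) * l' (v t) ^ i = 0 := by
      simp only [hRq, powSubst_mk, hcdef, A.mk_pow, A.mk_mul] at h1
      rw [A.mk_sum, A.mk_eq_zero] at h1
      exact h1
    rw [← h.ker_eq, RingHom.mem_ker, O.along_mk, A.mk_eq_zero]
    filter_upwards [h3, hl, h.eventually_eq] with t h3 hl h4
    simp only [h4, map_smul, hl, smul_eq_mul, mul_one]
    rw [← mul_zero ((t ^ m) ^ m), ← h3, Finset.mul_sum]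
    refine Finset.sum_congr rfl fun i hi => ?_
    have h5 : (t ^ m) ^ m = (t ^ m) ^ (m - i) * (t ^ m) ^ i := by
      rw [← pow_add, Nat.sub_add_cancel (Nat.lt_succ_iff.1 (Finset.mem_range.1 hi))]
    rw [h5, mul_pow]
    ring
  · intro a b
    have h1 (i : ℕ) : q i 0 = ((Polynomial.X - C (l' (v 0))) ^ m).coeff i := by
      have h2 := congrArg (fun p => (p.map A.ev.toRingHom).coeff i) hR
      have h3 (k : ℕ) : A.ev.toRingHom (conj m c k) = l' (v 0) := ev_conj _ _ _
      simp only [Polynomial.map_prod, Polynomial.map_sub, map_X, map_C, h3, Finset.prod_const,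
        Finset.card_range, coeff_map] at h2
      rw [← h2, hRq]
      exact ((ev_powSubst m h.ne_zero _).trans A.ev_mk).symm
    rw [sub_eq_add_neg b, add_pow]
    refine Finset.sum_congr rfl fun i _ => ?_
    rw [h1, sub_eq_add_neg, ← C_neg, coeff_X_add_C_pow, ← neg_mul, mul_pow]
    ring

/-- For each coordinate `l'` the equation is homogeneous of degree `m` in `(l, l')` up to the
coefficients `qᵢ(l)`. Multiplied by the `m`-th power of the scalars, it passes to the limit as
`(l'(w) - l'(v 0) l(w))ᵐ = 0`. -/
theorem IsTangentParam.eq_smul_of_mem_tangentCone {m : ℕ} {φ v : ℂ → Fin n → ℂ}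
    (h : IsTangentParam P m φ v) {l : (Fin n → ℂ) →L[ℂ] ℂ} (hl : ∀ᶠ t in 𝓝 0, l (v t) = 1)
    {w : Fin n → ℂ} (hw : w ∈ tangentCone P) : w = l w • v 0 := by
  obtain ⟨W, ⟨k, U, f, hm, rfl⟩, x, c, hxW, hx, hcx⟩ := hw
  funext j
  let l' : (Fin n → ℂ) →L[ℂ] ℂ := ContinuousLinearMap.proj j
  obtain ⟨q, hq, hF, hFP, hlim⟩ := h.exists_equation hl l'
  have h1 := hx.eventually (hm.eventually_eq_zero hFP)
  have hl0 : Tendsto (fun k => l (x k)) atTop (𝓝 0) := by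
    simpa only [map_zero, Function.comp_def] using (l.continuous.tendsto 0).comp hx
  have h2 : Tendsto (fun k => ∑ i ∈ Finset.range (m + 1),
      q i (l (x k)) * l (c k • x k) ^ (m - i) * l' (c k • x k) ^ i) atTop
      (𝓝 (∑ i ∈ Finset.range (m + 1), q i 0 * l w ^ (m - i) * l' w ^ i)) := by
    refine tendsto_finsetSum _ fun i _ => ?_
    exact (((hq i).continuousAt.tendsto.comp hl0).mul
      (((l.continuous.tendsto w).comp hcx).pow _)).mul (((l'.continuous.tendsto w).comp hcx).pow _)
  have h3 : (fun k => ∑ i ∈ Finset.range (m + 1),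
      q i (l (x k)) * l (c k • x k) ^ (m - i) * l' (c k • x k) ^ i) =ᶠ[atTop] fun _ => 0 := by
    filter_upwards [h1] with k hk
    rw [← mul_zero (c k ^ m), ← hk (hxW k).2, Finset.mul_sum]
    refine Finset.sum_congr rfl fun i hi => ?_
    have h5 : c k ^ m = c k ^ (m - i) * c k ^ i := by
      rw [← pow_add, Nat.sub_add_cancel (Nat.lt_succ_iff.1 (Finset.mem_range.1 hi))]
    rw [h5, map_smul, map_smul, smul_eq_mul, smul_eq_mul, mul_pow, mul_pow]
    ring
  have h4 := tendsto_nhds_unique (tendsto_const_nhds.congr' h3.symm) h2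
  rw [hlim, eq_comm] at h4
  have h5 := sub_eq_zero.1 (eq_zero_of_pow_eq_zero h4)
  rw [mul_comm] at h5
  exact h5

/-- Each tangent cone is a single line, and the normalization `l = 1` selects one vector on it. -/
theorem exists_isTangentLine_iff {m m' : ℕ} {φ v φ' v' : ℂ → Fin n → ℂ}
    (h : IsTangentParam P m φ v) (h' : IsTangentParam Q m' φ' v') (hP : P.FG) (hQ : Q.FG)
    {l : (Fin n → ℂ) →L[ℂ] ℂ} (hl : ∀ᶠ t in 𝓝 0, l (v t) = 1) (hl' : ∀ᶠ t in 𝓝 0, l (v' t) = 1) :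
    (∃ L : Submodule ℂ (Fin n → ℂ), IsTangentLine P L ∧ IsTangentLine Q L) ↔ v 0 = v' 0 := by
  constructor
  · rintro ⟨L, ⟨hL, hLP⟩, -, hLQ⟩
    obtain ⟨w, hw, hw0⟩ := L.ne_bot_iff.1 (by rintro rfl; simp at hL)
    have h1 := h.eq_smul_of_mem_tangentCone hl (hLP hw)
    have h2 := h'.eq_smul_of_mem_tangentCone hl' (hLQ hw)
    have h3 : l w ≠ 0 := by
      intro h0
      rw [h0, zero_smul] at h1
      exact hw0 h1
    exact smul_right_injective _ h3 (h1.symm.trans h2)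
  · intro hv
    refine ⟨ℂ ∙ v 0, ⟨finrank_span_singleton h.dir_ne_zero, fun w hw => ?_⟩,
      finrank_span_singleton h.dir_ne_zero, fun w hw => ?_⟩
    · obtain ⟨a, rfl⟩ := Submodule.mem_span_singleton.1 hw
      exact h.smul_mem_tangentCone hP a
    · obtain ⟨a, rfl⟩ := Submodule.mem_span_singleton.1 hw
      rw [hv]
      exact h'.smul_mem_tangentCone hQ a

/-- Otherwise there are pairs of distinct points tending to `0` with equal images; their normalized
secants accumulate at a unit vector of `C₅` killed by `π`. -/
theorem exists_injOn_of_isRepresentative {W : Set (Fin n → ℂ)} (hW : IsRepresentative I W) {p : ℕ}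
    {π : (Fin n → ℂ) →L[ℂ] (Fin p → ℂ)} (hπ : ∀ v ∈ coneC5 I, π v = 0 → v = 0) :
    ∃ N ∈ 𝓝 (0 : Fin n → ℂ), Set.InjOn π (W ∩ N) := by
  by_contra! hcon
  have hex (k : ℕ) : ∃ x y : Fin n → ℂ, x ∈ W ∧ y ∈ W ∧ ‖x‖ < 1 / ((k : ℝ) + 1) ∧
      ‖y‖ < 1 / ((k : ℝ) + 1) ∧ π x = π y ∧ x ≠ y := by
    have h1 := hcon _ (Metric.ball_mem_nhds 0 (Nat.one_div_pos_of_nat (α := ℝ) (n := k)))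
    rw [Set.InjOn] at h1
    push Not at h1
    obtain ⟨x, hx, y, hy, hxy, hne⟩ := h1
    exact ⟨x, y, hx.1, hy.1, mem_ball_zero_iff.1 hx.2, mem_ball_zero_iff.1 hy.2, hxy, hne⟩
  choose x y hxW hyW hx hy hxy hne using hex
  have hx0 : Tendsto x atTop (𝓝 0) :=
    squeeze_zero_norm (fun k => (hx k).le) tendsto_one_div_add_atTop_nhds_zero_nat
  have hy0 : Tendsto y atTop (𝓝 0) :=
    squeeze_zero_norm (fun k => (hy k).le) tendsto_one_div_add_atTop_nhds_zero_nat
  let c (k : ℕ) : ℂ := ((‖x k - y k‖⁻¹ : ℝ) : ℂ)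
  have hc (k : ℕ) : c k • (x k - y k) ∈ Metric.sphere (0 : Fin n → ℂ) 1 := by
    have h1 : ‖x k - y k‖ ≠ 0 := norm_ne_zero_iff.2 (sub_ne_zero.2 (hne k))
    rw [mem_sphere_zero_iff_norm, norm_smul, Complex.norm_real, norm_inv, norm_norm,
      inv_mul_cancel₀ h1]
  obtain ⟨u, hu, s, hs, hlim⟩ := (isCompact_sphere (0 : Fin n → ℂ) 1).tendsto_subseq hc
  have hu1 : u ∈ coneC5 I := ⟨W, hW, x ∘ s, y ∘ s, c ∘ s, fun k => hxW _, fun k => hyW _,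
    hx0.comp hs.tendsto_atTop, hy0.comp hs.tendsto_atTop, hlim⟩
  have hu2 : π u = 0 := by
    refine tendsto_nhds_unique ((π.continuous.tendsto u).comp hlim) (tendsto_const_nhds.congr ?_)
    intro k
    simp [hxy]
  rw [hπ u hu1 hu2, mem_sphere_zero_iff_norm, norm_zero] at hu
  exact zero_ne_one hu

end cones

end

section

/-! ### Generic plane projections -/

section projection

variable {n : ℕ} {I P Q : Ideal (O n)}

theorem along_comp {p : ℕ} (ϖ : (Fin n → ℂ) →L[ℂ] (Fin p → ℂ)) {φ : ℂ → Fin n → ℂ}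
    (hφ : AnalyticAt ℂ φ 0) (h0 : φ 0 = 0) (f : O p) :
    O.along (fun t => ϖ (φ t)) ((ϖ.analyticAt _).comp hφ) (by rw [h0, map_zero]) f =
      O.along φ hφ h0 (pullback ϖ f) := by
  obtain ⟨f, hf, rfl⟩ := O.exists_mk f
  rfl

theorem IsParam.imageIdeal_eq {φ : ℂ → Fin n → ℂ} (h : IsParam P φ)
    (ϖ : (Fin n → ℂ) →L[ℂ] (Fin 2 → ℂ)) :
    imageIdeal ϖ P = RingHom.ker (O.along (fun t => ϖ (φ t)) ((ϖ.analyticAt _).comp h.analyticAt)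
      (by rw [h.map_zero, _root_.map_zero])) := by
  ext f
  rw [RingHom.mem_ker, along_comp ϖ h.analyticAt h.map_zero, imageIdeal, Ideal.mem_comap]
  conv_lhs => rw [← h.ker_eq]
  exact RingHom.mem_ker

theorem intersectionMultiplicity_comap {g g' : (Fin 2 → ℂ) →L[ℂ] (Fin 2 → ℂ)}
    (h : ∀ x, g (g' x) = x) (h' : ∀ x, g' (g x) = x) (J J' : Ideal (O 2)) :
    intersectionMultiplicity (J.comap (pullback g)) (J'.comap (pullback g)) =
      intersectionMultiplicity J J' := by
  have key {g g' : (Fin 2 → ℂ) →L[ℂ] (Fin 2 → ℂ)} (h : ∀ x, g (g' x) = x) (f : O 2) :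
      pullback g' (pullback g f) = f := by
    obtain ⟨f, hf, rfl⟩ := O.exists_mk f
    rw [O.pullback_mk, O.pullback_mk, O.mk_eq_mk]
    exact .of_forall fun x => congrArg f (h x)
  let e : O 2 ≃ₐ[ℂ] O 2 := AlgEquiv.ofRingEquiv
    (f := RingEquiv.ofRingHom (pullback g) (pullback g') (RingHom.ext (key h'))
      (RingHom.ext (key h))) fun _ => rfl
  have he : J ⊔ J' = (J.comap (pullback g) ⊔ J'.comap (pullback g)).map (e : O 2 →+* O 2) := by
    rw [Ideal.map_sup]
    have hs : Function.Surjective (e : O 2 →+* O 2) := e.surjective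
    exact congrArg₂ _ (Ideal.map_comap_of_surjective _ hs J).symm
      (Ideal.map_comap_of_surjective _ hs J').symm
  rw [intersectionMultiplicity, intersectionMultiplicity, dimC_eq_length, dimC_eq_length]
  exact (Ideal.quotientEquivAlg _ _ e he).toLinearEquiv.length_eq

/-- The shear `(x, y) ↦ (x + s y, y)`. -/
noncomputable def shear (s : ℂ) : (Fin 2 → ℂ) →L[ℂ] (Fin 2 → ℂ) :=
  ContinuousLinearMap.pi
    ![ContinuousLinearMap.proj 0 + s • ContinuousLinearMap.proj 1, ContinuousLinearMap.proj 1]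

theorem shear_apply_zero (s : ℂ) (x : Fin 2 → ℂ) : shear s x 0 = x 0 + s * x 1 := rfl

theorem shear_shear (s : ℂ) (x : Fin 2 → ℂ) : shear s (shear (-s) x) = x := by
  funext i
  fin_cases i
  · change x 0 + -s * x 1 + s * x 1 = x 0
    ring
  · rfl

/-- Each vector forbids at most one `s`; when its second coordinate is `0`, the quotient is `0` by
convention and excluding it is harmless. -/
theorem exists_shear {p q : Fin 2 → ℂ} (hp : p ≠ 0) (hq : q ≠ 0) :
    ∃ s, shear s p 0 ≠ 0 ∧ shear s q 0 ≠ 0 := by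
  obtain ⟨s, hs⟩ := Infinite.exists_notMem_finset ({-p 0 / p 1, -q 0 / q 1} : Finset ℂ)
  rw [Finset.mem_insert, Finset.mem_singleton, not_or] at hs
  have key {p : Fin 2 → ℂ} (hp : p ≠ 0) (h : s ≠ -p 0 / p 1) : shear s p 0 ≠ 0 := by
    intro h0
    rw [shear_apply_zero] at h0
    by_cases h1 : p 1 = 0
    · rw [h1, mul_zero, add_zero] at h0
      refine hp (funext fun i => ?_)
      fin_cases i
      · exact h0
      · exact h1
    · exact h (by rw [eq_div_iff h1]; linear_combination h0)
  exact ⟨s, key hp hs.1, key hq hs.2⟩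

/-- A conjugate equal to `c` would give `ϖ φ(ζt) = ϖ φ(t)`; injectivity of `ϖ` on the representative
and of `φ` then yields `ζ = 1`. -/
theorem IsTangentParam.isPlaneBranch {m : ℕ} {φ v : ℂ → Fin n → ℂ} (h : IsTangentParam P m φ v)
    {W N : Set (Fin n → ℂ)} {ϖ : (Fin n → ℂ) →L[ℂ] (Fin 2 → ℂ)} (hW : ∀ᶠ t in 𝓝 0, φ t ∈ W)
    (hN : N ∈ 𝓝 (0 : Fin n → ℂ)) (hinj : Set.InjOn ϖ (W ∩ N)) (hϖ : ∀ᶠ t in 𝓝 0, ϖ (v t) 0 = 1) :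
    IsPlaneBranch (O.along (fun t => ϖ (φ t)) ((ϖ.analyticAt _).comp h.analyticAt)
      (by rw [h.map_zero, map_zero])) m
      (A.mk (fun t => ϖ (v t) 1)
        (analyticAt_pi_iff.1 ((ϖ.analyticAt _).comp h.analyticAt_dir) 1)) := by
  refine ⟨h.ne_zero, ?_, ?_, fun k hk hkm hconj => ?_⟩
  · refine (h.along_lin ((ContinuousLinearMap.proj 0).comp ϖ)).trans ?_
    conv_rhs => rw [← mul_one (A.X ^ m)]
    congr 1
    rw [A.one_eq, A.mk_eq_mk]
    exact hϖ
  · exact h.along_lin ((ContinuousLinearMap.proj 1).comp ϖ)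
  · set ζ := zetaRoot m ^ k with hζ
    rw [conj, rot_mk, A.mk_eq_mk] at hconj
    have hrot : Tendsto (fun t : ℂ => ζ * t) (𝓝 0) (𝓝 0) := by
      have h1 : Continuous fun t : ℂ => ζ * t := by fun_prop
      simpa only [mul_zero] using h1.tendsto 0
    obtain ⟨U, hU, hφU⟩ := h.injOn
    have h0 : ∀ᶠ t in 𝓝 (0 : ℂ), φ t = t ^ m • v t ∧ ϖ (v t) 0 = 1 ∧ φ t ∈ W ∩ N ∧ t ∈ U :=
      h.eventually_eq.and (hϖ.and ((hW.and (h.tendsto_zero.eventually hN)).and hU))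
    have h1 : ∀ᶠ t in 𝓝[≠] (0 : ℂ), ζ * t = t := by
      filter_upwards [(h0.and ((hrot.eventually h0).and hconj)).filter_mono nhdsWithin_le_nhds]
        with t ⟨⟨a1, a2, a3, a4⟩, ⟨b1, b2, b3, b4⟩, hc⟩
      refine hφU b4 a4 (hinj b3 a3 ?_)
      rw [a1, b1, map_smul, map_smul, mul_pow, hζ, zetaRoot_pow_pow h.ne_zero, one_mul]
      congr 1
      funext i
      fin_cases i
      · exact b2.trans a2.symm
      · exact hc
    obtain ⟨t, ht, ht0⟩ := (h1.and self_mem_nhdsWithin).exists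
    have h2 : ζ = 1 := mul_right_cancel₀ ht0 (ht.trans (one_mul t).symm)
    exact (isPrimitiveRoot_zetaRoot h.ne_zero).pow_ne_one_of_pos_of_lt hk.ne' hkm h2

/-- Equality would give `φ'(tᵐ) = φ(ζ tᵐ')` by injectivity of `ϖ`: the branches share an arc, and
germs vanishing on the first vanish on the second. -/
theorem IsTangentParam.powSubst_ne {m m' : ℕ} {φ v φ' v' : ℂ → Fin n → ℂ}
    (h : IsTangentParam P m φ v) (h' : IsTangentParam Q m' φ' v') (hPQ : ¬ P ≤ Q)
    {W N : Set (Fin n → ℂ)} {ϖ : (Fin n → ℂ) →L[ℂ] (Fin 2 → ℂ)} (hW : ∀ᶠ t in 𝓝 0, φ t ∈ W)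
    (hW' : ∀ᶠ t in 𝓝 0, φ' t ∈ W) (hN : N ∈ 𝓝 (0 : Fin n → ℂ)) (hinj : Set.InjOn ϖ (W ∩ N))
    (hϖ : ∀ᶠ t in 𝓝 0, ϖ (v t) 0 = 1) (hϖ' : ∀ᶠ t in 𝓝 0, ϖ (v' t) 0 = 1) (k : ℕ) :
    powSubst m h.ne_zero (A.mk (fun t => ϖ (v' t) 1)
        (analyticAt_pi_iff.1 ((ϖ.analyticAt _).comp h'.analyticAt_dir) 1)) ≠
      powSubst m' h'.ne_zero (conj m (A.mk (fun t => ϖ (v t) 1)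
        (analyticAt_pi_iff.1 ((ϖ.analyticAt _).comp h.analyticAt_dir) 1)) k) := by
  intro heq
  set ζ := zetaRoot m ^ k with hζ
  rw [conj, rot_mk, powSubst_mk, powSubst_mk, A.mk_eq_mk] at heq
  have ht' : Tendsto (fun t : ℂ => t ^ m) (𝓝 0) (𝓝 0) := by
    simpa only [zero_pow h.ne_zero] using (continuous_pow (M := ℂ) m).tendsto 0
  have ht : Tendsto (fun t : ℂ => ζ * t ^ m') (𝓝 0) (𝓝 0) := by
    have h1 : Continuous fun t : ℂ => ζ * t ^ m' := by fun_prop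
    simpa only [zero_pow h'.ne_zero, mul_zero] using h1.tendsto 0
  have key : ∀ᶠ t in 𝓝 (0 : ℂ), φ' (t ^ m) = φ (ζ * t ^ m') := by
    filter_upwards [heq, ht.eventually h.eventually_eq, ht'.eventually h'.eventually_eq,
      ht.eventually hϖ, ht'.eventually hϖ', ht.eventually hW, ht'.eventually hW',
      ht.eventually (h.tendsto_zero.eventually hN), ht'.eventually (h'.tendsto_zero.eventually hN)]
      with t h0 h1 h2 h3 h4 h5 h6 h7 h8
    refine hinj ⟨h6, h8⟩ ⟨h5, h7⟩ ?_
    rw [h1, h2, map_smul, map_smul, mul_pow, hζ, zetaRoot_pow_pow h.ne_zero, one_mul, ← pow_mul,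
      ← pow_mul, mul_comm m']
    congr 1
    funext i
    fin_cases i
    · exact h4.trans h3.symm
    · exact h0
  refine hPQ fun f hf => ?_
  obtain ⟨f, hfa, rfl⟩ := O.exists_mk f
  rw [← h.ker_eq, RingHom.mem_ker, O.along_mk, A.mk_eq_zero] at hf
  rw [← h'.ker_eq, RingHom.mem_ker, ← map_eq_zero_iff _ (powSubst_injective m h.ne_zero),
    O.along_mk, powSubst_mk, A.mk_eq_zero]
  filter_upwards [key, ht.eventually hf] with t h1 h2
  rw [h1, h2]

/-- The image of `O n` in `ℂ{t}` contains that of `O 2`, so its colength is finite. -/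
theorem IsTangentParam.multiplicity_eq_of_isPlaneBranch {m : ℕ} {φ v : ℂ → Fin n → ℂ}
    (h : IsTangentParam P m φ v) {ϖ : (Fin n → ℂ) →L[ℂ] (Fin 2 → ℂ)} {c : A}
    (hb : IsPlaneBranch (O.along (fun t => ϖ (φ t)) ((ϖ.analyticAt _).comp h.analyticAt)
      (by rw [h.map_zero, map_zero])) m c) : multiplicity P = m := by
  refine h.multiplicity_eq (ne_top_of_le_ne_top hb.length_quotient_range_ne_top
    (length_quotient_le ?_))
  rintro _ ⟨f, rfl⟩
  exact ⟨pullback ϖ f, (along_comp ϖ h.analyticAt h.map_zero f).symm⟩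

/-- The intersection multiplicity of the generic projections of two branches. -/
theorem exists_intersectionMultiplicity_eq {W : Set (Fin n → ℂ)} (hW : IsRepresentative I W)
    {π : (Fin n → ℂ) →L[ℂ] (Fin 2 → ℂ)} (hπ : ∀ v ∈ coneC5 I, π v = 0 → v = 0)
    (hP : O.IsCurvePrime P) (hQ : O.IsCurvePrime Q) (hIP : I ≤ P) (hIQ : I ≤ Q) (hPQ : ¬ P ≤ Q) :
    ∃ m m' d : ℕ, multiplicity P = m ∧ multiplicity Q = m' ∧
      intersectionMultiplicity (imageIdeal π P) (imageIdeal π Q) = d ∧ m * m' ≤ d ∧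
      (d = m * m' ↔
        ¬ ∃ L : Submodule ℂ (Fin n → ℂ), IsTangentLine P L ∧ IsTangentLine Q L) := by
  obtain ⟨φ₀, hφ₀⟩ := hP.exists_isParam
  obtain ⟨φ₀', hφ₀'⟩ := hQ.exists_isParam
  obtain ⟨m, v₀, h₀⟩ := hφ₀.exists_isTangentParam
  obtain ⟨m', v₀', h₀'⟩ := hφ₀'.exists_isTangentParam
  have hdir {P : Ideal (O n)} {m : ℕ} {φ v : ℂ → Fin n → ℂ} (h : IsTangentParam P m φ v)
      (hIP : I ≤ P) : v 0 ∈ coneC5 I := by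
    -- With `β = 0` the second point is the origin: tangents are limits of secants through `0`.
    have h1 := h.sub_mem_coneC5 hW hIP hIP h 1 0
    rwa [one_pow, zero_pow h.ne_zero, one_smul, zero_smul, sub_zero] at h1
  -- One linear form nonzero on both tangents is needed, so that both images are written over the
  -- same coordinate `x`.
  obtain ⟨s, hs, hs'⟩ := exists_shear
    (fun h => h₀.dir_ne_zero (hπ _ (hdir h₀ hIP) h))
    (fun h => h₀'.dir_ne_zero (hπ _ (hdir h₀' hIQ) h))
  let ϖ := (shear s).comp π
  have hϖ (v : Fin n → ℂ) (hv : v ∈ coneC5 I) (h0 : ϖ v = 0) : v = 0 := by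
    apply hπ v hv
    have h1 := shear_shear (-s) (π v)
    rw [neg_neg] at h1
    rw [← h1]
    exact (congrArg (shear (-s)) h0).trans (map_zero _)
  let l : (Fin n → ℂ) →L[ℂ] ℂ := (ContinuousLinearMap.proj 0).comp ϖ
  obtain ⟨φ, v, h, hl, -⟩ := h₀.exists_reparam l hs
  obtain ⟨φ', v', h', hl', -⟩ := h₀'.exists_reparam l hs'
  obtain ⟨N, hN, hinj⟩ := exists_injOn_of_isRepresentative hW hϖ
  have hφW := h.eventually_mem hW hIP
  have hφW' := h'.eventually_mem hW hIQ
  have hb := h.isPlaneBranch hφW hN hinj hl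
  have hb' := h'.isPlaneBranch hφW' hN hinj hl'
  obtain ⟨d, hd, hle, hiff⟩ := hb.intersectionMultiplicity_eq hb'
    (h.powSubst_ne h' hPQ hφW hφW' hN hinj hl hl')
  refine ⟨m, m', d, h.multiplicity_eq_of_isPlaneBranch hb, h'.multiplicity_eq_of_isPlaneBranch hb',
    ?_, hle, hiff.trans (not_congr ?_)⟩
  · have h2 (x : Fin 2 → ℂ) : shear (-s) (shear s x) = x := by
      simpa only [neg_neg] using shear_shear (-s) x
    rw [← intersectionMultiplicity_comap (shear_shear s) h2, ← hd, ← h.imageIdeal_eq ϖ,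
      ← h'.imageIdeal_eq ϖ]
    have h3 (P : Ideal (O n)) : (imageIdeal π P).comap (pullback (shear s)) = imageIdeal ϖ P := by
      ext f
      obtain ⟨f, hf, rfl⟩ := O.exists_mk f
      exact Iff.rfl
    rw [h3, h3]
  · rw [exists_isTangentLine_iff h h' hP.fg hQ.fg hl hl', A.ev_mk, A.ev_mk]
    constructor
    · intro h1
      -- The difference of the normalized tangents lies in `C₅`; both coordinates of its image
      -- vanish, so genericity makes it zero.
      have h2 := h.sub_mem_coneC5 hW hIP hIQ h' 1 1
      rw [one_pow, one_pow, one_smul, one_smul] at h2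
      refine sub_eq_zero.1 (hϖ _ h2 ?_)
      rw [map_sub, sub_eq_zero]
      funext i
      fin_cases i
      · exact hl.self_of_nhds.trans hl'.self_of_nhds.symm
      · exact h1
    · intro h1
      rw [h1]

end projection

end

end CurveGerm

/-! ### Summation over pairs of branches -/

theorem mainTheorem8 {n r : ℕ} (I : Ideal (CurveGerm.O n))
    (hI : CurveGerm.IsGenericallyReducedCurve I)
    (P : Fin r → Ideal (CurveGerm.O n)) (hPinj : Function.Injective P)
    (hP : Set.range P = I.minimalPrimes) (hr : 2 ≤ r)
    (π : (Fin n → ℂ) →L[ℂ] (Fin 2 → ℂ)) (hπ : CurveGerm.IsC5Generic I π) :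
    CurveGerm.sInvariant P π ≠ ⊤ ∧
    (∑ p : Fin r × Fin r with p.1 < p.2,
        CurveGerm.multiplicity (P p.1) * CurveGerm.multiplicity (P p.2)) ≤
      (CurveGerm.sInvariant P π : ℝ≥0∞) ∧
    ((CurveGerm.sInvariant P π : ℝ≥0∞) =
        ∑ p : Fin r × Fin r with p.1 < p.2,
          CurveGerm.multiplicity (P p.1) * CurveGerm.multiplicity (P p.2) ↔
      ∀ i j : Fin r, i ≠ j →
        ¬ ∃ L : Submodule ℂ (Fin n → ℂ),
          CurveGerm.IsTangentLine (P i) L ∧ CurveGerm.IsTangentLine (P j) L) := by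
  obtain ⟨k, U, f, hm, -⟩ := hI.2
  have hW : CurveGerm.IsRepresentative I {x ∈ U | ∀ i, f i x = 0} := ⟨k, U, f, hm, rfl⟩
  have hmin (i : Fin r) : P i ∈ I.minimalPrimes := hP ▸ Set.mem_range_self i
  have hpair (p : Fin r × Fin r) (hp : p.1 < p.2) := CurveGerm.exists_intersectionMultiplicity_eq
    hW (fun v hv hv0 => hπ.2.subset ⟨hv0, hv⟩)
    (CurveGerm.O.IsCurvePrime.of_mem_minimalPrimes hI.1 (hmin p.1))
    (CurveGerm.O.IsCurvePrime.of_mem_minimalPrimes hI.1 (hmin p.2))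
    (hmin p.1).1.2 (hmin p.2).1.2
    (fun hle => hp.ne (hPinj (le_antisymm hle ((hmin p.2).2 (hmin p.1).1 hle))))
  choose! m m' d h1 h2 h3 h4 h5 using hpair
  have hs : CurveGerm.sInvariant P π = ((∑ p : Fin r × Fin r with p.1 < p.2, d p : ℕ) : ℕ∞) := by
    rw [CurveGerm.sInvariant, Nat.cast_sum]
    exact Finset.sum_congr rfl fun p hp => h3 p (Finset.mem_filter.1 hp).2
  have hmm : ∑ p : Fin r × Fin r with p.1 < p.2,
      CurveGerm.multiplicity (P p.1) * CurveGerm.multiplicity (P p.2) =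
      ((∑ p : Fin r × Fin r with p.1 < p.2, m p * m' p : ℕ) : ℝ≥0∞) := by
    rw [Nat.cast_sum]
    refine Finset.sum_congr rfl fun p hp => ?_
    rw [h1 p (Finset.mem_filter.1 hp).2, h2 p (Finset.mem_filter.1 hp).2, Nat.cast_mul]
  rw [hs, hmm, ENat.toENNReal_coe, Nat.cast_le, Nat.cast_inj]
  have hle (p) (hp : p ∈ Finset.univ.filter fun p : Fin r × Fin r => p.1 < p.2) :
      m p * m' p ≤ d p := h4 p (Finset.mem_filter.1 hp).2
  refine ⟨ENat.natCast_ne_top _, Finset.sum_le_sum hle, ?_⟩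
  -- With termwise inequalities between finite sums, equality of the sums is equality for every
  -- pair.
  rw [eq_comm, Finset.sum_eq_sum_iff_of_le hle]
  constructor
  · intro h i j hij
    rcases lt_or_gt_of_ne hij with hlt | hlt
    · exact (h5 (i, j) hlt).1 (h (i, j) (by simpa using hlt)).symm
    · rintro ⟨L, hL, hL'⟩
      exact (h5 (j, i) hlt).1 (h (j, i) (by simpa using hlt)).symm ⟨L, hL', hL⟩
  · intro h p hp
    have hlt := (Finset.mem_filter.1 hp).2
    exact ((h5 p hlt).2 (h p.1 p.2 hlt.ne)).symm
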